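/- Let $(K,J,g)$ be a (non-empty) compact Kähler manifold of complex dimension $k$, and let $\psi:K\to K$ be a Kähler isometry, i.e. a holomorphic diffeomorphism with $\psi^*g=g$. Let $f=(\psi,\mathrm{Id}_{\mathbb S^3})$, acting on $K\times\mathbb S^3$, and let $M_f=(K\times\mathbb S^3)_f$ be its mapping torus, i.e. the smooth manifold obtained as the quotient of $K\times\mathbb S^3\times\mathbb R$ by the $\mathbb Z$-action $n\cdot(p,q,t)=(\psi^n(p),q,t+n)$. Then $M_f$ admits a split twisted generalized Kähler structure $(I_\pm,h,\Omega_\pm)$ for which, moreover, $I_+$ and $I_-$ induce opposite orientations on $M_f$. That is, there are a Riemannian metric $h$ and two (integrable) complex structures $I_+$, $I_-$ on $M_f$, both compatible with $h$ (that is, $h(I_\pm\cdot,I_\pm\cdot)=h$), such that, with $\Omega_\pm(X,Y)=h(I_\pm X,Y)$ and $d^c_\pm\Omega_\pm(X,Y,Z)=-d\Omega_\pm(I_\pm X,I_\pm Y,I_\pm Z)$: 1. (generalized Kähler) $d^c_+\Omega_+=-d^c_-\Omega_-$ and $dd^c_+\Omega_+=0$; 2. (split) $[I_+,I_-]=0$,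 and $I_+\neq\pm I_-$ at every point; 3. (twisted) the class $[d^c_+\Omega_+]$ in the de Rham cohomology $H^3(M_f,\mathbb R)$ is non-zero; 4. at every point of $M_f$, the orientations of the tangent space induced by $I_+$ and $I_-$ are opposite. -/

import Mathlib

set_option maxSynthPendingDepth 3

open Set Function
open scoped Manifold Topology ContDiff

noncomputable section

section MappingTorus

variable {E : Type*} [NormedAddCommGroup E] [NormedSpace ℝ E] {H : Type*} [TopologicalSpace H]
  {I : ModelWithCorners ℝ E H} {M : Type*} [TopologicalSpace M] [ChartedSpace H M]

/-- The action of `ℤ` on `M × ℝ` given by `n • (p, t) = (fⁿ p, t + n)`. -/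
@[reducible]
def suspensionAction (f : M ≃ₘ⟮I, I⟯ M) : AddAction ℤ (M × ℝ) where
  vadd n x := ((f.toEquiv ^ n : Equiv.Perm M) x.1, x.2 + n)
  zero_vadd x := Prod.ext rfl (by change x.2 + ((0 : ℤ) : ℝ) = x.2; simp)
  add_vadd m n x := by
    change (((f.toEquiv ^ (m + n) : Equiv.Perm M) x.1, x.2 + ((m + n : ℤ) : ℝ)) : M × ℝ)
      = ((f.toEquiv ^ m : Equiv.Perm M) ((f.toEquiv ^ n : Equiv.Perm M) x.1), x.2 + n + m)
    rw [zpow_add, Equiv.Perm.mul_apply]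
    refine Prod.ext rfl ?_
    push_cast
    ring

/-- The orbit equivalence relation of the action `n • (p, t) = (fⁿ p, t + n)` on `M × ℝ`. -/
@[reducible]
def suspensionSetoid (f : M ≃ₘ⟮I, I⟯ M) : Setoid (M × ℝ) :=
  @AddAction.orbitRel ℤ (M × ℝ) _ (suspensionAction f)

/-- The mapping torus `M_f`: the quotient of `M × ℝ` by the action `n • (p, t) = (fⁿ p, t + n)`. -/
def MappingTorus (f : M ≃ₘ⟮I, I⟯ M) : Type _ := Quotient (suspensionSetoid f)

namespace MappingTorus

variable (f : M ≃ₘ⟮I, I⟯ M)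

/-- The quotient topology. -/
instance : TopologicalSpace (MappingTorus f) :=
  inferInstanceAs (TopologicalSpace (Quotient (suspensionSetoid f)))

/-- The quotient map `M × ℝ → M_f`. -/
def mk (x : M × ℝ) : MappingTorus f := Quotient.mk (suspensionSetoid f) x

lemma contMDiff_zpow (n : ℤ) : ContMDiff I I ∞ ((f.toEquiv ^ n : Equiv.Perm M) : M → M) := by
  have hp : ContMDiff I I ∞ (f.toEquiv : M → M) := f.contMDiff_toFun
  have hm : ContMDiff I I ∞ (f.toEquiv.symm : M → M) := f.contMDiff_invFun
  induction n with
  | zero => exact contMDiff_id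
  | succ n ih =>
    rw [zpow_add_one]
    exact ih.comp hp
  | pred n ih =>
    rw [zpow_sub_one]
    exact ih.comp hm

lemma contMDiff_vadd (n : ℤ) :
    letI := suspensionAction f
    ContMDiff (I.prod 𝓘(ℝ, ℝ)) (I.prod 𝓘(ℝ, ℝ)) ∞ (fun x : M × ℝ => n +ᵥ x) := by
  refine ContMDiff.prodMk ((contMDiff_zpow f n).comp contMDiff_fst) ?_
  have h : ContMDiff 𝓘(ℝ, ℝ) 𝓘(ℝ, ℝ) ∞ (fun t : ℝ => t + (n : ℝ)) :=
    (contDiff_id.add contDiff_const).contMDiff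
  exact h.comp contMDiff_snd

lemma isAddQuotientCoveringMap_mk [T2Space M] [LocallyCompactSpace M] :
    letI := suspensionAction f
    IsAddQuotientCoveringMap (mk f) ℤ := by
  let := suspensionAction f
  have h0 : ∀ (n : ℤ) (x : M × ℝ), (n +ᵥ x).2 = x.2 + n := fun _ _ => rfl
  have : ContinuousConstVAdd ℤ (M × ℝ) := ⟨fun n => (contMDiff_vadd f n).continuous⟩
  have : IsCancelVAdd ℤ (M × ℝ) :=
    { left_cancel' := fun n x y h => (AddAction.injective n) h
      right_cancel' := fun m n x h => by
        have := congrArg Prod.snd h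
        rw [h0, h0] at this
        exact_mod_cast add_left_cancel this }
  have : ProperlyDiscontinuousVAdd ℤ (M × ℝ) := ⟨by
    intro K L hK hL
    have hD : IsCompact ((fun p : ℝ × ℝ => p.1 - p.2) '' ((Prod.snd '' L) ×ˢ (Prod.snd '' K))) :=
      ((hL.image continuous_snd).prod (hK.image continuous_snd)).image (by fun_prop)
    obtain ⟨r, hr⟩ := hD.isBounded.subset_closedBall 0
    refine (Set.finite_Icc (-⌈r⌉) ⌈r⌉).subset ?_
    rintro n ⟨_, ⟨x, hx, rfl⟩, hxL⟩
    have h1 := hr ⟨((n +ᵥ x).2, x.2), ⟨⟨_, hxL, rfl⟩, ⟨_, hx, rfl⟩⟩, rfl⟩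
    simp only [h0, Metric.mem_closedBall, dist_zero_right, Real.norm_eq_abs] at h1
    rw [add_sub_cancel_left, abs_le] at h1
    have h2 := Int.le_ceil r
    constructor
    · have : (-(⌈r⌉ : ℝ)) ≤ n := by linarith
      exact_mod_cast this
    · have : (n : ℝ) ≤ ⌈r⌉ := by linarith
      exact_mod_cast this⟩
  exact isAddQuotientCoveringMap_quotientMk_of_properlyDiscontinuousVAdd

lemma isLocalHomeomorph_mk [T2Space M] [LocallyCompactSpace M] : IsLocalHomeomorph (mk f) := by
  let := suspensionAction f
  exact (isAddQuotientCoveringMap_mk f).isCoveringMap.isLocalHomeomorph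

lemma surjective_mk : Surjective (mk f) := Quotient.mk_surjective

/-- The charts of `M_f` are the local inverses of the quotient map `M × ℝ → M_f` followed by charts
of `M × ℝ`. -/
instance [T2Space M] [LocallyCompactSpace M] : ChartedSpace (ModelProd H ℝ) (MappingTorus f) :=
  (isLocalHomeomorph_mk f).chartedSpaceOfRightInverse (rightInverse_surjInv (surjective_mk f))

lemma contMDiffOn_localInverse_comp_mk [T2Space M] [LocallyCompactSpace M] (x : M × ℝ) :
    ContMDiffOn (I.prod 𝓘(ℝ, ℝ)) (I.prod 𝓘(ℝ, ℝ)) ∞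
      (fun y => (isLocalHomeomorph_mk f).localInverseAt x (mk f y))
      (mk f ⁻¹' ((isLocalHomeomorph_mk f).localInverseAt x).source) := by
  let := suspensionAction f
  intro y hy
  set s := (isLocalHomeomorph_mk f).localInverseAt x with hs
  have hsymm : ∀ z, s.symm z = mk f z := fun z => by rw [hs, IsLocalHomeomorph.localInverseAt_symm]
  have hz : mk f (s (mk f y)) = mk f y := by rw [← hsymm]; exact s.left_inv hy
  obtain ⟨n, hn⟩ := (isAddQuotientCoveringMap_mk f).apply_eq_iff_mem_orbit.mp hz
  have hn' : n +ᵥ y = s (mk f y) := hn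
  have hev : ∀ᶠ w in 𝓝 y, n +ᵥ w ∈ s.target := by
    refine (contMDiff_vadd f n).continuous.continuousAt.preimage_mem_nhds ?_
    refine s.open_target.mem_nhds ?_
    rw [hn']
    exact s.map_source hy
  refine (((contMDiff_vadd f n).contMDiffAt (x := y)).congr_of_eventuallyEq ?_).contMDiffWithinAt
  filter_upwards [hev] with w hw
  have : mk f w = mk f (n +ᵥ w) := ((isAddQuotientCoveringMap_mk f).map_vadd n).symm
  rw [this, ← hsymm, s.right_inv hw]

/-- The mapping torus of a diffeomorphism is a smooth manifold. -/
instance [T2Space M] [LocallyCompactSpace M] [IsManifold I ∞ M] :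
    IsManifold (I.prod 𝓘(ℝ, ℝ)) ∞ (MappingTorus f) := by
  refine isManifold_of_contDiffOn _ _ _ ?_
  rintro _ _ ⟨q, rfl⟩ ⟨q', rfl⟩
  set x := surjInv (surjective_mk f) q
  set x' := surjInv (surjective_mk f) q'
  rw [← contMDiffOn_iff_contDiffOn]
  have h1 := (contMDiffOn_chart_symm (I := I.prod 𝓘(ℝ, ℝ)) (n := ∞) (x := x))
  have h2 := (contMDiffOn_chart (I := I.prod 𝓘(ℝ, ℝ)) (n := ∞) (x := x'))
  have h3 := contMDiffOn_localInverse_comp_mk f x'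
  have h4 := (I.prod 𝓘(ℝ, ℝ)).contMDiffOn_symm (n := ∞)
  have h5 := (I.prod 𝓘(ℝ, ℝ)).contMDiff (n := ∞)
  have key := h5.comp_contMDiffOn ((h2.comp' h3).comp' (h1.comp' h4))
  refine key.congr_mono ?_ ?_
  · intro y hy
    simp [OpenPartialHomeomorph.trans_symm_eq_symm_trans_symm] 
  · rintro y ⟨hy, hy'⟩
    simp only [OpenPartialHomeomorph.trans_symm_eq_symm_trans_symm, mem_preimage,
      OpenPartialHomeomorph.trans_source, OpenPartialHomeomorph.symm_source, mem_inter_iff,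
      OpenPartialHomeomorph.coe_trans, IsLocalHomeomorph.localInverseAt_symm, comp_apply] at hy ⊢
    exact ⟨⟨hy', hy.1.1⟩, hy.2⟩

end MappingTorus

end MappingTorus

section Forms

variable {E : Type*} [NormedAddCommGroup E] [NormedSpace ℝ E] {H : Type*} [TopologicalSpace H]
  (I : ModelWithCorners ℝ E H) (M : Type*) [TopologicalSpace M] [ChartedSpace H M]

/-- (Not necessarily smooth) differential `n`-forms on a manifold `M`. -/
abbrev DiffForm (n : ℕ) : Type _ := ∀ x : M, TangentSpace I x [⋀^Fin n]→L[ℝ] ℝ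

namespace DiffForm

variable {I M} {n : ℕ}

/-- The expression of a differential form in the preferred chart at `x₀`: its pullback under the
inverse of the chart. It is meaningful on the target of the chart, for manifolds without boundary. -/
def inChart (α : DiffForm I M n) (x₀ : M) (y : E) : E [⋀^Fin n]→L[ℝ] ℝ :=
  (α ((extChartAt I x₀).symm y)).compContinuousLinearMap
    (mfderiv 𝓘(ℝ, E) I (extChartAt I x₀).symm y)

/-- A differential form is smooth if its expressions in charts are. -/
def IsSmooth (α : DiffForm I M n) : Prop :=
  ∀ x₀ : M, ContDiffOn ℝ ∞ (α.inChart x₀) (extChartAt I x₀).target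

/-- The exterior derivative of a differential form on a manifold, computed at each point in the
preferred chart at that point. -/
def extDeriv (α : DiffForm I M n) : DiffForm I M (n + 1) := fun x =>
  (_root_.extDeriv (α.inChart x) (extChartAt I x x)).compContinuousLinearMap
    (mfderiv I 𝓘(ℝ, E) (extChartAt I x) x)

lemma inChart_add (α β : DiffForm I M n) (x₀ : M) :
    (α + β).inChart x₀ = α.inChart x₀ + β.inChart x₀ := rfl

lemma inChart_smul (c : ℝ) (α : DiffForm I M n) (x₀ : M) :
    (c • α).inChart x₀ = c • α.inChart x₀ := rfl

lemma inChart_zero (x₀ : M) : (0 : DiffForm I M n).inChart x₀ = 0 := rfl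

lemma isSmooth_zero : (0 : DiffForm I M n).IsSmooth := fun x₀ => by
  rw [inChart_zero]
  exact contDiffOn_const

lemma IsSmooth.add {α β : DiffForm I M n} (hα : α.IsSmooth) (hβ : β.IsSmooth) :
    (α + β).IsSmooth := fun x₀ => (hα x₀).add (hβ x₀)

lemma IsSmooth.smul (c : ℝ) {α : DiffForm I M n} (hα : α.IsSmooth) : (c • α).IsSmooth :=
  fun x₀ => (hα x₀).const_smul c

lemma extDeriv_zero : (0 : DiffForm I M n).extDeriv = 0 := by
  funext x
  simp only [extDeriv, inChart_zero]
  have : _root_.extDeriv (0 : E → E [⋀^Fin n]→L[ℝ] ℝ) (extChartAt I x x) = 0 := by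
    simpa using _root_.extDeriv_smul (0 : ℝ) (0 : E → E [⋀^Fin n]→L[ℝ] ℝ) (x := extChartAt I x x)
  rw [this]
  rfl

lemma extDeriv_smul (c : ℝ) (α : DiffForm I M n) : (c • α).extDeriv = c • α.extDeriv := by
  funext x
  simp only [extDeriv, inChart_smul, _root_.extDeriv_smul]
  rfl

section

variable [I.Boundaryless]

lemma IsSmooth.differentiableAt {α : DiffForm I M n} (hα : α.IsSmooth) (x : M) :
    DifferentiableAt ℝ (α.inChart x) (extChartAt I x x) :=
  ((hα x).contDiffAt (extChartAt_target_mem_nhds x)).differentiableAt (by simp)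

lemma extDeriv_add {α β : DiffForm I M n} (hα : α.IsSmooth) (hβ : β.IsSmooth) :
    (α + β).extDeriv = α.extDeriv + β.extDeriv := by
  funext x
  simp only [extDeriv, inChart_add, _root_.extDeriv_add (hα.differentiableAt x)
    (hβ.differentiableAt x)]
  rfl

variable (I M)

/-- The space of smooth closed `n`-forms. -/
def closedForms (n : ℕ) : Submodule ℝ (DiffForm I M n) where
  carrier := {α | α.IsSmooth ∧ α.extDeriv = 0}
  add_mem' := by
    rintro α β ⟨hα, hα'⟩ ⟨hβ, hβ'⟩
    exact ⟨hα.add hβ, by rw [extDeriv_add hα hβ, hα', hβ', add_zero]⟩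
  zero_mem' := ⟨isSmooth_zero, extDeriv_zero⟩
  smul_mem' := by
    rintro c α ⟨hα, hα'⟩
    exact ⟨hα.smul c, by rw [extDeriv_smul, hα', smul_zero]⟩

/-- The space of exact `n`-forms, i.e. of exterior derivatives of smooth `(n-1)`-forms. -/
def exactForms : (n : ℕ) → Submodule ℝ (DiffForm I M n)
  | 0 => ⊥
  | n + 1 =>
    { carrier := {η | ∃ α : DiffForm I M n, α.IsSmooth ∧ α.extDeriv = η}
      add_mem' := by
        rintro _ _ ⟨α, hα, rfl⟩ ⟨β, hβ, rfl⟩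
        exact ⟨α + β, hα.add hβ, extDeriv_add hα hβ⟩
      zero_mem' := ⟨0, isSmooth_zero, extDeriv_zero⟩
      smul_mem' := by
        rintro c _ ⟨α, hα, rfl⟩
        exact ⟨c • α, hα.smul c, extDeriv_smul c α⟩ }

/-- The `n`-th de Rham cohomology of `M`: closed forms modulo exact forms. -/
abbrev deRhamCohomology (n : ℕ) : Type _ :=
  closedForms I M n ⧸ (exactForms I M n).comap (closedForms I M n).subtype

end

end DiffForm

end Forms

section Hermitian

variable {E : Type*} [NormedAddCommGroup E] [NormedSpace ℝ E] {H : Type*} [TopologicalSpace H]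
  (I : ModelWithCorners ℝ E H) (M : Type*) [TopologicalSpace M] [ChartedSpace H M]
  [IsManifold I ∞ M]

/-- A complex structure on a smooth manifold `M`: a smooth field `J` of endomorphisms of the tangent
spaces with `J² = -1` that is integrable, i.e. around each point there are smooth coordinates with
values in some `ℂⁿ` whose differential turns `J` into multiplication by `i`. -/
structure ComplexStructure where
  J (x : M) : TangentSpace I x →L[ℝ] TangentSpace I x
  J_J (x : M) (v : TangentSpace I x) : J x (J x v) = -v
  contMDiff : ContMDiff I (I.prod 𝓘(ℝ, E →L[ℝ] E)) ∞
    (fun x => Bundle.TotalSpace.mk' (E →L[ℝ] E)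
      (E := fun x : M => TangentSpace I x →L[ℝ] TangentSpace I x) x (J x))
  integrable (x : M) : ∃ (n : ℕ) (φ : OpenPartialHomeomorph M (Fin n → ℂ)), x ∈ φ.source ∧
    ContMDiffOn I 𝓘(ℝ, Fin n → ℂ) ∞ φ φ.source ∧
    ContMDiffOn 𝓘(ℝ, Fin n → ℂ) I ∞ φ.symm φ.target ∧
    ∀ y ∈ φ.source, ∀ v : TangentSpace I y,
      (mfderiv I 𝓘(ℝ, Fin n → ℂ) φ y (J y v) : Fin n → ℂ)
        = Complex.I • (show Fin n → ℂ from mfderiv I 𝓘(ℝ, Fin n → ℂ) φ y v)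

/-- A smooth Riemannian metric on `M`. -/
abbrev SmoothMetric : Type _ :=
  Bundle.ContMDiffRiemannianMetric I ∞ E (fun x : M => TangentSpace I x)

/-- A Hermitian structure on `M`: a Riemannian metric `g` and a complex structure `J` with
`g(J·, J·) = g`. -/
structure HermitianStructure where
  metric : SmoothMetric I M
  cplx : ComplexStructure I M
  compatible (x : M) (v w : TangentSpace I x) :
    metric.inner x (cplx.J x v) (cplx.J x w) = metric.inner x v w

namespace HermitianStructure

variable {I M} (S : HermitianStructure I M)

lemma inner_J_self (x : M) (v : TangentSpace I x) : S.metric.inner x (S.cplx.J x v) v = 0 := by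
  have h := S.compatible x (S.cplx.J x v) v
  rw [S.cplx.J_J, map_neg, neg_apply, S.metric.symm] at h
  linarith

/-- The fundamental form `ω(v, w) = g(J v, w)`. -/
def fundamentalForm : DiffForm I M 2 := fun x =>
  { toFun := fun v => S.metric.inner x (S.cplx.J x (v 0)) (v 1)
    map_update_add' := by
      intro inst v i a b
      rw [Subsingleton.elim inst (instDecidableEqFin 2)]
      fin_cases i <;> simp [Function.update]
    map_update_smul' := by
      intro inst v i c a
      rw [Subsingleton.elim inst (instDecidableEqFin 2)]
      fin_cases i <;> simp [Function.update]
    cont := by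
      have h : Continuous fun p : E × E =>
          (show E →L[ℝ] E →L[ℝ] ℝ from (S.metric.inner x).comp (S.cplx.J x)) p.1 p.2 :=
        ContinuousLinearMap.continuous₂ _
      have h' : Continuous fun v : Fin 2 → E => (v 0, v 1) := by fun_prop
      exact h.comp h'
    map_eq_zero_of_eq' := by
      intro v i j hv hij
      have h01 : v 0 = v 1 := by
        fin_cases i <;> fin_cases j <;> simp_all
      change S.metric.inner x (S.cplx.J x (v 0)) (v 1) = 0
      rw [← h01, inner_J_self] }

lemma fundamentalForm_apply (x : M) (v : Fin 2 → TangentSpace I x) :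
    S.fundamentalForm x v = S.metric.inner x (S.cplx.J x (v 0)) (v 1) := rfl

/-- The three-form `dᶜω = -J dω`, i.e. `(dᶜω)(u, v, w) = -dω(J u, J v, J w)`. -/
def dcFundamentalForm : DiffForm I M 3 := fun x =>
  -(S.fundamentalForm.extDeriv x).compContinuousLinearMap (S.cplx.J x)

end HermitianStructure

/-- A Kähler structure: a Hermitian structure whose fundamental form is closed. -/
structure KahlerStructure extends HermitianStructure I M where
  closed : toHermitianStructure.fundamentalForm.extDeriv = 0

/-- A diffeomorphism is holomorphic for the complex structure of `S` and an isometry for its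
metric. -/
structure KahlerStructure.IsHolomorphicIsometry {I : ModelWithCorners ℝ E H} {M : Type*}
    [TopologicalSpace M] [ChartedSpace H M] [IsManifold I ∞ M] (S : KahlerStructure I M)
    (ψ : M ≃ₘ⟮I, I⟯ M) : Prop where
  holomorphic (x : M) (v : TangentSpace I x) :
    mfderiv I I ψ x (S.cplx.J x v) = S.cplx.J (ψ x) (mfderiv I I ψ x v)
  isometry (x : M) (v w : TangentSpace I x) :
    S.metric.inner (ψ x) (mfderiv I I ψ x v) (mfderiv I I ψ x w) = S.metric.inner x v w

/-- A generalized Kähler structure `(I₊, I₋, h)`: a Riemannian metric `h` and two complex structures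
`I₊`, `I₋` compatible with `h` such that `d₊ᶜ Ω₊ = -d₋ᶜ Ω₋` and `d d₊ᶜ Ω₊ = 0`. -/
structure GeneralizedKahlerStructure where
  metric : SmoothMetric I M
  Iplus : ComplexStructure I M
  Iminus : ComplexStructure I M
  compatible_plus (x : M) (v w : TangentSpace I x) :
    metric.inner x (Iplus.J x v) (Iplus.J x w) = metric.inner x v w
  compatible_minus (x : M) (v w : TangentSpace I x) :
    metric.inner x (Iminus.J x v) (Iminus.J x w) = metric.inner x v w
  dc_plus_eq : (HermitianStructure.mk metric Iplus compatible_plus).dcFundamentalForm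
    = -(HermitianStructure.mk metric Iminus compatible_minus).dcFundamentalForm
  ddc_plus : (HermitianStructure.mk metric Iplus compatible_plus).dcFundamentalForm.extDeriv = 0

namespace GeneralizedKahlerStructure

variable {I M} (G : GeneralizedKahlerStructure I M)

/-- The torsion `d₊ᶜ Ω₊ = -d₋ᶜ Ω₋`. -/
def torsion : DiffForm I M 3 :=
  (HermitianStructure.mk G.metric G.Iplus G.compatible_plus).dcFundamentalForm

/-- The structure is split: `[I₊, I₋] = 0` and, at every point, `I₊ ≠ ± I₋`. Then the tangent bundle
is the direct sum of the two nonzero eigenbundles of the involution `I₊ I₋`. -/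
def IsSplit : Prop :=
  ∀ x : M, (G.Iplus.J x).comp (G.Iminus.J x) = (G.Iminus.J x).comp (G.Iplus.J x) ∧
    G.Iplus.J x ≠ G.Iminus.J x ∧ G.Iplus.J x ≠ -G.Iminus.J x

/-- The structure is twisted: the class of the torsion in the third de Rham cohomology is
nonzero. -/
def IsTwisted [I.Boundaryless] : Prop :=
  ∃ hT : G.torsion ∈ DiffForm.closedForms I M 3,
    (Submodule.Quotient.mk ⟨G.torsion, hT⟩ : DiffForm.deRhamCohomology I M 3) ≠ 0

end GeneralizedKahlerStructure

/-- `o` is the orientation of the real vector space `V` induced by the complex structure `J` on `V`: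
the one for which `v₁, J v₁, …, vₙ, J vₙ` is a positive basis whenever `v₁, …, vₙ` is a complex
basis. (All such real bases define the same orientation, so it suffices to have one.) -/
def IsInducedOrientation {V : Type*} [AddCommGroup V] [Module ℝ V] (J : V → V) {n : ℕ}
    (o : Orientation ℝ V (Fin n × Fin 2)) : Prop :=
  ∃ b : Module.Basis (Fin n × Fin 2) ℝ V, (∀ i, b (i, 1) = J (b (i, 0))) ∧ b.orientation = o

/-- `I₊` and `I₋` induce opposite orientations on (each tangent space of) `M`. -/
def GeneralizedKahlerStructure.InducesOppositeOrientations {I : ModelWithCorners ℝ E H} {M : Type*}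
    [TopologicalSpace M] [ChartedSpace H M] [IsManifold I ∞ M] (G : GeneralizedKahlerStructure I M) : Prop :=
  ∀ x : M, ∃ (n : ℕ) (o : Orientation ℝ (TangentSpace I x) (Fin n × Fin 2)),
    IsInducedOrientation (G.Iplus.J x) o ∧ IsInducedOrientation (G.Iminus.J x) (-o)

end Hermitian

/-- The unit sphere `S³` in `ℝ⁴`. -/
abbrev Sphere3 : Type := Metric.sphere (0 : EuclideanSpace ℝ (Fin (3 + 1))) 1

/-!
The map `(p, q, t) ↦ (p, eᵗ q)` identifies `K × S³ × ℝ` with `K × (ℝ⁴ \ {0})` and turns the deck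
transformations of the mapping torus into products of a holomorphic isometry of `K` and a dilation
of `ℝ⁴`. Hence the product of `g` with the dilation invariant metric `|z|⁻² |dz|²`, and the
complex structures `J ⊕ I_s`, descend to the mapping torus; here `s = ±1`, and `I_s` acts on `ℝ⁴ =
ℂ²` as `i` on the first factor and as `s i` on the second, so that `I₊` and `I₋` commute and
induce opposite orientations. Since `g` is Kähler, only the Hopf factor contributes to `d^c Ω`,
which is `s` times the pull-back of a closed three-form of `ℝ⁴ \ {0}` that is independent of `s`.
The integral of this form over `S³` is positive, so by Stokes' theorem it is not exact.
-/

section AlternatingMaps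

variable {𝕜 : Type*} [NontriviallyNormedField 𝕜] [CompleteSpace 𝕜]
  {E : Type*} [NormedAddCommGroup E] [NormedSpace 𝕜 E] [FiniteDimensional 𝕜 E]
  {F : Type*} [NormedAddCommGroup F] [NormedSpace 𝕜 F]
  {G : Type*} [NormedAddCommGroup G] [NormedSpace 𝕜 G]
  {X : Type*} [NormedAddCommGroup X] [NormedSpace 𝕜 X]
  {ι : Type*} [Fintype ι] {r : WithTop ℕ∞} {x : X}

lemma contDiffAt_alternating_of_forall_apply [FiniteDimensional 𝕜 G] {f : X → E [⋀^ι]→L[𝕜] G}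
    (h : ∀ v : ι → E, ContDiffAt 𝕜 r (fun y => f y v) x) : ContDiffAt 𝕜 r f x := by
  classical
  let b := Module.finBasis 𝕜 E
  let evalBasis : (E [⋀^ι]→L[𝕜] G) →ₗ[𝕜] ((ι → Fin (Module.finrank 𝕜 E)) → G) :=
    { toFun := fun f s => f (fun i => b (s i))
      map_add' := fun _ _ => rfl
      map_smul' := fun _ _ => rfl }
  have hinj : LinearMap.ker evalBasis = ⊥ := LinearMap.ker_eq_bot.2 fun f g h =>
    ContinuousAlternatingMap.toAlternatingMap_injective
      (Module.Basis.ext_alternating b fun s _ => congrFun h s)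
  obtain ⟨g, hg⟩ := evalBasis.exists_leftInverse_of_injective hinj
  have hf : f = fun y => LinearMap.toContinuousLinearMap g (evalBasis (f y)) := by
    funext y
    exact (LinearMap.congr_fun hg (f y)).symm
  rw [hf]
  exact (LinearMap.toContinuousLinearMap g).contDiff.contDiffAt.comp x
    (contDiffAt_pi.2 fun s => h _)

lemma contDiffAt_alternating_compContinuousLinearMap [FiniteDimensional 𝕜 G]
    {f : X → F [⋀^ι]→L[𝕜] G} {g : X → E →L[𝕜] F}
    (hf : ContDiffAt 𝕜 r f x) (hg : ContDiffAt 𝕜 r g x) :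
    ContDiffAt 𝕜 r (fun y => (f y).compContinuousLinearMap (g y)) x := by
  have := FiniteDimensional.complete 𝕜 G
  refine contDiffAt_alternating_of_forall_apply fun v => ?_
  have hf' : ContDiffAt 𝕜 r (fun y => (f y).toContinuousMultilinearMap) x :=
    (ContinuousAlternatingMap.toContinuousMultilinearMapCLM 𝕜 :
      (F [⋀^ι]→L[𝕜] G) →L[𝕜] _).contDiff.contDiffAt.comp x hf
  have hgv : ContDiffAt 𝕜 r (fun y => fun i : ι => g y (v i)) x :=
    contDiffAt_pi.2 fun i => hg.clm_apply contDiffAt_const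
  have heval := ((ContinuousLinearMap.id 𝕜
    (ContinuousMultilinearMap 𝕜 (fun _ : ι => F) G)).analyticAt_uncurry_of_multilinear
      (x := ((f x).toContinuousMultilinearMap, fun i => g x (v i)))).contDiffAt (n := r)
  exact heval.comp x (hf'.prodMk hgv)

end AlternatingMaps

namespace DiffForm

variable {E : Type*} [NormedAddCommGroup E] [NormedSpace ℝ E] {H : Type*} [TopologicalSpace H]
  {I : ModelWithCorners ℝ E H} {M : Type*} [TopologicalSpace M] [ChartedSpace H M]
  {E' : Type*} [NormedAddCommGroup E'] [NormedSpace ℝ E'] {H' : Type*} [TopologicalSpace H']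
  {I' : ModelWithCorners ℝ E' H'} {N : Type*} [TopologicalSpace N] [ChartedSpace H' N]
  {n : ℕ}

lemma apply_congr (α : DiffForm I M n) {x y : M} (h : x = y) :
    (α x : E [⋀^Fin n]→L[ℝ] ℝ) = α y := by
  subst h; rfl

lemma inChart_congr {α β : DiffForm I M n} {x x₀ : M} (hx : x ∈ (extChartAt I x₀).source)
    (h : ∀ᶠ y in 𝓝 x, α y = β y) :
    α.inChart x₀ =ᶠ[𝓝 (extChartAt I x₀ x)] β.inChart x₀ := by
  have hc : ContinuousAt (extChartAt I x₀).symm (extChartAt I x₀ x) :=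
    continuousAt_extChartAt_symm' hx
  have h' : ∀ᶠ y in 𝓝 ((extChartAt I x₀).symm (extChartAt I x₀ x)), α y = β y := by
    rwa [(extChartAt I x₀).left_inv hx]
  filter_upwards [hc.eventually h'] with y hy
  simp only [inChart, hy]

lemma extDeriv_congr {α β : DiffForm I M n} {x : M} (h : ∀ᶠ y in 𝓝 x, α y = β y) :
    α.extDeriv x = β.extDeriv x := by
  simp only [extDeriv, (inChart_congr (mem_extChartAt_source x) h).extDeriv_eq]

/-- Smoothness of a differential form at a point, tested in the preferred chart at that point. -/
def SmoothAt (α : DiffForm I M n) (x : M) : Prop :=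
  ContDiffAt ℝ ∞ (α.inChart x) (extChartAt I x x)

lemma SmoothAt.congr {α β : DiffForm I M n} {x : M} (hβ : β.SmoothAt x)
    (h : ∀ᶠ y in 𝓝 x, α y = β y) : α.SmoothAt x :=
  hβ.congr_of_eventuallyEq (inChart_congr (mem_extChartAt_source x) h)

lemma SmoothAt.differentiableAt {α : DiffForm I M n} {x : M} (hα : α.SmoothAt x) :
    DifferentiableAt ℝ (α.inChart x) (extChartAt I x x) :=
  ContDiffAt.differentiableAt hα (by simp)

lemma SmoothAt.smul (c : ℝ) {α : DiffForm I M n} {x : M} (hα : α.SmoothAt x) :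
    (c • α).SmoothAt x :=
  ContDiffAt.const_smul c hα

lemma SmoothAt.extDeriv_add {α β : DiffForm I M n} {x : M} (hα : α.SmoothAt x)
    (hβ : β.SmoothAt x) : (α + β).extDeriv x = α.extDeriv x + β.extDeriv x := by
  simp only [extDeriv, inChart_add, _root_.extDeriv_add hα.differentiableAt hβ.differentiableAt]
  rfl

lemma IsSmooth.smoothAt [I.Boundaryless] {α : DiffForm I M n} (hα : α.IsSmooth) (x : M) :
    α.SmoothAt x :=
  (hα x).contDiffAt (extChartAt_target_mem_nhds x)

/-- The pullback of a differential form. -/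
def pullback (I : ModelWithCorners ℝ E H) (f : M → N) (α : DiffForm I' N n) : DiffForm I M n :=
  fun x => (α (f x)).compContinuousLinearMap (mfderiv I I' f x)

lemma pullback_comp {E'' : Type*} [NormedAddCommGroup E''] [NormedSpace ℝ E''] {H'' : Type*}
    [TopologicalSpace H''] {I'' : ModelWithCorners ℝ E'' H''} {Q : Type*} [TopologicalSpace Q]
    [ChartedSpace H'' Q] {f : M → N} {g : N → Q} {α : DiffForm I'' Q n} {x : M}
    (hg : MDifferentiableAt I' I'' g (f x)) (hf : MDifferentiableAt I I' f x) :
    pullback I (g ∘ f) α x = pullback I f (pullback I' g α) x := by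
  ext v
  change (α (g (f x))) (fun i => mfderiv I I'' (g ∘ f) x (v i)) = _
  rw [mfderiv_comp x hg hf]
  rfl

lemma pullback_id (α : DiffForm I M n) : pullback I id α = α := by
  funext x
  ext v
  change α x (fun i => mfderiv I I id x (v i)) = _
  rw [mfderiv_id]
  rfl

lemma pullback_congr {f g : M → N} {α : DiffForm I' N n} {x : M} (h : f =ᶠ[𝓝 x] g) :
    pullback I f α x = pullback I g α x := by
  ext v
  have hderiv : (mfderiv I I' f x : E →L[ℝ] E') = mfderiv I I' g x := h.mfderiv_eq
  change (α (f x) : E' [⋀^Fin n]→L[ℝ] ℝ) (fun i => (mfderiv I I' f x : E →L[ℝ] E') (v i)) = _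
  rw [hderiv, apply_congr α h.self_of_nhds]
  rfl

section PullbackInCharts

variable {f : M → N} {x x₀ : M} {y₀ : N}

lemma contDiffAt_extChartAt_comp [I.Boundaryless] {r : WithTop ℕ∞} [IsManifold I r M]
    [IsManifold I' r N] (hx : x ∈ (extChartAt I x₀).source)
    (hfx : f x ∈ (extChartAt I' y₀).source) (hf : ContMDiffAt I I' r f x) :
    ContDiffAt ℝ r (extChartAt I' y₀ ∘ f ∘ (extChartAt I x₀).symm) (extChartAt I x₀ x) := by
  rw [← contMDiffAt_iff_contDiffAt]
  have hsymm : ContMDiffAt 𝓘(ℝ, E) I r (extChartAt I x₀).symm (extChartAt I x₀ x) :=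
    (contMDiffOn_extChartAt_symm x₀).contMDiffAt
      (extChartAt_target_mem_nhds' ((extChartAt I x₀).map_source hx))
  have hchart : ContMDiffAt I' 𝓘(ℝ, E') r (extChartAt I' y₀) (f x) :=
    contMDiffAt_extChartAt' (by simpa using hfx)
  have hcomp : ContMDiffAt I 𝓘(ℝ, E') r (extChartAt I' y₀ ∘ f) x := hchart.comp x hf
  rw [← (extChartAt I x₀).left_inv hx] at hcomp
  exact hcomp.comp _ hsymm

variable [I.Boundaryless] [IsManifold I 1 M] [IsManifold I' 1 N]

lemma mdifferentiableAt_extChartAt_symm {y : E} (hy : y ∈ (extChartAt I x₀).target) :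
    MDifferentiableAt 𝓘(ℝ, E) I (extChartAt I x₀).symm y :=
  (mdifferentiableOn_extChartAt_symm y hy).mdifferentiableAt
    ((isOpen_extChartAt_target x₀).mem_nhds hy)

lemma mfderiv_comp_mfderiv_extChartAt_symm [I'.Boundaryless] {y : E}
    (hy : y ∈ (extChartAt I x₀).target)
    (hfy : f ((extChartAt I x₀).symm y) ∈ (extChartAt I' y₀).source)
    (hf : MDifferentiableAt I I' f ((extChartAt I x₀).symm y)) :
    (mfderiv I I' f ((extChartAt I x₀).symm y)).comp
        (mfderiv 𝓘(ℝ, E) I (extChartAt I x₀).symm y)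
      = (mfderiv 𝓘(ℝ, E') I' (extChartAt I' y₀).symm
          (extChartAt I' y₀ (f ((extChartAt I x₀).symm y)))).comp
        (mfderiv 𝓘(ℝ, E) 𝓘(ℝ, E') (extChartAt I' y₀ ∘ f ∘ (extChartAt I x₀).symm) y) := by
  have hsymm := mdifferentiableAt_extChartAt_symm hy
  have hsymm' := mdifferentiableAt_extChartAt_symm ((extChartAt I' y₀).map_source hfy)
  have hfsymm := hf.comp y hsymm
  have hcoord : MDifferentiableAt 𝓘(ℝ, E) 𝓘(ℝ, E')
      (extChartAt I' y₀ ∘ f ∘ (extChartAt I x₀).symm) y :=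
    (mdifferentiableAt_extChartAt (by simpa using hfy)).comp y hfsymm
  have hcancel : f ∘ (extChartAt I x₀).symm =ᶠ[𝓝 y]
      (extChartAt I' y₀).symm ∘ extChartAt I' y₀ ∘ f ∘ (extChartAt I x₀).symm := by
    filter_upwards [hfsymm.continuousAt.eventually (extChartAt_source_mem_nhds' hfy)] with w hw
    exact ((extChartAt I' y₀).left_inv hw).symm
  exact (mfderiv_comp y hf hsymm).symm.trans
    (hcancel.mfderiv_eq.trans (mfderiv_comp y hsymm' hcoord))

lemma mfderiv_comp_mfderiv_extChartAt (hx : x ∈ (extChartAt I x₀).source)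
    (hfx : f x ∈ (extChartAt I' y₀).source) (hf : ContMDiffAt I I' 1 f x) :
    (mfderiv 𝓘(ℝ, E) 𝓘(ℝ, E') (extChartAt I' y₀ ∘ f ∘ (extChartAt I x₀).symm)
        (extChartAt I x₀ x)).comp (mfderiv I 𝓘(ℝ, E) (extChartAt I x₀) x)
      = (mfderiv I' 𝓘(ℝ, E') (extChartAt I' y₀) (f x)).comp (mfderiv I I' f x) := by
  have hcoord : MDifferentiableAt 𝓘(ℝ, E) 𝓘(ℝ, E')
      (extChartAt I' y₀ ∘ f ∘ (extChartAt I x₀).symm) (extChartAt I x₀ x) :=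
    ((contDiffAt_extChartAt_comp hx hfx hf).differentiableAt one_ne_zero).mdifferentiableAt
  have hchart : MDifferentiableAt I 𝓘(ℝ, E) (extChartAt I x₀) x :=
    mdifferentiableAt_extChartAt (by simpa using hx)
  have hchart' : MDifferentiableAt I' 𝓘(ℝ, E') (extChartAt I' y₀) (f x) :=
    mdifferentiableAt_extChartAt (by simpa using hfx)
  have hcancel : (extChartAt I' y₀ ∘ f ∘ (extChartAt I x₀).symm) ∘ extChartAt I x₀
      =ᶠ[𝓝 x] extChartAt I' y₀ ∘ f := by
    filter_upwards [extChartAt_source_mem_nhds' hx] with z hz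
    simp only [comp_apply, (extChartAt I x₀).left_inv hz]
  exact (mfderiv_comp x hcoord hchart).symm.trans
    (hcancel.mfderiv_eq.trans (mfderiv_comp x hchart' (hf.mdifferentiableAt one_ne_zero)))

lemma inChart_pullback_eventuallyEq [I'.Boundaryless] (α : DiffForm I' N n)
    (hx : x ∈ (extChartAt I x₀).source) (hfx : f x ∈ (extChartAt I' y₀).source)
    (hf : ContMDiffAt I I' 1 f x) :
    (pullback I f α).inChart x₀ =ᶠ[𝓝 (extChartAt I x₀ x)] fun y =>
      (α.inChart y₀ ((extChartAt I' y₀ ∘ f ∘ (extChartAt I x₀).symm) y)).compContinuousLinearMap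
        (fderiv ℝ (extChartAt I' y₀ ∘ f ∘ (extChartAt I x₀).symm) y) := by
  have hsymm : ContinuousAt (extChartAt I x₀).symm (extChartAt I x₀ x) :=
    continuousAt_extChartAt_symm' hx
  have hf_near : ∀ᶠ z in 𝓝 x, ContMDiffAt I I' 1 f z :=
    (contMDiffAt_iff_contMDiffAt_nhds (by simp)).1 hf
  have hsource_near : ∀ᶠ z in 𝓝 x, f z ∈ (extChartAt I' y₀).source :=
    hf.continuousAt.eventually (extChartAt_source_mem_nhds' hfx)
  have htarget : ∀ᶠ y in 𝓝 (extChartAt I x₀ x), y ∈ (extChartAt I x₀).target :=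
    extChartAt_target_mem_nhds' ((extChartAt I x₀).map_source hx)
  rw [← (extChartAt I x₀).left_inv hx] at hf_near hsource_near
  filter_upwards [hsymm.eventually hf_near, hsymm.eventually hsource_near, htarget]
    with y hfy hy hyt
  set z := (extChartAt I x₀).symm y
  ext v
  change (α (f z) : E' [⋀^Fin n]→L[ℝ] ℝ) (fun i => ((mfderiv I I' f z).comp
    (mfderiv 𝓘(ℝ, E) I (extChartAt I x₀).symm y)) (v i)) = _
  rw [mfderiv_comp_mfderiv_extChartAt_symm hyt hy (hfy.mdifferentiableAt one_ne_zero),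
    mfderiv_eq_fderiv, ← apply_congr α ((extChartAt I' y₀).left_inv hy)]
  rfl

end PullbackInCharts

variable [I.Boundaryless] [IsManifold I ∞ M] [I'.Boundaryless] [IsManifold I' ∞ N]

lemma contDiffAt_inChart_pullback [FiniteDimensional ℝ E] {f : M → N} {x x₀ : M} {y₀ : N}
    {α : DiffForm I' N n} (hx : x ∈ (extChartAt I x₀).source)
    (hfx : f x ∈ (extChartAt I' y₀).source) (hf : ContMDiffAt I I' ∞ f x)
    (hα : ContDiffAt ℝ ∞ (α.inChart y₀) (extChartAt I' y₀ (f x))) :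
    ContDiffAt ℝ ∞ ((pullback I f α).inChart x₀) (extChartAt I x₀ x) := by
  have hcoord := contDiffAt_extChartAt_comp hx hfx hf
  refine ContDiffAt.congr_of_eventuallyEq ?_
    (inChart_pullback_eventuallyEq α hx hfx (hf.of_le (by simp)))
  refine contDiffAt_alternating_compContinuousLinearMap ?_
    (hcoord.fderiv_right (m := ∞) (by simp))
  refine ContDiffAt.comp (g := α.inChart y₀) _ ?_ hcoord
  simpa only [comp_apply, (extChartAt I x₀).left_inv hx] using hα

lemma SmoothAt.pullback [FiniteDimensional ℝ E] {f : M → N} {x : M} {α : DiffForm I' N n}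
    (hα : α.SmoothAt (f x)) (hf : ContMDiffAt I I' ∞ f x) : (DiffForm.pullback I f α).SmoothAt x :=
  contDiffAt_inChart_pullback (mem_extChartAt_source x) (mem_extChartAt_source (f x)) hf hα

lemma isSmooth_of_forall_smoothAt [FiniteDimensional ℝ E] {α : DiffForm I M n}
    (hα : ∀ x, α.SmoothAt x) : α.IsSmooth := by
  intro x₀ y hy
  have hx := (extChartAt I x₀).map_target hy
  have h := contDiffAt_inChart_pullback hx (mem_extChartAt_source _) contMDiffAt_id (hα _)
  rw [pullback_id, (extChartAt I x₀).right_inv hy] at h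
  exact h.contDiffWithinAt

lemma SmoothAt.extDeriv_pullback {f : M → N} {x : M} {α : DiffForm I' N n}
    (hα : α.SmoothAt (f x)) (hf : ContMDiffAt I I' ∞ f x) :
    (DiffForm.pullback I f α).extDeriv x = DiffForm.pullback I f α.extDeriv x := by
  have hx := mem_extChartAt_source (I := I) x
  have hfx := mem_extChartAt_source (I := I') (f x)
  have hf' : ContMDiffAt I I' 1 f x := hf.of_le (by simp)
  have hx_inv := (extChartAt I x).left_inv hx
  have hα' : DifferentiableAt ℝ (α.inChart (f x))
      ((extChartAt I' (f x) ∘ f ∘ (extChartAt I x).symm) (extChartAt I x x)) := by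
    simpa only [comp_apply, hx_inv] using hα.differentiableAt
  have hflat := _root_.extDeriv_pullback hα' (contDiffAt_extChartAt_comp hx hfx hf)
    (by rw [minSmoothness_of_isRCLikeNormedField]; exact WithTop.coe_le_coe.2 le_top)
  ext v
  simp only [extDeriv, (inChart_pullback_eventuallyEq α hx hfx hf').extDeriv_eq, hflat]
  have hchain (w : TangentSpace I x) :
      fderiv ℝ (extChartAt I' (f x) ∘ f ∘ (extChartAt I x).symm) (extChartAt I x x)
        (mfderiv I 𝓘(ℝ, E) (extChartAt I x) x w)
      = mfderiv I' 𝓘(ℝ, E') (extChartAt I' (f x)) (f x) (mfderiv I I' f x w) := by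
    rw [← mfderiv_eq_fderiv]
    exact DFunLike.congr_fun (mfderiv_comp_mfderiv_extChartAt hx hfx hf') w
  change (_root_.extDeriv (α.inChart (f x)) (extChartAt I' (f x) (f ((extChartAt I x).symm
    (extChartAt I x x))))) (fun i => fderiv ℝ (extChartAt I' (f x) ∘ f ∘ (extChartAt I x).symm)
      (extChartAt I x x) (mfderiv I 𝓘(ℝ, E) (extChartAt I x) x (v i))) = _
  rw [hx_inv, funext fun i => hchain (v i)]
  rfl

end DiffForm

namespace DiffForm

variable {E : Type*} [NormedAddCommGroup E] [NormedSpace ℝ E] {n : ℕ}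

/-- A form on a vector space, as a differential form on the corresponding manifold. -/
def ofFun (β : E → E [⋀^Fin n]→L[ℝ] ℝ) : DiffForm 𝓘(ℝ, E) E n := β

lemma inChart_ofFun (β : E → E [⋀^Fin n]→L[ℝ] ℝ) (x₀ : E) : (ofFun β).inChart x₀ = β := by
  funext y
  ext v
  have hid : mfderiv 𝓘(ℝ, E) 𝓘(ℝ, E) (extChartAt 𝓘(ℝ, E) x₀).symm y
      = ContinuousLinearMap.id ℝ E := by
    rw [extChartAt_model_space_eq_id]
    exact mfderiv_id
  change (β y) (fun i => mfderiv 𝓘(ℝ, E) 𝓘(ℝ, E) (extChartAt 𝓘(ℝ, E) x₀).symm y (v i)) = _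
  rw [hid]
  rfl

lemma smoothAt_ofFun {β : E → E [⋀^Fin n]→L[ℝ] ℝ} {x : E} :
    (ofFun β).SmoothAt x ↔ ContDiffAt ℝ ∞ β x := by
  rw [SmoothAt, inChart_ofFun, extChartAt_model_space_eq_id]
  rfl

lemma extDeriv_ofFun (β : E → E [⋀^Fin n]→L[ℝ] ℝ) :
    (ofFun β).extDeriv = ofFun (_root_.extDeriv β) := by
  funext x
  ext v
  have hid : mfderiv 𝓘(ℝ, E) 𝓘(ℝ, E) (extChartAt 𝓘(ℝ, E) x) x = ContinuousLinearMap.id ℝ E := by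
    rw [extChartAt_model_space_eq_id]
    exact mfderiv_id
  simp only [extDeriv, hid, inChart_ofFun]
  rfl

end DiffForm

section TangentCoordinates

open Bundle

variable {E : Type*} [NormedAddCommGroup E] [NormedSpace ℝ E] {H : Type*} [TopologicalSpace H]
  {I : ModelWithCorners ℝ E H} {M : Type*} [TopologicalSpace M] [ChartedSpace H M]
  {E₁ : Type*} [NormedAddCommGroup E₁] [NormedSpace ℝ E₁] {H₁ : Type*} [TopologicalSpace H₁]
  {I₁ : ModelWithCorners ℝ E₁ H₁} {M₁ : Type*} [TopologicalSpace M₁] [ChartedSpace H₁ M₁]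
  {E₂ : Type*} [NormedAddCommGroup E₂] [NormedSpace ℝ E₂] {H₂ : Type*} [TopologicalSpace H₂]
  {I₂ : ModelWithCorners ℝ E₂ H₂} {M₂ : Type*} [TopologicalSpace M₂] [ChartedSpace H₂ M₂]
  {E₃ : Type*} [NormedAddCommGroup E₃] [NormedSpace ℝ E₃] {H₃ : Type*} [TopologicalSpace H₃]
  {I₃ : ModelWithCorners ℝ E₃ H₃} {M₃ : Type*} [TopologicalSpace M₃] [ChartedSpace H₃ M₃]
  {r : WithTop ℕ∞}

lemma contDiff_flip :
    ContDiff ℝ r (ContinuousLinearMap.flip : (E₁ →L[ℝ] E₂ →L[ℝ] E₃) → E₂ →L[ℝ] E₁ →L[ℝ] E₃) :=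
  (ContinuousLinearMap.flipₗᵢ ℝ E₁ E₂ E₃).toContinuousLinearEquiv.contDiff

lemma contMDiffAt_bilinearComp {b : M → E₁ →L[ℝ] E₁ →L[ℝ] ℝ} {φ χ : M → E₂ →L[ℝ] E₁} {x₀ : M}
    (hb : ContMDiffAt I 𝓘(ℝ, E₁ →L[ℝ] E₁ →L[ℝ] ℝ) r b x₀)
    (hφ : ContMDiffAt I 𝓘(ℝ, E₂ →L[ℝ] E₁) r φ x₀) (hχ : ContMDiffAt I 𝓘(ℝ, E₂ →L[ℝ] E₁) r χ x₀) :
    ContMDiffAt I 𝓘(ℝ, E₂ →L[ℝ] E₂ →L[ℝ] ℝ) r (fun x => (b x).bilinearComp (φ x) (χ x)) x₀ :=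
  (contDiff_flip.contMDiff.contMDiffAt (f := ContinuousLinearMap.flip)).comp x₀
    (((contDiff_flip.contMDiff.contMDiffAt (f := ContinuousLinearMap.flip)).comp x₀
      (hb.clm_comp hφ)).clm_comp hχ)

variable [IsManifold I ∞ M] [IsManifold I₁ ∞ M₁] [IsManifold I₂ ∞ M₂] [IsManifold I₃ ∞ M₃]

lemma symmL_trivializationAt_continuousLinearMapAt {x₀ x : M} (hx : x ∈ (chartAt H x₀).source)
    (w : TangentSpace I x) :
    (trivializationAt E (TangentSpace I) x₀).symmL ℝ x
      ((trivializationAt E (TangentSpace I) x₀).continuousLinearMapAt ℝ x w) = w :=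
  Trivialization.symmL_continuousLinearMapAt _ (by simpa using hx) w

lemma inTangentCoordinates_comp {X : Type*} {f : X → M₁} {g : X → M₂} {k : X → M₃}
    (φ : ∀ b, TangentSpace I₁ (f b) →L[ℝ] TangentSpace I₂ (g b))
    (χ : ∀ b, TangentSpace I₂ (g b) →L[ℝ] TangentSpace I₃ (k b)) {x₀ x : X}
    (hx : g x ∈ (chartAt H₂ (g x₀)).source) :
    inTangentCoordinates I₁ I₃ f k (fun b => (χ b).comp (φ b)) x₀ x
      = (inTangentCoordinates I₂ I₃ g k χ x₀ x).comp
        (inTangentCoordinates I₁ I₂ f g φ x₀ x) := by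
  ext v
  simp only [inTangentCoordinates, ContinuousLinearMap.inCoordinates,
    ContinuousLinearMap.comp_apply]
  rw [symmL_trivializationAt_continuousLinearMapAt hx]
  rfl

lemma inTangentCoordinates_add {X : Type*} {f : X → M₁} {g : X → M₂}
    (φ χ : ∀ b, TangentSpace I₁ (f b) →L[ℝ] TangentSpace I₂ (g b)) (x₀ x : X) :
    inTangentCoordinates I₁ I₂ f g (fun b => φ b + χ b) x₀ x
      = inTangentCoordinates I₁ I₂ f g φ x₀ x + inTangentCoordinates I₁ I₂ f g χ x₀ x := by
  ext v
  simp only [inTangentCoordinates, ContinuousLinearMap.inCoordinates,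
    ContinuousLinearMap.comp_apply, add_apply]
  exact map_add _ _ _

omit [IsManifold I ∞ M] in
lemma contMDiffAt_inTangentCoordinates_comp {f : M → M₁} {g : M → M₂} {k : M → M₃}
    {φ : ∀ b, TangentSpace I₁ (f b) →L[ℝ] TangentSpace I₂ (g b)}
    {χ : ∀ b, TangentSpace I₂ (g b) →L[ℝ] TangentSpace I₃ (k b)} {x₀ : M}
    (hχ : ContMDiffAt I 𝓘(ℝ, E₂ →L[ℝ] E₃) r (inTangentCoordinates I₂ I₃ g k χ x₀) x₀)
    (hφ : ContMDiffAt I 𝓘(ℝ, E₁ →L[ℝ] E₂) r (inTangentCoordinates I₁ I₂ f g φ x₀) x₀)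
    (hg : ContinuousAt g x₀) :
    ContMDiffAt I 𝓘(ℝ, E₁ →L[ℝ] E₃) r
      (inTangentCoordinates I₁ I₃ f k (fun b => (χ b).comp (φ b)) x₀) x₀ := by
  refine (hχ.clm_comp hφ).congr_of_eventuallyEq ?_
  filter_upwards [hg (chart_source_mem_nhds H₂ (g x₀))] with x hx
  exact inTangentCoordinates_comp φ χ hx

lemma contMDiffAt_endomorphism_iff {A : ∀ x : M, TangentSpace I x →L[ℝ] TangentSpace I x} {x₀ : M} :
    ContMDiffAt I (I.prod 𝓘(ℝ, E →L[ℝ] E)) r (fun x => TotalSpace.mk' (E →L[ℝ] E)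
      (E := fun x : M => TangentSpace I x →L[ℝ] TangentSpace I x) x (A x)) x₀ ↔
    ContMDiffAt I 𝓘(ℝ, E →L[ℝ] E) r (inTangentCoordinates I I id id A x₀) x₀ := by
  rw [contMDiffAt_hom_bundle]
  exact ⟨fun h => h.2, fun h => ⟨contMDiffAt_id, h⟩⟩

/-- A field of bilinear forms on the tangent spaces, in the coordinates around `x₀`. -/
def bilinInCoordinates (b : ∀ x : M, TangentSpace I x →L[ℝ] TangentSpace I x →L[ℝ] ℝ) (x₀ x : M) :
    E →L[ℝ] E →L[ℝ] ℝ :=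
  (show E →L[ℝ] E →L[ℝ] ℝ from b x).bilinearComp
    (show E →L[ℝ] E from (trivializationAt E (TangentSpace I) x₀).symmL ℝ x)
    (show E →L[ℝ] E from (trivializationAt E (TangentSpace I) x₀).symmL ℝ x)

lemma bilinInCoordinates_apply (b : ∀ x : M, TangentSpace I x →L[ℝ] TangentSpace I x →L[ℝ] ℝ)
    (x₀ x : M) (u v : E) : bilinInCoordinates b x₀ x u v =
      b x ((trivializationAt E (TangentSpace I) x₀).symmL ℝ x u)
        ((trivializationAt E (TangentSpace I) x₀).symmL ℝ x v) := rfl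

/-- The pullback of a bilinear form on a tangent space by a linear map between tangent spaces. -/
def bilinPullback {x : M} {y : M₁} (b : TangentSpace I₁ y →L[ℝ] TangentSpace I₁ y →L[ℝ] ℝ)
    (φ : TangentSpace I x →L[ℝ] TangentSpace I₁ y) :
    TangentSpace I x →L[ℝ] TangentSpace I x →L[ℝ] ℝ :=
  ContinuousLinearMap.bilinearComp (E := E₁) (F := E₁) (G := ℝ) (E' := E) (F' := E) b φ φ

lemma contMDiffAt_bilin_iff {b : ∀ x : M, TangentSpace I x →L[ℝ] TangentSpace I x →L[ℝ] ℝ}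
    {x₀ : M} :
    ContMDiffAt I (I.prod 𝓘(ℝ, E →L[ℝ] E →L[ℝ] ℝ)) r (fun x => TotalSpace.mk' (E →L[ℝ] E →L[ℝ] ℝ)
      (E := fun x : M => TangentSpace I x →L[ℝ] TangentSpace I x →L[ℝ] ℝ) x (b x)) x₀ ↔
    ContMDiffAt I 𝓘(ℝ, E →L[ℝ] E →L[ℝ] ℝ) r (bilinInCoordinates b x₀) x₀ := by
  rw [contMDiffAt_hom_bundle]
  have hcoord : (fun x => ContinuousLinearMap.inCoordinates E (TangentSpace I) (E →L[ℝ] ℝ)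
      (fun x : M => TangentSpace I x →L[ℝ] ℝ) x₀ x x₀ x (b x)) =ᶠ[𝓝 x₀]
      bilinInCoordinates b x₀ := by
    filter_upwards [chart_source_mem_nhds H x₀] with x hx
    ext u v
    have hbase : x ∈ (trivializationAt E (TangentSpace I) x₀).baseSet := by simpa using hx
    refine (inCoordinates_apply_eq₂ (F₃ := ℝ) (E₃ := Bundle.Trivial M ℝ) hbase hbase
      (by simp)).trans ?_
    rw [bilinInCoordinates_apply, Trivialization.linearMapAt_apply,
      Trivialization.symmL_apply _ hbase, Trivialization.symmL_apply _ hbase]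
    simp
  exact ⟨fun h => h.2.congr_of_eventuallyEq hcoord.symm,
    fun h => ⟨contMDiffAt_id, h.congr_of_eventuallyEq hcoord⟩⟩

lemma contMDiffAt_bilinInCoordinates_pullback
    {b : ∀ x : M₁, TangentSpace I₁ x →L[ℝ] TangentSpace I₁ x →L[ℝ] ℝ} {P : M → M₁}
    {φ : ∀ x : M, TangentSpace I x →L[ℝ] TangentSpace I₁ (P x)} {x₀ : M}
    (hb : ContMDiffAt I₁ 𝓘(ℝ, E₁ →L[ℝ] E₁ →L[ℝ] ℝ) r (bilinInCoordinates b (P x₀)) (P x₀))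
    (hφ : ContMDiffAt I 𝓘(ℝ, E →L[ℝ] E₁) r (inTangentCoordinates I I₁ id P φ x₀) x₀)
    (hP : ContMDiffAt I I₁ r P x₀) :
    ContMDiffAt I 𝓘(ℝ, E →L[ℝ] E →L[ℝ] ℝ) r
      (bilinInCoordinates (fun x => bilinPullback (b (P x)) (φ x)) x₀) x₀ := by
  refine (contMDiffAt_bilinearComp (hb.comp x₀ hP) hφ hφ).congr_of_eventuallyEq ?_
  filter_upwards [hP.continuousAt (chart_source_mem_nhds H₁ (P x₀))] with x hx
  ext u v
  let τ := trivializationAt E₁ (TangentSpace I₁) (P x₀)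
  change b (P x) _ _ = b (P x) (τ.symmL ℝ (P x) (τ.continuousLinearMapAt ℝ (P x) _))
    (τ.symmL ℝ (P x) (τ.continuousLinearMapAt ℝ (P x) _))
  rw [symmL_trivializationAt_continuousLinearMapAt hx,
    symmL_trivializationAt_continuousLinearMapAt hx]
  rfl

lemma HermitianStructure.smoothAt_fundamentalForm [FiniteDimensional ℝ E]
    [I.Boundaryless] (S : HermitianStructure I M) (x₀ : M) : S.fundamentalForm.SmoothAt x₀ := by
  have hg := contMDiffAt_bilin_iff.1 (S.metric.contMDiff x₀)
  have hJ := contMDiffAt_endomorphism_iff.1 (S.cplx.contMDiff x₀)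
  have hchart_symm : ContMDiffAt 𝓘(ℝ, E) I ∞ (extChartAt I x₀).symm (extChartAt I x₀ x₀) :=
    (contMDiffOn_extChartAt_symm x₀).contMDiffAt (extChartAt_target_mem_nhds x₀)
  refine contDiffAt_alternating_of_forall_apply fun v => ?_
  have hω : ContMDiffAt I 𝓘(ℝ, ℝ) ∞ (fun x => bilinInCoordinates S.metric.inner x₀ x
      (inTangentCoordinates I I id id S.cplx.J x₀ x (v 0)) (v 1)) x₀ :=
    (hg.clm_apply (hJ.clm_apply contMDiffAt_const)).clm_apply contMDiffAt_const
  rw [← contMDiffAt_iff_contDiffAt]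
  refine (hω.comp_of_eq hchart_symm (extChartAt_to_inv x₀)).congr_of_eventuallyEq ?_
  filter_upwards [extChartAt_target_mem_nhds (I := I) x₀] with y hy
  have hy' : (extChartAt I x₀).symm y ∈ (chartAt H x₀).source := by
    simpa using (extChartAt I x₀).map_target hy
  let τ := trivializationAt E (TangentSpace I) x₀
  have hτ : τ.symmL ℝ ((extChartAt I x₀).symm y)
      = mfderiv 𝓘(ℝ, E) I (extChartAt I x₀).symm y := by
    rw [TangentBundle.symmL_trivializationAt hy', I.range_eq_univ, mfderivWithin_univ,
      (extChartAt I x₀).right_inv hy]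
  change S.metric.inner _ (S.cplx.J _ (mfderiv 𝓘(ℝ, E) I (extChartAt I x₀).symm y (v 0)))
      (mfderiv 𝓘(ℝ, E) I (extChartAt I x₀).symm y (v 1)) = S.metric.inner _
      (τ.symmL ℝ ((extChartAt I x₀).symm y)
        (τ.continuousLinearMapAt ℝ ((extChartAt I x₀).symm y) _)) _
  rw [symmL_trivializationAt_continuousLinearMapAt hy', ← hτ]
  rfl

end TangentCoordinates

section FlatModel

/-- The Euclidean space `ℝ⁴`, thought of as the quaternions. -/
abbrev R4 : Type := EuclideanSpace ℝ (Fin (3 + 1))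

namespace R4

/-- For `s = 1`, the multiplication by `i` on the left of a quaternion; for `s = -1`, the
multiplication by `i` on the right. -/
def mulI (s : ℝ) : R4 →L[ℝ] R4 :=
  LinearMap.toContinuousLinearMap
    { toFun := fun x => WithLp.toLp 2 ![-x 1, x 0, -(s * x 3), s * x 2]
      map_add' := fun x y => by ext i; fin_cases i <;> simp <;> ring
      map_smul' := fun c x => by ext i; fin_cases i <;> simp <;> ring }

@[simp] lemma mulI_apply_zero (s : ℝ) (x : R4) : mulI s x 0 = -x 1 := rfl
@[simp] lemma mulI_apply_one (s : ℝ) (x : R4) : mulI s x 1 = x 0 := rfl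
@[simp] lemma mulI_apply_two (s : ℝ) (x : R4) : mulI s x 2 = -(s * x 3) := rfl
@[simp] lemma mulI_apply_three (s : ℝ) (x : R4) : mulI s x 3 = s * x 2 := rfl

lemma ext_coord {x y : R4} (h₀ : x 0 = y 0) (h₁ : x 1 = y 1) (h₂ : x 2 = y 2) (h₃ : x 3 = y 3) :
    x = y := by
  ext i
  fin_cases i <;> assumption

lemma inner_eq (x y : R4) : inner ℝ x y = x 0 * y 0 + x 1 * y 1 + x 2 * y 2 + x 3 * y 3 := by
  rw [PiLp.inner_apply, Fin.sum_univ_four]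
  simp [mul_comm]

lemma norm_sq_eq (x : R4) : ‖x‖ ^ 2 = x 0 ^ 2 + x 1 ^ 2 + x 2 ^ 2 + x 3 ^ 2 := by
  rw [← real_inner_self_eq_norm_sq, inner_eq]
  ring

variable {s : ℝ}

lemma mulI_mulI (hs : s * s = 1) (x : R4) : mulI s (mulI s x) = -x := by
  apply ext_coord
  · simp
  · simp
  · simp only [mulI_apply_two, mulI_apply_three, PiLp.neg_apply]
    linear_combination (-x 2) * hs
  · simp only [mulI_apply_two, mulI_apply_three, PiLp.neg_apply]
    linear_combination (-x 3) * hs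

lemma inner_mulI_mulI (hs : s * s = 1) (x y : R4) :
    inner ℝ (mulI s x) (mulI s y) = (inner ℝ x y : ℝ) := by
  simp only [inner_eq, mulI_apply_zero, mulI_apply_one, mulI_apply_two, mulI_apply_three]
  linear_combination (x 3 * y 3 + x 2 * y 2) * hs

lemma mulI_comm (s t : ℝ) (x : R4) : mulI s (mulI t x) = mulI t (mulI s x) := by
  apply ext_coord <;> simp <;> ring

/-- The two-form `(u, v) ↦ ⟪i u, v⟫`. -/
def kahlerForm (s : ℝ) : R4 [⋀^Fin 2]→L[ℝ] ℝ :=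
  { toFun := fun v => inner ℝ (mulI s (v 0)) (v 1)
    map_update_add' := by
      intro inst v i a b
      rw [Subsingleton.elim inst (instDecidableEqFin 2)]
      fin_cases i <;> simp [Function.update, inner_add_left, inner_add_right]
    map_update_smul' := by
      intro inst v i c a
      rw [Subsingleton.elim inst (instDecidableEqFin 2)]
      fin_cases i <;> simp [Function.update, inner_smul_left, inner_smul_right]
    cont := by fun_prop
    map_eq_zero_of_eq' := by
      intro v i j hv hij
      have hv01 : v 0 = v 1 := by
        fin_cases i <;> fin_cases j <;> simp_all
      simp only [hv01, inner_eq, mulI_apply_zero, mulI_apply_one, mulI_apply_two,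
        mulI_apply_three]
      ring }

/-- The determinant on `ℝ⁴`. -/
def detForm : R4 [⋀^Fin (3 + 1)]→L[ℝ] ℝ :=
  { (EuclideanSpace.basisFun (Fin (3 + 1)) ℝ).toBasis.det with
    cont := by
      change Continuous fun v : Fin (3 + 1) → R4 =>
        (EuclideanSpace.basisFun (Fin (3 + 1)) ℝ).toBasis.det v
      simp only [Module.Basis.det_apply]
      refine Continuous.matrix_det (continuous_pi fun i => continuous_pi fun j => ?_)
      simp only [Module.Basis.toMatrix_apply, OrthonormalBasis.coe_toBasis_repr_apply,
        EuclideanSpace.basisFun_repr]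
      fun_prop }

lemma detForm_apply (v : Fin (3 + 1) → R4) :
    detForm v = Matrix.det (Matrix.of fun i j => v j i) := by
  change (EuclideanSpace.basisFun (Fin (3 + 1)) ℝ).toBasis.det v = _
  rw [Module.Basis.det_apply]
  congr 1

lemma detForm_eq (a b c d : R4) :
    detForm ![a, b, c, d] =
      a 0 * (b 1 * (c 2 * d 3 - d 2 * c 3) - c 1 * (b 2 * d 3 - d 2 * b 3)
        + d 1 * (b 2 * c 3 - c 2 * b 3))
      - b 0 * (a 1 * (c 2 * d 3 - d 2 * c 3) - c 1 * (a 2 * d 3 - d 2 * a 3)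
        + d 1 * (a 2 * c 3 - c 2 * a 3))
      + c 0 * (a 1 * (b 2 * d 3 - d 2 * b 3) - b 1 * (a 2 * d 3 - d 2 * a 3)
        + d 1 * (a 2 * b 3 - b 2 * a 3))
      - d 0 * (a 1 * (b 2 * c 3 - c 2 * b 3) - b 1 * (a 2 * c 3 - c 2 * a 3)
        + c 1 * (a 2 * b 3 - b 2 * a 3)) := by
  rw [detForm_apply, Matrix.det_succ_row_zero]
  simp [Fin.sum_univ_succ, Matrix.det_fin_three, Fin.succAbove, Matrix.submatrix]
  ring

lemma sum_inner_mul_detForm (z a b c d : R4) :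
    inner ℝ z a * detForm ![z, b, c, d] - inner ℝ z b * detForm ![z, a, c, d]
      + inner ℝ z c * detForm ![z, a, b, d] - inner ℝ z d * detForm ![z, a, b, c]
      = ‖z‖ ^ 2 * detForm ![a, b, c, d] := by
  simp only [detForm_eq, inner_eq, norm_sq_eq]
  ring

/-- The two-form `|z|⁻² ⟪i ·, ·⟫`, the fundamental form of the Hopf metric `|z|⁻² |dz|²`. -/
def hopfForm (s : ℝ) (z : R4) : R4 [⋀^Fin 2]→L[ℝ] ℝ := (‖z‖ ^ 2)⁻¹ • kahlerForm s

lemma hopfForm_apply (s : ℝ) (z : R4) (v : Fin 2 → R4) :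
    hopfForm s z v = (‖z‖ ^ 2)⁻¹ * inner ℝ (mulI s (v 0)) (v 1) := rfl

/-- The three-form `-2 |z|⁻⁴ det (z, ·, ·, ·)`: up to a constant, the pullback of the volume form
of the unit sphere by the radial projection. -/
def sphereForm (z : R4) : R4 [⋀^Fin 3]→L[ℝ] ℝ :=
  (-2 * ((‖z‖ ^ 2)⁻¹) ^ 2) • detForm.curryLeft z

lemma curryLeft_detForm_apply (z : R4) (v : Fin 3 → R4) :
    detForm.curryLeft z v = detForm ![z, v 0, v 1, v 2] := by
  change detForm (Matrix.vecCons z v) = _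
  congr 1
  ext i : 1
  fin_cases i <;> rfl

lemma sphereForm_apply (z : R4) (v : Fin 3 → R4) :
    sphereForm z v = -2 * ((‖z‖ ^ 2)⁻¹) ^ 2 * detForm ![z, v 0, v 1, v 2] :=
  congrArg (-2 * ((‖z‖ ^ 2)⁻¹) ^ 2 * ·) (curryLeft_detForm_apply z v)

lemma hasFDerivAt_inv_norm_sq {z : R4} (hz : z ≠ 0) :
    HasFDerivAt (fun y : R4 => (‖y‖ ^ 2)⁻¹) (-((‖z‖ ^ 2) ^ 2)⁻¹ • (2 • innerSL ℝ z)) z :=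
  (hasDerivAt_inv (by positivity)).comp_hasFDerivAt z (hasStrictFDerivAt_norm_sq z).hasFDerivAt

lemma contDiffAt_inv_norm_sq {z : R4} (hz : z ≠ 0) :
    ContDiffAt ℝ ∞ (fun y : R4 => (‖y‖ ^ 2)⁻¹) z :=
  (contDiff_norm_sq ℝ).contDiffAt.inv (by positivity)

lemma contDiffAt_hopfForm (s : ℝ) {z : R4} (hz : z ≠ 0) : ContDiffAt ℝ ∞ (hopfForm s) z :=
  (contDiffAt_inv_norm_sq hz).smul contDiffAt_const

lemma contDiffAt_sphereForm {z : R4} (hz : z ≠ 0) : ContDiffAt ℝ ∞ sphereForm z :=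
  (contDiffAt_const.mul ((contDiffAt_inv_norm_sq hz).pow 2)).smul
    detForm.curryLeft.contDiff.contDiffAt

lemma extDeriv_hopfForm_apply (s : ℝ) {z : R4} (hz : z ≠ 0) (v : Fin 3 → R4) :
    extDeriv (hopfForm s) z v = -2 * ((‖z‖ ^ 2)⁻¹) ^ 2 *
      (inner ℝ z (v 0) * inner ℝ (mulI s (v 1)) (v 2)
        - inner ℝ z (v 1) * inner ℝ (mulI s (v 0)) (v 2)
        + inner ℝ z (v 2) * inner ℝ (mulI s (v 0)) (v 1)) := by
  rw [extDeriv_apply ((contDiffAt_hopfForm s hz).differentiableAt (by simp))]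
  have hfderiv (w : Fin 2 → R4) (u : R4) : fderiv ℝ (fun y => hopfForm s y w) z u
      = -((‖z‖ ^ 2) ^ 2)⁻¹ * (2 * inner ℝ z u) * inner ℝ (mulI s (w 0)) (w 1) := by
    simp only [hopfForm_apply]
    rw [((hasFDerivAt_inv_norm_sq hz).mul_const _).fderiv]
    simp only [smul_apply, coe_innerSL_apply, nsmul_eq_mul, Nat.cast_ofNat, smul_eq_mul]
    ring
  simp only [hfderiv]
  refine (Fin.sum_univ_three _).trans ?_
  simp [Fin.removeNth, Fin.succAbove]
  ring

/-- The sign `s` on the right-hand side is the reason why the two complex structures of the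
construction have opposite torsions: they differ in `s` only. -/
lemma extDeriv_hopfForm_mulI (hs : s * s = 1) {z : R4} (hz : z ≠ 0) (v : Fin 3 → R4) :
    -extDeriv (hopfForm s) z (fun i => mulI s (v i)) = s * sphereForm z v := by
  rw [extDeriv_hopfForm_apply s hz, sphereForm_apply, detForm_eq]
  simp only [mulI_mulI hs, inner_eq, mulI_apply_zero, mulI_apply_one, mulI_apply_two,
    mulI_apply_three, PiLp.neg_apply]
  ring_nf

lemma fderiv_sphereForm_apply {z : R4} (hz : z ≠ 0) (w : Fin 3 → R4) (u : R4) :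
    fderiv ℝ (fun y => sphereForm y w) z u
      = -2 * (((‖z‖ ^ 2)⁻¹) ^ 2 * detForm ![u, w 0, w 1, w 2]
        - 4 * ((‖z‖ ^ 2)⁻¹) ^ 3 * inner ℝ z u * detForm ![z, w 0, w 1, w 2]) := by
  have hdet : HasFDerivAt (fun y => detForm ![y, w 0, w 1, w 2])
      ((ContinuousAlternatingMap.apply ℝ R4 ℝ w).comp detForm.curryLeft) z := by
    simp only [← curryLeft_detForm_apply]
    exact ((ContinuousAlternatingMap.apply ℝ R4 ℝ w).comp detForm.curryLeft).hasFDerivAt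
  simp only [sphereForm_apply]
  rw [((((hasFDerivAt_inv_norm_sq hz).pow 2).const_mul (-2)).fun_mul hdet).fderiv]
  simp only [add_apply, smul_apply, ContinuousLinearMap.comp_apply,
    ContinuousAlternatingMap.apply_apply, curryLeft_detForm_apply, coe_innerSL_apply, inv_pow,
    smul_eq_mul, nsmul_eq_mul, Nat.cast_ofNat, Nat.add_one_sub_one, pow_one]
  ring

lemma extDeriv_sphereForm {z : R4} (hz : z ≠ 0) : extDeriv sphereForm z = 0 := by
  ext v
  rw [extDeriv_apply ((contDiffAt_sphereForm hz).differentiableAt (by simp))]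
  simp only [fderiv_sphereForm_apply hz]
  refine (Fin.sum_univ_four _).trans ?_
  have hdet₁ : detForm ![v 1, v 0, v 2, v 3] = -detForm ![v 0, v 1, v 2, v 3] := by
    simp only [detForm_eq]
    ring
  have hdet₂ : detForm ![v 2, v 0, v 1, v 3] = detForm ![v 0, v 1, v 2, v 3] := by
    simp only [detForm_eq]
    ring
  have hdet₃ : detForm ![v 3, v 0, v 1, v 2] = -detForm ![v 0, v 1, v 2, v 3] := by
    simp only [detForm_eq]
    ring
  have hnorm : (‖z‖ ^ 2)⁻¹ * ‖z‖ ^ 2 = 1 := inv_mul_cancel₀ (by positivity)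
  have hcofactor := sum_inner_mul_detForm z (v 0) (v 1) (v 2) (v 3)
  generalize (‖z‖ ^ 2)⁻¹ = r at hnorm ⊢
  have hsum : -2 * (r ^ 2 * detForm ![v 0, v 1, v 2, v 3]
        - 4 * r ^ 3 * inner ℝ z (v 0) * detForm ![z, v 1, v 2, v 3])
      - -2 * (r ^ 2 * detForm ![v 1, v 0, v 2, v 3]
        - 4 * r ^ 3 * inner ℝ z (v 1) * detForm ![z, v 0, v 2, v 3])
      + -2 * (r ^ 2 * detForm ![v 2, v 0, v 1, v 3]
        - 4 * r ^ 3 * inner ℝ z (v 2) * detForm ![z, v 0, v 1, v 3])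
      - -2 * (r ^ 2 * detForm ![v 3, v 0, v 1, v 2]
        - 4 * r ^ 3 * inner ℝ z (v 3) * detForm ![z, v 0, v 1, v 2]) = 0 := by
    rw [hdet₁, hdet₂, hdet₃]
    linear_combination 8 * r ^ 3 * hcofactor + 8 * r ^ 2 * detForm ![v 0, v 1, v 2, v 3] * hnorm
  simpa [Fin.removeNth, Fin.succAbove, sub_eq_add_neg] using hsum

lemma inv_norm_sq_mul_inner_smul {c : ℝ} (hc : c ≠ 0) (z v w : R4) :
    (‖c • z‖ ^ 2)⁻¹ * inner ℝ (c • v) (c • w) = (‖z‖ ^ 2)⁻¹ * inner ℝ v w := by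
  rw [inner_smul_left, inner_smul_right, norm_smul, mul_pow, Real.norm_eq_abs, sq_abs]
  simp only [conj_trivial]
  field_simp

/-- The Hopf metric `|z|⁻² |dz|²` on `ℝ⁴ \ {0}`; it is invariant under homotheties. -/
def hopfMetric (z : R4) :
    TangentSpace 𝓘(ℝ, R4) z →L[ℝ] TangentSpace 𝓘(ℝ, R4) z →L[ℝ] ℝ :=
  show R4 →L[ℝ] R4 →L[ℝ] ℝ from (‖z‖ ^ 2)⁻¹ • innerSL ℝ

lemma bilinInCoordinates_hopfMetric (z₀ : R4) :
    bilinInCoordinates hopfMetric z₀ = fun z : R4 => (‖z‖ ^ 2)⁻¹ • innerSL ℝ := by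
  funext z
  ext u v
  rw [bilinInCoordinates_apply]
  simp only [hopfMetric, TangentBundle.symmL_model_space]
  rfl

end R4

end FlatModel

section LocalModel

open Bundle

lemma mfderiv_apply_mfderiv_of_eventuallyEq
    {E₁ : Type*} [NormedAddCommGroup E₁] [NormedSpace ℝ E₁] {H₁ : Type*} [TopologicalSpace H₁]
    {I₁ : ModelWithCorners ℝ E₁ H₁} {M₁ : Type*} [TopologicalSpace M₁] [ChartedSpace H₁ M₁]
    {E₂ : Type*} [NormedAddCommGroup E₂] [NormedSpace ℝ E₂] {H₂ : Type*} [TopologicalSpace H₂]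
    {I₂ : ModelWithCorners ℝ E₂ H₂} {M₂ : Type*} [TopologicalSpace M₂] [ChartedSpace H₂ M₂]
    {E₃ : Type*} [NormedAddCommGroup E₃] [NormedSpace ℝ E₃] {H₃ : Type*} [TopologicalSpace H₃]
    {I₃ : ModelWithCorners ℝ E₃ H₃} {M₃ : Type*} [TopologicalSpace M₃] [ChartedSpace H₃ M₃]
    {f : M₁ → M₂} {g : M₂ → M₃} {k : M₁ → M₃} {a : M₁} {b : M₂}
    (hg : MDifferentiableAt I₂ I₃ g b) (hf : MDifferentiableAt I₁ I₂ f a) (hb : f a = b)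
    (hk : g ∘ f =ᶠ[𝓝 a] k) (v : E₁) :
    (mfderiv I₂ I₃ g b : E₂ →L[ℝ] E₃) ((mfderiv I₁ I₂ f a : E₁ →L[ℝ] E₂) v)
      = (mfderiv I₁ I₃ k a : E₁ →L[ℝ] E₃) v := by
  subst hb
  rw [← hk.mfderiv_eq]
  exact (mfderiv_comp_apply a hg hf v).symm

variable {EK : Type*} [NormedAddCommGroup EK] [NormedSpace ℝ EK] {HK : Type*} [TopologicalSpace HK]
  {IK : ModelWithCorners ℝ EK HK} {K : Type*} [TopologicalSpace K] [ChartedSpace HK K]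
  {E : Type*} [NormedAddCommGroup E] [NormedSpace ℝ E] {H : Type*} [TopologicalSpace H]
  {I : ModelWithCorners ℝ E H} {M : Type*} [TopologicalSpace M] [ChartedSpace H M]
  {F : Type*} [NormedAddCommGroup F] [NormedSpace ℝ F]

variable (IK I) in
/-- A diffeomorphism from an open subset of `M` to an open subset of `K × F`. -/
structure IsSmoothChart (θ : OpenPartialHomeomorph M (K × F)) : Prop where
  contMDiffOn : ContMDiffOn I (IK.prod 𝓘(ℝ, F)) ∞ θ θ.source
  contMDiffOn_symm : ContMDiffOn (IK.prod 𝓘(ℝ, F)) I ∞ θ.symm θ.target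

namespace IsSmoothChart

variable (θ : OpenPartialHomeomorph M (K × F))

variable (IK I) in
/-- The derivative at `y` of the first component of `θ`. -/
def derivFst (y : M) : TangentSpace I y →L[ℝ] TangentSpace IK (θ y).1 :=
  mfderiv I IK (fun y => (θ y).1) y

variable (I) in
/-- The derivative at `y` of the second component of `θ`. -/
def derivSnd (y : M) : TangentSpace I y →L[ℝ] TangentSpace 𝓘(ℝ, F) (θ y).2 :=
  mfderiv I 𝓘(ℝ, F) (fun y => (θ y).2) y

variable (IK I) in
/-- The derivative at `θ y` of `θ.symm` in the first variable. -/
def inclFst (y : M) : TangentSpace IK (θ y).1 →L[ℝ] TangentSpace I y :=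
  mfderiv IK I (fun p => θ.symm (p, (θ y).2)) (θ y).1

variable (I) in
/-- The derivative at `θ y` of `θ.symm` in the second variable. -/
def inclSnd (y : M) : TangentSpace 𝓘(ℝ, F) (θ y).2 →L[ℝ] TangentSpace I y :=
  mfderiv 𝓘(ℝ, F) I (fun z => θ.symm ((θ y).1, z)) (θ y).2

variable {θ} {y : M}

section

variable {X Y Z : Type*} [TopologicalSpace X] [TopologicalSpace Y] [TopologicalSpace Z]
  {τ : OpenPartialHomeomorph X (Y × Z)} {x : X}

lemma eventually_prodMk_left_mem_target (hx : x ∈ τ.source) :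
    ∀ᶠ p in 𝓝 (τ x).1, (p, (τ x).2) ∈ τ.target := by
  have hcont : ContinuousAt (fun p : Y => (p, (τ x).2)) (τ x).1 := by fun_prop
  exact hcont.eventually (τ.open_target.mem_nhds (τ.map_source hx))

lemma eventually_prodMk_right_mem_target (hx : x ∈ τ.source) :
    ∀ᶠ z in 𝓝 (τ x).2, ((τ x).1, z) ∈ τ.target := by
  have hcont : ContinuousAt (fun z : Z => ((τ x).1, z)) (τ x).2 := by fun_prop
  exact hcont.eventually (τ.open_target.mem_nhds (τ.map_source hx))

end

variable (hθ : IsSmoothChart IK I θ) (hy : y ∈ θ.source)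
include hθ hy

lemma contMDiffAt : ContMDiffAt I (IK.prod 𝓘(ℝ, F)) ∞ θ y :=
  hθ.contMDiffOn.contMDiffAt (θ.open_source.mem_nhds hy)

lemma contMDiffAt_symm : ContMDiffAt (IK.prod 𝓘(ℝ, F)) I ∞ θ.symm ((θ y).1, (θ y).2) :=
  hθ.contMDiffOn_symm.contMDiffAt (θ.open_target.mem_nhds (θ.map_source hy))

lemma contMDiffAt_fst : ContMDiffAt I IK ∞ (fun y => (θ y).1) y :=
  _root_.contMDiffAt_fst.comp y (hθ.contMDiffAt hy)

lemma contMDiffAt_snd : ContMDiffAt I 𝓘(ℝ, F) ∞ (fun y => (θ y).2) y :=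
  _root_.contMDiffAt_snd.comp y (hθ.contMDiffAt hy)

lemma contMDiffAt_symm_left : ContMDiffAt IK I ∞ (fun p => θ.symm (p, (θ y).2)) (θ y).1 :=
  (hθ.contMDiffAt_symm hy).comp (θ y).1 (contMDiffAt_id.prodMk contMDiffAt_const)

lemma contMDiffAt_symm_right :
    ContMDiffAt 𝓘(ℝ, F) I ∞ (fun z => θ.symm ((θ y).1, z)) (θ y).2 :=
  (hθ.contMDiffAt_symm hy).comp (θ y).2 (contMDiffAt_const.prodMk contMDiffAt_id)

lemma derivFst_inclFst (w : TangentSpace IK (θ y).1) :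
    derivFst IK I θ y (inclFst IK I θ y w) = w := by
  have h := mfderiv_apply_mfderiv_of_eventuallyEq (k := id)
    ((hθ.contMDiffAt_fst hy).mdifferentiableAt (by simp))
    ((hθ.contMDiffAt_symm_left hy).mdifferentiableAt (by simp)) (θ.left_inv hy)
    (by filter_upwards [eventually_prodMk_left_mem_target hy] with p hp; simp [θ.right_inv hp]) w
  rw [mfderiv_id] at h
  exact h

lemma derivFst_inclSnd (w : TangentSpace 𝓘(ℝ, F) (θ y).2) :
    derivFst IK I θ y (inclSnd I θ y w) = 0 := by
  have h := mfderiv_apply_mfderiv_of_eventuallyEq (k := fun _ => (θ y).1)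
    ((hθ.contMDiffAt_fst hy).mdifferentiableAt (by simp))
    ((hθ.contMDiffAt_symm_right hy).mdifferentiableAt (by simp)) (θ.left_inv hy)
    (by filter_upwards [eventually_prodMk_right_mem_target hy] with p hp; simp [θ.right_inv hp]) w
  rw [mfderiv_const] at h
  exact h

lemma derivSnd_inclFst (w : TangentSpace IK (θ y).1) :
    derivSnd I θ y (inclFst IK I θ y w) = 0 := by
  have h := mfderiv_apply_mfderiv_of_eventuallyEq (k := fun _ => (θ y).2)
    ((hθ.contMDiffAt_snd hy).mdifferentiableAt (by simp))
    ((hθ.contMDiffAt_symm_left hy).mdifferentiableAt (by simp)) (θ.left_inv hy)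
    (by filter_upwards [eventually_prodMk_left_mem_target hy] with p hp; simp [θ.right_inv hp]) w
  rw [mfderiv_const] at h
  exact h

lemma derivSnd_inclSnd (w : TangentSpace 𝓘(ℝ, F) (θ y).2) :
    derivSnd I θ y (inclSnd I θ y w) = w := by
  have h := mfderiv_apply_mfderiv_of_eventuallyEq (k := id)
    ((hθ.contMDiffAt_snd hy).mdifferentiableAt (by simp))
    ((hθ.contMDiffAt_symm_right hy).mdifferentiableAt (by simp)) (θ.left_inv hy)
    (by filter_upwards [eventually_prodMk_right_mem_target hy] with p hp; simp [θ.right_inv hp]) w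
  rw [mfderiv_id] at h
  exact h

lemma mfderiv_eq_prod : mfderiv I (IK.prod 𝓘(ℝ, F)) θ y
    = (derivFst IK I θ y).prod (derivSnd I θ y) :=
  mfderiv_prodMk ((hθ.contMDiffAt_fst hy).mdifferentiableAt (by simp))
    ((hθ.contMDiffAt_snd hy).mdifferentiableAt (by simp))

lemma inclFst_derivFst_add_inclSnd_derivSnd (v : TangentSpace I y) :
    inclFst IK I θ y (derivFst IK I θ y v) + inclSnd I θ y (derivSnd I θ y v) = v := by
  have hsymm := (hθ.contMDiffAt_symm hy).mdifferentiableAt (by simp)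
  have h := mfderiv_apply_mfderiv_of_eventuallyEq (k := id) hsymm
    ((hθ.contMDiffAt hy).mdifferentiableAt (by simp)) rfl
    (by filter_upwards [θ.open_source.mem_nhds hy] with p hp; simp [θ.left_inv hp]) v
  rw [mfderiv_id, mfderiv_prod_eq_add_apply hsymm, hθ.mfderiv_eq_prod hy] at h
  exact h

lemma ext_derivFst_derivSnd {v w : TangentSpace I y}
    (hfst : derivFst IK I θ y v = derivFst IK I θ y w)
    (hsnd : derivSnd I θ y v = derivSnd I θ y w) : v = w := by
  rw [← hθ.inclFst_derivFst_add_inclSnd_derivSnd hy v,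
    ← hθ.inclFst_derivFst_add_inclSnd_derivSnd hy w, hfst, hsnd]

section

omit hθ hy in
lemma inCoordinates_congr_base [IsManifold I 1 M] [IsManifold IK 1 K] (a a' : K) (b : M) {c c' : M}
    (h : c = c') (φ : EK →L[ℝ] E) :
    ContinuousLinearMap.inCoordinates EK (TangentSpace IK) E (TangentSpace I) a a' b c φ
      = ContinuousLinearMap.inCoordinates EK (TangentSpace IK) E (TangentSpace I) a a' b c' φ := by
  subst h
  rfl

variable [IsManifold I ∞ M]

lemma contMDiffAt_derivFst [IsManifold IK ∞ K] : ContMDiffAt I 𝓘(ℝ, E →L[ℝ] EK) ∞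
    (inTangentCoordinates I IK id (fun y => (θ y).1) (derivFst IK I θ) y) y :=
  (hθ.contMDiffAt_fst hy).mfderiv_const (by simp)

lemma contMDiffAt_derivSnd : ContMDiffAt I 𝓘(ℝ, E →L[ℝ] F) ∞
    (inTangentCoordinates I 𝓘(ℝ, F) id (fun y => (θ y).2) (derivSnd I θ) y) y :=
  (hθ.contMDiffAt_snd hy).mfderiv_const (by simp)

lemma contMDiffAt_inclFst [IsManifold IK ∞ K] : ContMDiffAt I 𝓘(ℝ, EK →L[ℝ] E) ∞
    (inTangentCoordinates IK I (fun y => (θ y).1) id (inclFst IK I θ) y) y := by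
  have hsymm : ContMDiffAt (I.prod IK) I ∞
      (uncurry fun (y : M) (p : K) => θ.symm (p, (θ y).2)) (y, (θ y).1) :=
    (hθ.contMDiffAt_symm hy).comp_of_eq (_root_.contMDiffAt_snd.prodMk
      ((hθ.contMDiffAt_snd hy).comp_of_eq _root_.contMDiffAt_fst rfl)) rfl
  refine (hsymm.mfderiv _ _ (hθ.contMDiffAt_fst hy) (m := ∞) (by simp)).congr_of_eventuallyEq ?_
  filter_upwards [θ.open_source.mem_nhds hy] with x hx
  have hy_inv : θ.symm ((θ y).1, (θ y).2) = y := θ.left_inv hy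
  simp only [inTangentCoordinates, hy_inv]
  exact inCoordinates_congr_base _ _ _ (θ.left_inv hx).symm _

lemma contMDiffAt_inclSnd : ContMDiffAt I 𝓘(ℝ, F →L[ℝ] E) ∞
    (inTangentCoordinates 𝓘(ℝ, F) I (fun y => (θ y).2) id (inclSnd I θ) y) y := by
  have hsymm : ContMDiffAt (I.prod 𝓘(ℝ, F)) I ∞
      (uncurry fun (y : M) (z : F) => θ.symm ((θ y).1, z)) (y, (θ y).2) :=
    (hθ.contMDiffAt_symm hy).comp_of_eq
      (((hθ.contMDiffAt_fst hy).comp_of_eq _root_.contMDiffAt_fst rfl).prodMk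
        _root_.contMDiffAt_snd) rfl
  refine (hsymm.mfderiv _ _ (hθ.contMDiffAt_snd hy) (m := ∞) (by simp)).congr_of_eventuallyEq ?_
  filter_upwards [θ.open_source.mem_nhds hy] with x hx
  have hy_inv : θ.symm ((θ y).1, (θ y).2) = y := θ.left_inv hy
  simp only [inTangentCoordinates, hy_inv]
  exact inCoordinates_congr_base _ _ _ (θ.left_inv hx).symm _

end

end IsSmoothChart

namespace IsSmoothChart

variable [IsManifold IK ∞ K]

variable (I) in
/-- The almost complex structure on the source of a chart that corresponds to the product of the
complex structure of `K` and of the multiplication by `i` on `ℝ⁴`. -/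
def localJ (S : KahlerStructure IK K) (θ : OpenPartialHomeomorph M (K × R4)) (s : ℝ) (y : M) :
    TangentSpace I y →L[ℝ] TangentSpace I y :=
  (inclFst IK I θ y).comp ((S.cplx.J (θ y).1).comp (derivFst IK I θ y))
    + (inclSnd I θ y).comp ((show TangentSpace 𝓘(ℝ, R4) (θ y).2 →L[ℝ]
        TangentSpace 𝓘(ℝ, R4) (θ y).2 from R4.mulI s).comp (derivSnd I θ y))

variable (I) in
/-- The metric on the source of a chart that corresponds to the product of the metric of `K` and of
the Hopf metric. -/
def localMetric (S : KahlerStructure IK K) (θ : OpenPartialHomeomorph M (K × R4)) (y : M) :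
    TangentSpace I y →L[ℝ] TangentSpace I y →L[ℝ] ℝ :=
  bilinPullback (S.metric.inner (θ y).1) (derivFst IK I θ y)
    + bilinPullback (R4.hopfMetric (θ y).2) (derivSnd I θ y)

variable {S : KahlerStructure IK K} {θ : OpenPartialHomeomorph M (K × R4)}

lemma localMetric_apply (y : M) (v w : TangentSpace I y) :
    localMetric I S θ y v w = S.metric.inner (θ y).1 (derivFst IK I θ y v) (derivFst IK I θ y w)
      + (‖(θ y).2‖ ^ 2)⁻¹
        * inner ℝ (show R4 from derivSnd I θ y v) (show R4 from derivSnd I θ y w) := rfl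

variable (hθ : IsSmoothChart IK I θ) {y : M} (hy : y ∈ θ.source) (s : ℝ)
include hθ hy

lemma derivFst_localJ (v : TangentSpace I y) :
    derivFst IK I θ y (localJ I S θ s y v) = S.cplx.J (θ y).1 (derivFst IK I θ y v) := by
  have hfst := hθ.derivFst_inclFst hy (S.cplx.J (θ y).1 (derivFst IK I θ y v))
  have hsnd := hθ.derivFst_inclSnd hy (R4.mulI s (derivSnd I θ y v))
  refine (map_add (derivFst IK I θ y) _ _).trans ?_
  exact (congrArg₂ (· + ·) hfst hsnd).trans (add_zero _)

lemma derivSnd_localJ (v : TangentSpace I y) :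
    derivSnd I θ y (localJ I S θ s y v) = R4.mulI s (derivSnd I θ y v) := by
  have hfst := hθ.derivSnd_inclFst hy (S.cplx.J (θ y).1 (derivFst IK I θ y v))
  have hsnd := hθ.derivSnd_inclSnd hy (R4.mulI s (derivSnd I θ y v))
  refine (map_add (derivSnd I θ y) _ _).trans ?_
  exact (congrArg₂ (· + ·) hfst hsnd).trans (zero_add _)

variable [IsManifold I ∞ M]

lemma contMDiffAt_localJ : ContMDiffAt I 𝓘(ℝ, E →L[ℝ] E) ∞
    (inTangentCoordinates I I id id (localJ I S θ s) y) y := by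
  have hcont_fst := (hθ.contMDiffAt_fst hy).continuousAt
  have hcont_snd := (hθ.contMDiffAt_snd hy).continuousAt
  have hJ := (contMDiffAt_endomorphism_iff.1 (S.cplx.contMDiff (θ y).1)).comp y
    (hθ.contMDiffAt_fst hy)
  have hJ_comp : ContMDiffAt I 𝓘(ℝ, E →L[ℝ] EK) ∞
      (inTangentCoordinates I IK id (fun y => (θ y).1)
        (fun y => (S.cplx.J (θ y).1).comp (derivFst IK I θ y)) y) y :=
    contMDiffAt_inTangentCoordinates_comp (g := fun y => (θ y).1)
      (χ := fun y => S.cplx.J (θ y).1) hJ (hθ.contMDiffAt_derivFst hy) hcont_fst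
  have hmulI : ContMDiffAt I 𝓘(ℝ, R4 →L[ℝ] R4) ∞ (inTangentCoordinates 𝓘(ℝ, R4) 𝓘(ℝ, R4)
      (fun y => (θ y).2) (fun y => (θ y).2) (fun _ => R4.mulI s) y) y := by
    rw [inTangentCoordinates_model_space]
    exact contMDiffAt_const
  have hmulI_comp : ContMDiffAt I 𝓘(ℝ, E →L[ℝ] R4) ∞
      (inTangentCoordinates I 𝓘(ℝ, R4) id (fun y => (θ y).2)
        (fun y => (show TangentSpace 𝓘(ℝ, R4) (θ y).2 →L[ℝ] TangentSpace 𝓘(ℝ, R4) (θ y).2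
          from R4.mulI s).comp (derivSnd I θ y)) y) y :=
    contMDiffAt_inTangentCoordinates_comp (g := fun y => (θ y).2)
      (χ := fun _ => R4.mulI s) hmulI (hθ.contMDiffAt_derivSnd hy) hcont_snd
  have hfst :=
    contMDiffAt_inTangentCoordinates_comp (hθ.contMDiffAt_inclFst hy) hJ_comp hcont_fst
  have hsnd :=
    contMDiffAt_inTangentCoordinates_comp (hθ.contMDiffAt_inclSnd hy) hmulI_comp hcont_snd
  refine (hfst.add hsnd).congr_of_eventuallyEq (Filter.Eventually.of_forall fun x => ?_)
  exact inTangentCoordinates_add (f := id) (g := id) _ _ y x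

lemma contMDiffAt_localMetric (hz : (θ y).2 ≠ 0) : ContMDiffAt I 𝓘(ℝ, E →L[ℝ] E →L[ℝ] ℝ) ∞
    (bilinInCoordinates (localMetric I S θ) y) y := by
  have hfst := contMDiffAt_bilinInCoordinates_pullback (P := fun y => (θ y).1)
    (contMDiffAt_bilin_iff.1 (S.metric.contMDiff (θ y).1)) (hθ.contMDiffAt_derivFst hy)
    (hθ.contMDiffAt_fst hy)
  have hhopf : ContMDiffAt 𝓘(ℝ, R4) 𝓘(ℝ, R4 →L[ℝ] R4 →L[ℝ] ℝ) ∞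
      (bilinInCoordinates R4.hopfMetric (θ y).2) (θ y).2 := by
    rw [R4.bilinInCoordinates_hopfMetric]
    exact ((R4.contDiffAt_inv_norm_sq hz).smul contDiffAt_const).contMDiffAt
  have hsnd := contMDiffAt_bilinInCoordinates_pullback (P := fun y => (θ y).2) hhopf
    (hθ.contMDiffAt_derivSnd hy) (hθ.contMDiffAt_snd hy)
  exact hfst.add hsnd

end IsSmoothChart

end LocalModel

section ComplexCoordinates

namespace R4

variable {s : ℝ} (hs : s * s = 1)

/-- The coordinates `z₀ + i z₁` and `z₂ + i s z₃`, which turn `mulI s` into the multiplication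
by `i` of `ℂ²`. -/
def complexPair : R4 ≃L[ℝ] (Fin 2 → ℂ) :=
  LinearEquiv.toContinuousLinearEquiv
    { toFun := fun z => ![⟨z 0, z 1⟩, ⟨z 2, s * z 3⟩]
      invFun := fun w => WithLp.toLp 2 ![(w 0).re, (w 0).im, (w 1).re, s * (w 1).im]
      map_add' := fun z w => by
        ext j
        fin_cases j <;> apply Complex.ext <;> simp [mul_add]
      map_smul' := fun c z => by
        ext j
        fin_cases j <;> apply Complex.ext <;> simp [mul_left_comm]
      left_inv := fun z => by
        apply ext_coord <;> simp [← mul_assoc, hs]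
      right_inv := fun w => by
        ext j
        fin_cases j <;> apply Complex.ext <;> simp [← mul_assoc, hs] }

lemma complexPair_mulI (z : R4) :
    complexPair hs (mulI s z) = Complex.I • complexPair hs z := by
  ext j
  fin_cases j <;> apply Complex.ext <;> simp [complexPair, ← mul_assoc, hs]

variable (n : ℕ)

/-- The identification `ℂⁿ × ℂ² = ℂⁿ⁺²`. -/
def appendPair : ((Fin n → ℂ) × (Fin 2 → ℂ)) ≃L[ℂ] (Fin (n + 2) → ℂ) :=
  (ContinuousLinearEquiv.sumPiEquivProdPi ℂ (Fin n) (Fin 2) fun _ => ℂ).symm.trans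
    (ContinuousLinearEquiv.piCongrLeft ℂ (fun _ => ℂ) finSumFinEquiv)

/-- Complex coordinates on `ℂⁿ × ℝ⁴`, where `mulI s` is the complex structure of `ℝ⁴`. -/
def prodComplexPair : ((Fin n → ℂ) × R4) ≃L[ℝ] (Fin (n + 2) → ℂ) :=
  ((ContinuousLinearEquiv.refl ℝ (Fin n → ℂ)).prodCongr (complexPair hs)).trans
    ((appendPair n).toLinearEquiv.restrictScalars ℝ).toContinuousLinearEquiv

lemma prodComplexPair_mulI (a : Fin n → ℂ) (z : R4) :
    prodComplexPair hs n (Complex.I • a, mulI s z)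
      = Complex.I • prodComplexPair hs n (a, z) :=
  calc appendPair n (Complex.I • a, complexPair hs (mulI s z))
    _ = appendPair n (Complex.I • (a, complexPair hs z)) := by
      rw [complexPair_mulI, Prod.smul_mk]
    _ = Complex.I • appendPair n (a, complexPair hs z) := map_smul _ _ _

end R4

end ComplexCoordinates

section HopfAtlas

open Bundle

variable {EK : Type*} [NormedAddCommGroup EK] [NormedSpace ℝ EK] {HK : Type*} [TopologicalSpace HK]
  {IK : ModelWithCorners ℝ EK HK} {K : Type*} [TopologicalSpace K] [ChartedSpace HK K]
  {E : Type*} [NormedAddCommGroup E] [NormedSpace ℝ E] {H : Type*} [TopologicalSpace H]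
  {I : ModelWithCorners ℝ E H} {M : Type*} [TopologicalSpace M] [ChartedSpace H M]

namespace IsSmoothChart

variable {F : Type*} [NormedAddCommGroup F] [NormedSpace ℝ F]

section

variable {V : Type*} [NormedAddCommGroup V] [NormedSpace ℝ V]
  {W : Type*} [NormedAddCommGroup W] [NormedSpace ℝ W]
  {θ : OpenPartialHomeomorph M (K × F)} {φ : OpenPartialHomeomorph K V} {e : (V × F) ≃L[ℝ] W}
  {y : M}

variable (θ φ e) in
/-- The coordinates on `M` obtained from coordinates on the factor `K` of a chart with values in
`K × F`. -/
def prodCoordinates : OpenPartialHomeomorph M W :=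
  (θ ≫ₕ φ.prod (OpenPartialHomeomorph.refl F)) ≫ₕ e.toHomeomorph.toOpenPartialHomeomorph

lemma mem_prodCoordinates_source :
    y ∈ (prodCoordinates θ φ e).source ↔ y ∈ θ.source ∧ (θ y).1 ∈ φ.source := by
  simp [prodCoordinates]

lemma mem_prodCoordinates_target {w : W} : w ∈ (prodCoordinates θ φ e).target ↔
    (e.symm w).1 ∈ φ.target ∧ (φ.symm (e.symm w).1, (e.symm w).2) ∈ θ.target := by
  simp [prodCoordinates]

variable (hθ : IsSmoothChart IK I θ)
include hθ

lemma contMDiffOn_prodCoordinates (hφ : ContMDiffOn IK 𝓘(ℝ, V) ∞ φ φ.source) :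
    ContMDiffOn I 𝓘(ℝ, W) ∞ (prodCoordinates θ φ e) (prodCoordinates θ φ e).source := by
  intro y hy
  obtain ⟨hyθ, hyφ⟩ := mem_prodCoordinates_source.1 hy
  have hfst : ContMDiffAt I 𝓘(ℝ, V) ∞ (fun y => φ (θ y).1) y :=
    (hφ.contMDiffAt (φ.open_source.mem_nhds hyφ)).comp y (hθ.contMDiffAt_fst hyθ)
  exact (e.contDiff.contMDiff.contMDiffAt.comp y
    (hfst.prodMk_space (hθ.contMDiffAt_snd hyθ))).contMDiffWithinAt

lemma contMDiffOn_prodCoordinates_symm (hφ : ContMDiffOn 𝓘(ℝ, V) IK ∞ φ.symm φ.target) :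
    ContMDiffOn 𝓘(ℝ, W) I ∞ (prodCoordinates θ φ e).symm (prodCoordinates θ φ e).target := by
  intro w hw
  obtain ⟨hwφ, hwθ⟩ := mem_prodCoordinates_target.1 hw
  have hfst : ContMDiffAt 𝓘(ℝ, W) 𝓘(ℝ, V) ∞ (fun w => (e.symm w).1) w :=
    (contDiff_fst.comp e.symm.contDiff).contMDiff.contMDiffAt
  have hsnd : ContMDiffAt 𝓘(ℝ, W) 𝓘(ℝ, F) ∞ (fun w => (e.symm w).2) w :=
    (contDiff_snd.comp e.symm.contDiff).contMDiff.contMDiffAt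
  have hφ_symm := (hφ.contMDiffAt (φ.open_target.mem_nhds hwφ)).comp w hfst
  have hθ_symm := hθ.contMDiffOn_symm.contMDiffAt (θ.open_target.mem_nhds hwθ)
  exact (hθ_symm.comp w (hφ_symm.prodMk hsnd)).contMDiffWithinAt

lemma mfderiv_prodCoordinates_apply (hφ : ContMDiffOn IK 𝓘(ℝ, V) ∞ φ φ.source)
    (hy : y ∈ (prodCoordinates θ φ e).source) (v : E) :
    (mfderiv I 𝓘(ℝ, W) (prodCoordinates θ φ e) y : E →L[ℝ] W) v
      = e ((mfderiv IK 𝓘(ℝ, V) φ (θ y).1 : EK →L[ℝ] V) ((derivFst IK I θ y : E →L[ℝ] EK) v),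
        (derivSnd I θ y : E →L[ℝ] F) v) := by
  obtain ⟨hyθ, hyφ⟩ := mem_prodCoordinates_source.1 hy
  have hfst : HasMFDerivAt I 𝓘(ℝ, V) (fun y => φ (θ y).1) y
      ((mfderiv IK 𝓘(ℝ, V) φ (θ y).1).comp (derivFst IK I θ y)) :=
    ((hφ.contMDiffAt (φ.open_source.mem_nhds hyφ)).mdifferentiableAt (by simp)).hasMFDerivAt.comp y
      ((hθ.contMDiffAt_fst hyθ).mdifferentiableAt (by simp)).hasMFDerivAt
  have hsnd : HasMFDerivAt I 𝓘(ℝ, F) (fun y => (θ y).2) y (derivSnd I θ y) :=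
    ((hθ.contMDiffAt_snd hyθ).mdifferentiableAt (by simp)).hasMFDerivAt
  have hprod : HasMFDerivAt I 𝓘(ℝ, V × F) (fun y => (φ (θ y).1, (θ y).2)) y
      (((mfderiv IK 𝓘(ℝ, V) φ (θ y).1).comp (derivFst IK I θ y)).prod (derivSnd I θ y)) :=
    ⟨hfst.1.prodMk hsnd.1, hfst.2.prodMk hsnd.2⟩
  have he : HasMFDerivAt 𝓘(ℝ, V × F) 𝓘(ℝ, W) e (φ (θ y).1, (θ y).2)
      (e : (V × F) →L[ℝ] W) := e.hasFDerivAt.hasMFDerivAt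
  exact congrArg (fun L : E →L[ℝ] W => L v) (he.comp y hprod).mfderiv

end

section

variable {θ θ' : OpenPartialHomeomorph M (K × F)} {y : M} (hθ : IsSmoothChart IK I θ)
  (hy : y ∈ θ.source)
include hθ hy

lemma derivFst_of_transition {g : K → K} (hg : MDifferentiableAt IK IK g (θ y).1)
    (h : ∀ᶠ x in 𝓝 y, (θ' x).1 = g (θ x).1) (v : E) :
    (derivFst IK I θ' y : E →L[ℝ] EK) v
      = (mfderiv IK IK g (θ y).1 : EK →L[ℝ] EK) ((derivFst IK I θ y : E →L[ℝ] EK) v) := by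
  refine (mfderiv_apply_mfderiv_of_eventuallyEq (k := fun y => (θ' y).1) hg
    ((hθ.contMDiffAt_fst hy).mdifferentiableAt (by simp)) rfl ?_ v).symm
  filter_upwards [h] with x hx using hx.symm

lemma derivSnd_of_transition {c : ℝ} (h : ∀ᶠ x in 𝓝 y, (θ' x).2 = c • (θ x).2) (v : E) :
    (derivSnd I θ' y : E →L[ℝ] F) v = c • (derivSnd I θ y : E →L[ℝ] F) v := by
  have hc : HasMFDerivAt 𝓘(ℝ, F) 𝓘(ℝ, F) (fun z : F => c • z) (θ y).2
      (c • ContinuousLinearMap.id ℝ F) :=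
    (c • ContinuousLinearMap.id ℝ F).hasFDerivAt.hasMFDerivAt
  have hcomp := mfderiv_apply_mfderiv_of_eventuallyEq (k := fun y => (θ' y).2)
    hc.mdifferentiableAt ((hθ.contMDiffAt_snd hy).mdifferentiableAt (by simp)) rfl
    (by filter_upwards [h] with x hx using hx.symm) v
  rw [hc.mfderiv] at hcomp
  exact hcomp.symm

end

section

variable {n : ℕ} {θ : OpenPartialHomeomorph M (K × F)} {y : M} {β : F → F [⋀^Fin n]→L[ℝ] ℝ}
  [IsManifold I ∞ M] [I.Boundaryless]
  (hθ : IsSmoothChart IK I θ) (hy : y ∈ θ.source) (hβ : ContDiffAt ℝ ∞ β (θ y).2)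
include hθ hy hβ

lemma smoothAt_pullback_snd [FiniteDimensional ℝ E] :
    (DiffForm.pullback I (fun x => (θ x).2) (DiffForm.ofFun β)).SmoothAt y :=
  DiffForm.SmoothAt.pullback (f := fun x => (θ x).2) (DiffForm.smoothAt_ofFun.2 hβ)
    (hθ.contMDiffAt_snd hy)

lemma extDeriv_pullback_snd :
    (DiffForm.pullback I (fun x => (θ x).2) (DiffForm.ofFun β)).extDeriv y
      = DiffForm.pullback I (fun x => (θ x).2) (DiffForm.ofFun (extDeriv β)) y := by
  rw [DiffForm.SmoothAt.extDeriv_pullback (f := fun x => (θ x).2) (DiffForm.smoothAt_ofFun.2 hβ)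
    (hθ.contMDiffAt_snd hy), DiffForm.extDeriv_ofFun]

end

end IsSmoothChart

variable [IsManifold IK ∞ K]

namespace KahlerStructure

variable (S : KahlerStructure IK K) {p q : K}

lemma J_congr (h : p = q) (v : EK) :
    (S.cplx.J p : EK →L[ℝ] EK) v = (S.cplx.J q : EK →L[ℝ] EK) v := by
  subst h
  rfl

lemma inner_congr (h : p = q) (v w : EK) : (S.metric.inner p : EK →L[ℝ] EK →L[ℝ] ℝ) v w
    = (S.metric.inner q : EK →L[ℝ] EK →L[ℝ] ℝ) v w := by
  subst h
  rfl

lemma inner_self_nonneg (p : K) (v : TangentSpace IK p) : 0 ≤ S.metric.inner p v v := by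
  rcases eq_or_ne v 0 with rfl | hv
  · rw [map_zero]
  · exact (S.metric.pos p v hv).le

end KahlerStructure

namespace IsSmoothChart

variable {S : KahlerStructure IK K} {θ θ' : OpenPartialHomeomorph M (K × R4)} {y : M}
  (hθ : IsSmoothChart IK I θ) (hy : y ∈ θ.source)
  {g : K ≃ₘ⟮IK, IK⟯ K} (hg : S.IsHolomorphicIsometry g) {c : ℝ}
  (h : ∀ᶠ x in 𝓝 y, θ' x = (g (θ x).1, c • (θ x).2))
include hθ hy hg h

lemma localJ_eq_of_transition (hθ' : IsSmoothChart IK I θ') (hy' : y ∈ θ'.source) (s : ℝ) :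
    localJ I S θ' s y = localJ I S θ s y := by
  ext v
  have hfst (w : E) := hθ.derivFst_of_transition hy (g.mdifferentiable (by simp) (θ y).1)
    (h.mono fun x hx => congrArg Prod.fst hx) w
  have hsnd (w : E) := hθ.derivSnd_of_transition hy (h.mono fun x hx => congrArg Prod.snd hx) w
  apply hθ'.ext_derivFst_derivSnd hy'
  · have hJ : S.cplx.J (θ' y).1 (derivFst IK I θ' y v)
        = S.cplx.J (g (θ y).1) (mfderiv IK IK g (θ y).1 (derivFst IK I θ y v)) :=
      (S.J_congr (congrArg Prod.fst h.self_of_nhds) _).trans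
        (congrArg (S.cplx.J (g (θ y).1) : EK →L[ℝ] EK) (hfst v))
    have hJ_localJ : derivFst IK I θ' y (localJ I S θ s y v)
        = mfderiv IK IK g (θ y).1 (S.cplx.J (θ y).1 (derivFst IK I θ y v)) :=
      (hfst _).trans (congrArg (mfderiv IK IK g (θ y).1 : EK →L[ℝ] EK) (hθ.derivFst_localJ hy s v))
    exact (hθ'.derivFst_localJ hy' s v).trans
      (hJ.trans ((hg.holomorphic _ _).symm.trans hJ_localJ.symm))
  · have hmulI : R4.mulI s (derivSnd I θ' y v) = c • R4.mulI s (derivSnd I θ y v) :=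
      (congrArg (R4.mulI s) (hsnd v)).trans (map_smul (R4.mulI s) c _)
    have hmulI_localJ : derivSnd I θ' y (localJ I S θ s y v)
        = c • R4.mulI s (derivSnd I θ y v) :=
      (hsnd _).trans (congrArg (fun z : R4 => c • z) (hθ.derivSnd_localJ hy s v))
    exact (hθ'.derivSnd_localJ hy' s v).trans (hmulI.trans hmulI_localJ.symm)

lemma localMetric_eq_of_transition (hc : c ≠ 0) : localMetric I S θ' y = localMetric I S θ y := by
  ext v w
  have hfst (u : E) := hθ.derivFst_of_transition hy (g.mdifferentiable (by simp) (θ y).1)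
    (h.mono fun x hx => congrArg Prod.fst hx) u
  have hsnd (u : E) := hθ.derivSnd_of_transition hy (h.mono fun x hx => congrArg Prod.snd hx) u
  rw [localMetric_apply, localMetric_apply]
  congr 1
  · calc (S.metric.inner (θ' y).1 : EK →L[ℝ] EK →L[ℝ] ℝ) ((derivFst IK I θ' y : E →L[ℝ] EK) v)
          ((derivFst IK I θ' y : E →L[ℝ] EK) w)
      _ = (S.metric.inner (g (θ y).1) : EK →L[ℝ] EK →L[ℝ] ℝ)
            ((mfderiv IK IK g (θ y).1 : EK →L[ℝ] EK) ((derivFst IK I θ y : E →L[ℝ] EK) v))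
            ((mfderiv IK IK g (θ y).1 : EK →L[ℝ] EK) ((derivFst IK I θ y : E →L[ℝ] EK) w)) :=
          (S.inner_congr (congrArg Prod.fst h.self_of_nhds) _ _).trans (congrArg₂
            (fun a b => (S.metric.inner (g (θ y).1) : EK →L[ℝ] EK →L[ℝ] ℝ) a b) (hfst v) (hfst w))
      _ = _ := hg.isometry _ _ _
  · calc (‖(θ' y).2‖ ^ 2)⁻¹ * inner ℝ ((derivSnd I θ' y : E →L[ℝ] R4) v)
          ((derivSnd I θ' y : E →L[ℝ] R4) w)
      _ = (‖c • (θ y).2‖ ^ 2)⁻¹ * inner ℝ (c • (derivSnd I θ y : E →L[ℝ] R4) v)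
            (c • (derivSnd I θ y : E →L[ℝ] R4) w) :=
          congr (congrArg (fun z : R4 => ((‖z‖ ^ 2)⁻¹ * ·)) (congrArg Prod.snd h.self_of_nhds))
            (congrArg₂ (fun a b : R4 => inner ℝ a b) (hsnd v) (hsnd w))
      _ = _ := R4.inv_norm_sq_mul_inner_smul hc _ _ _

end IsSmoothChart

/-- An atlas of local diffeomorphisms from `M` to `K × (ℝ⁴ \ {0})`, whose coordinate changes are
products of holomorphic isometries of `K` and dilations of `ℝ⁴`. -/
structure HopfAtlas (I : ModelWithCorners ℝ E H) (M : Type*) [TopologicalSpace M]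
    [ChartedSpace H M] (S : KahlerStructure IK K) (ι : Type*) where
  chart : ι → OpenPartialHomeomorph M (K × R4)
  isSmooth (i : ι) : IsSmoothChart IK I (chart i)
  ne_zero (i : ι) (y : M) (hy : y ∈ (chart i).source) : (chart i y).2 ≠ 0
  index : M → ι
  mem_source (y : M) : y ∈ (chart (index y)).source
  compat (i j : ι) (y : M) (hi : y ∈ (chart i).source) (hj : y ∈ (chart j).source) :
    ∃ (g : K ≃ₘ⟮IK, IK⟯ K) (c : ℝ), c ≠ 0 ∧ S.IsHolomorphicIsometry g ∧
      ∀ᶠ x in 𝓝 y, chart j x = (g (chart i x).1, c • (chart i x).2)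

namespace HopfAtlas

open IsSmoothChart

variable {S : KahlerStructure IK K} {ι : Type*} (A : HopfAtlas I M S ι)

/-- The field of endomorphisms whose expression in the charts is the product of the complex
structure of `K` and of `R4.mulI s`; the choice of charts is immaterial by `J_eq`. -/
def J (s : ℝ) (y : M) : TangentSpace I y →L[ℝ] TangentSpace I y :=
  localJ I S (A.chart (A.index y)) s y

/-- The metric whose expression in the charts is the product of the metric of `K` and of the
Hopf metric `|z|⁻² ⟪·, ·⟫`; the choice of charts is immaterial by `inner_eq`. -/
def inner (y : M) : TangentSpace I y →L[ℝ] TangentSpace I y →L[ℝ] ℝ :=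
  localMetric I S (A.chart (A.index y)) y

section

variable {i : ι} {y : M} (hy : y ∈ (A.chart i).source)
include hy

lemma J_eq (s : ℝ) : A.J s y = localJ I S (A.chart i) s y := by
  obtain ⟨g, c, _, hg, h⟩ := A.compat i _ y hy (A.mem_source y)
  exact localJ_eq_of_transition (A.isSmooth _) hy hg h (A.isSmooth _) (A.mem_source y) s

lemma inner_eq : A.inner y = localMetric I S (A.chart i) y := by
  obtain ⟨g, c, hc, hg, h⟩ := A.compat i _ y hy (A.mem_source y)
  exact localMetric_eq_of_transition (A.isSmooth _) hy hg h hc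

lemma derivFst_J (s : ℝ) (v : TangentSpace I y) :
    derivFst IK I (A.chart i) y (A.J s y v)
      = S.cplx.J (A.chart i y).1 (derivFst IK I (A.chart i) y v) := by
  rw [A.J_eq hy, (A.isSmooth i).derivFst_localJ hy]

lemma derivSnd_J (s : ℝ) (v : TangentSpace I y) :
    derivSnd I (A.chart i) y (A.J s y v) = R4.mulI s (derivSnd I (A.chart i) y v) := by
  rw [A.J_eq hy, (A.isSmooth i).derivSnd_localJ hy]

lemma inner_apply (v w : TangentSpace I y) : A.inner y v w
    = S.metric.inner (A.chart i y).1 (derivFst IK I (A.chart i) y v)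
        (derivFst IK I (A.chart i) y w)
      + (‖(A.chart i y).2‖ ^ 2)⁻¹ * Inner.inner ℝ (show R4 from derivSnd I (A.chart i) y v)
        (show R4 from derivSnd I (A.chart i) y w) := by
  rw [A.inner_eq hy, localMetric_apply]

lemma inner_self_apply (v : TangentSpace I y) : A.inner y v v
    = S.metric.inner (A.chart i y).1 (derivFst IK I (A.chart i) y v)
        (derivFst IK I (A.chart i) y v)
      + (‖(A.chart i y).2‖ ^ 2)⁻¹ * ‖(show R4 from derivSnd I (A.chart i) y v)‖ ^ 2 := by
  rw [A.inner_apply hy, real_inner_self_eq_norm_sq]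

lemma eventually_mem_source : ∀ᶠ x in 𝓝 y, x ∈ (A.chart i).source :=
  (A.chart i).open_source.mem_nhds hy

end

lemma J_J {s : ℝ} (hs : s * s = 1) (y : M) (v : TangentSpace I y) :
    A.J s y (A.J s y v) = -v := by
  have hy := A.mem_source y
  apply (A.isSmooth _).ext_derivFst_derivSnd hy
  · rw [A.derivFst_J hy, A.derivFst_J hy, S.cplx.J_J, map_neg]
  · rw [A.derivSnd_J hy, A.derivSnd_J hy]
    exact (R4.mulI_mulI hs _).trans (map_neg (derivSnd I (A.chart (A.index y)) y) v).symm

lemma inner_J_J {s : ℝ} (hs : s * s = 1) (y : M) (v w : TangentSpace I y) :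
    A.inner y (A.J s y v) (A.J s y w) = A.inner y v w := by
  have hy := A.mem_source y
  rw [A.inner_apply hy, A.inner_apply hy, A.derivFst_J hy, A.derivFst_J hy, A.derivSnd_J hy,
    A.derivSnd_J hy, S.compatible]
  congr 2
  exact R4.inner_mulI_mulI hs _ _

lemma inner_pos (y : M) (v : TangentSpace I y) (hv : v ≠ 0) : 0 < A.inner y v v := by
  have hy := A.mem_source y
  have hz := A.ne_zero _ y hy
  rw [A.inner_self_apply hy]
  by_cases hfst : derivFst IK I (A.chart (A.index y)) y v = 0
  · have hsnd : (show R4 from derivSnd I (A.chart (A.index y)) y v) ≠ 0 := fun hsnd =>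
      hv ((A.isSmooth _).ext_derivFst_derivSnd hy (hfst.trans (map_zero _).symm)
        (hsnd.trans (map_zero (derivSnd I (A.chart (A.index y)) y)).symm))
    exact add_pos_of_nonneg_of_pos (S.inner_self_nonneg _ _) (by positivity)
  · exact add_pos_of_pos_of_nonneg (S.metric.pos _ _ hfst) (by positivity)

lemma isVonNBounded_inner (y : M) :
    Bornology.IsVonNBounded ℝ {v : TangentSpace I y | A.inner y v v < 1} := by
  have hy := A.mem_source y
  have hz := A.ne_zero _ y hy
  set θ := A.chart (A.index y)
  have hfst := (S.metric.isVonNBounded (θ y).1).image (inclFst IK I θ y)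
  have hsnd := Bornology.IsVonNBounded.image (E := R4)
    (NormedSpace.isVonNBounded_ball ℝ R4 ‖(θ y).2‖) (inclSnd I θ y)
  refine (hfst.add hsnd).subset fun v hv => ?_
  rw [mem_ofPred_eq, A.inner_self_apply hy] at hv
  refine Set.mem_add.2 ⟨_, ⟨derivFst IK I θ y v, ?_, rfl⟩, _, ⟨derivSnd I θ y v, ?_, rfl⟩,
    (A.isSmooth _).inclFst_derivFst_add_inclSnd_derivSnd hy v⟩
  · exact (le_add_of_nonneg_right (by positivity)).trans_lt hv
  · have hlt := (le_add_of_nonneg_left (S.inner_self_nonneg _ _)).trans_lt hv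
    rw [inv_mul_lt_one₀ (by positivity)] at hlt
    exact mem_ball_zero_iff.2 (lt_of_pow_lt_pow_left₀ 2 (norm_nonneg _) hlt)

lemma integrable_J {s : ℝ} (hs : s * s = 1) (x : M) :
    ∃ (n : ℕ) (φ : OpenPartialHomeomorph M (Fin n → ℂ)), x ∈ φ.source ∧
    ContMDiffOn I 𝓘(ℝ, Fin n → ℂ) ∞ φ φ.source ∧
    ContMDiffOn 𝓘(ℝ, Fin n → ℂ) I ∞ φ.symm φ.target ∧
    ∀ y ∈ φ.source, ∀ v : TangentSpace I y,
      (mfderiv I 𝓘(ℝ, Fin n → ℂ) φ y (A.J s y v) : Fin n → ℂ)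
        = Complex.I • (show Fin n → ℂ from mfderiv I 𝓘(ℝ, Fin n → ℂ) φ y v) := by
  have hθ := A.isSmooth (A.index x)
  obtain ⟨n, φ, hxφ, hφ, hφ_symm, hJ⟩ := S.cplx.integrable (A.chart (A.index x) x).1
  refine ⟨n + 2, prodCoordinates (A.chart (A.index x)) φ (R4.prodComplexPair hs n),
    mem_prodCoordinates_source.2 ⟨A.mem_source x, hxφ⟩, hθ.contMDiffOn_prodCoordinates hφ,
    hθ.contMDiffOn_prodCoordinates_symm hφ_symm, fun y hy v => ?_⟩
  obtain ⟨hyθ, hyφ⟩ := mem_prodCoordinates_source.1 hy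
  have hfst := (congrArg (mfderiv IK 𝓘(ℝ, Fin n → ℂ) φ (A.chart (A.index x) y).1 :
    EK →L[ℝ] (Fin n → ℂ)) (A.derivFst_J hyθ s v)).trans (hJ _ hyφ _)
  have hsnd := A.derivSnd_J hyθ s v
  refine (hθ.mfderiv_prodCoordinates_apply hφ hy (A.J s y v)).trans ?_
  refine (congrArg₂ (fun a b => R4.prodComplexPair hs n (a, b)) hfst hsnd).trans ?_
  refine (R4.prodComplexPair_mulI hs n _ _).trans ?_
  exact congrArg (fun w : Fin (n + 2) → ℂ => Complex.I • w)
    (hθ.mfderiv_prodCoordinates_apply hφ hy v).symm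

variable [IsManifold I ∞ M]

lemma contMDiff_J (s : ℝ) : ContMDiff I (I.prod 𝓘(ℝ, E →L[ℝ] E)) ∞
    (fun x => TotalSpace.mk' (E →L[ℝ] E)
      (E := fun x : M => TangentSpace I x →L[ℝ] TangentSpace I x) x (A.J s x)) := by
  intro y
  have hy := A.mem_source y
  rw [contMDiffAt_endomorphism_iff]
  refine ((A.isSmooth _).contMDiffAt_localJ (S := S) hy s).congr_of_eventuallyEq ?_
  filter_upwards [A.eventually_mem_source hy] with x hx
  simp only [inTangentCoordinates, A.J_eq hx]

lemma contMDiff_inner : ContMDiff I (I.prod 𝓘(ℝ, E →L[ℝ] E →L[ℝ] ℝ)) ∞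
    (fun x => TotalSpace.mk' (E →L[ℝ] E →L[ℝ] ℝ)
      (E := fun x : M => TangentSpace I x →L[ℝ] TangentSpace I x →L[ℝ] ℝ) x (A.inner x)) := by
  intro y
  have hy := A.mem_source y
  rw [contMDiffAt_bilin_iff]
  refine ((A.isSmooth _).contMDiffAt_localMetric (S := S) hy
    (A.ne_zero _ y hy)).congr_of_eventuallyEq ?_
  filter_upwards [A.eventually_mem_source hy] with x hx
  simp only [bilinInCoordinates, A.inner_eq hx]

/-- The Riemannian metric defined by the atlas. -/
def metric : SmoothMetric I M where
  inner := A.inner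
  symm y v w := by
    have hy := A.mem_source y
    rw [A.inner_apply hy, A.inner_apply hy, S.metric.symm, real_inner_comm]
  pos := A.inner_pos
  isVonNBounded := A.isVonNBounded_inner
  contMDiff := A.contMDiff_inner

/-- The complex structures defined by the atlas, one for each sign `s`. -/
def cplx {s : ℝ} (hs : s * s = 1) : ComplexStructure I M where
  J := A.J s
  J_J := A.J_J hs
  contMDiff := A.contMDiff_J s
  integrable := A.integrable_J hs

/-- The Hermitian structures defined by the atlas, one for each sign `s`. -/
def hermitian {s : ℝ} (hs : s * s = 1) : HermitianStructure I M where
  metric := A.metric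
  cplx := A.cplx hs
  compatible := A.inner_J_J hs

section

variable {s : ℝ} (hs : s * s = 1) {i : ι} {y : M} (hy : y ∈ (A.chart i).source)
include hy

lemma fundamentalForm_eq : (A.hermitian hs).fundamentalForm y
    = DiffForm.pullback I (fun y => (A.chart i y).1) S.fundamentalForm y
      + DiffForm.pullback I (fun y => (A.chart i y).2) (DiffForm.ofFun (R4.hopfForm s)) y := by
  ext v
  refine (A.inner_apply hy _ _).trans (congrArg₂ (· + ·) ?_ ?_)
  · exact congrArg (fun w : EK => (S.metric.inner (A.chart i y).1 : EK →L[ℝ] EK →L[ℝ] ℝ) w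
      (derivFst IK I (A.chart i) y (v 1))) (A.derivFst_J hy s (v 0))
  · exact congrArg (fun w : R4 => (‖(A.chart i y).2‖ ^ 2)⁻¹ *
      Inner.inner ℝ w (show R4 from derivSnd I (A.chart i) y (v 1))) (A.derivSnd_J hy s (v 0))

variable [IK.Boundaryless] [I.Boundaryless] [FiniteDimensional ℝ EK] [FiniteDimensional ℝ E]

lemma extDeriv_fundamentalForm : (A.hermitian hs).fundamentalForm.extDeriv y
    = DiffForm.pullback I (fun y => (A.chart i y).2)
      (DiffForm.ofFun (extDeriv (R4.hopfForm s))) y := by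
  have hθ := A.isSmooth i
  have hfst := hθ.contMDiffAt_fst hy
  have hS := S.smoothAt_fundamentalForm (A.chart i y).1
  have hhopf := R4.contDiffAt_hopfForm s (A.ne_zero i y hy)
  have hlocal : ∀ᶠ x in 𝓝 y, (A.hermitian hs).fundamentalForm x
      = (DiffForm.pullback I (fun y => (A.chart i y).1) S.fundamentalForm
        + DiffForm.pullback I (fun y => (A.chart i y).2)
          (DiffForm.ofFun (R4.hopfForm s))) x := by
    filter_upwards [A.eventually_mem_source hy] with x hx using A.fundamentalForm_eq hs hx
  rw [DiffForm.extDeriv_congr hlocal,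
    (hS.pullback (f := fun y => (A.chart i y).1) hfst).extDeriv_add
      (hθ.smoothAt_pullback_snd hy hhopf),
    hS.extDeriv_pullback (f := fun y => (A.chart i y).1) hfst, S.closed,
    hθ.extDeriv_pullback_snd hy hhopf]
  exact zero_add _

lemma dcFundamentalForm_eq : (A.hermitian hs).dcFundamentalForm y
    = s • DiffForm.pullback I (fun y => (A.chart i y).2) (DiffForm.ofFun R4.sphereForm) y := by
  ext v
  refine Eq.trans ?_ (R4.extDeriv_hopfForm_mulI hs (A.ne_zero i y hy)
    fun j => derivSnd I (A.chart i) y (v j))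
  simp only [HermitianStructure.dcFundamentalForm, A.extDeriv_fundamentalForm hs hy]
  exact congrArg (fun w : Fin 3 → R4 => -extDeriv (R4.hopfForm s) (A.chart i y).2 w)
    (funext fun j => A.derivSnd_J hy s (v j))

end

variable [IK.Boundaryless] [I.Boundaryless] [FiniteDimensional ℝ EK] [FiniteDimensional ℝ E]
  {s : ℝ} (hs : s * s = 1)

lemma eventually_dcFundamentalForm_eq (y : M) :
    ∀ᶠ x in 𝓝 y, (A.hermitian hs).dcFundamentalForm x
      = (s • DiffForm.pullback I (fun x => (A.chart (A.index y) x).2)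
        (DiffForm.ofFun R4.sphereForm)) x := by
  filter_upwards [A.eventually_mem_source (A.mem_source y)] with x hx
  exact A.dcFundamentalForm_eq hs hx

lemma isSmooth_dcFundamentalForm : (A.hermitian hs).dcFundamentalForm.IsSmooth := by
  refine DiffForm.isSmooth_of_forall_smoothAt fun y => ?_
  have hy := A.mem_source y
  exact (((A.isSmooth _).smoothAt_pullback_snd hy
    (R4.contDiffAt_sphereForm (A.ne_zero _ y hy))).smul s).congr
    (A.eventually_dcFundamentalForm_eq hs y)

lemma extDeriv_dcFundamentalForm : (A.hermitian hs).dcFundamentalForm.extDeriv = 0 := by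
  funext y
  have hy := A.mem_source y
  have hz := A.ne_zero _ y hy
  rw [DiffForm.extDeriv_congr (A.eventually_dcFundamentalForm_eq hs y), DiffForm.extDeriv_smul,
    Pi.smul_apply, (A.isSmooth _).extDeriv_pullback_snd hy (R4.contDiffAt_sphereForm hz)]
  ext v
  refine (congrArg (fun α : R4 [⋀^Fin 4]→L[ℝ] ℝ => s * α _) (R4.extDeriv_sphereForm hz)).trans ?_
  exact mul_zero s

/-- The generalized Kähler structure defined by the atlas, where `I₊` and `I₋` are the complex
structures of signs `1` and `-1`. -/
def generalizedKahler : GeneralizedKahlerStructure I M where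
  metric := A.metric
  Iplus := A.cplx (s := 1) (by norm_num)
  Iminus := A.cplx (s := -1) (by norm_num)
  compatible_plus := A.inner_J_J (by norm_num)
  compatible_minus := A.inner_J_J (by norm_num)
  dc_plus_eq := by
    funext y
    have hplus := A.dcFundamentalForm_eq (s := 1) (by norm_num) (A.mem_source y)
    have hminus := A.dcFundamentalForm_eq (s := -1) (by norm_num) (A.mem_source y)
    rw [neg_smul] at hminus
    exact hplus.trans (neg_eq_iff_eq_neg.2 hminus).symm
  ddc_plus := A.extDeriv_dcFundamentalForm (by norm_num)

lemma torsion_eq {i : ι} {y : M} (hy : y ∈ (A.chart i).source) :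
    A.generalizedKahler.torsion y
      = DiffForm.pullback I (fun y => (A.chart i y).2) (DiffForm.ofFun R4.sphereForm) y :=
  (A.dcFundamentalForm_eq (s := 1) (by norm_num) hy).trans (one_smul _ _)

lemma torsion_mem_closedForms :
    A.generalizedKahler.torsion ∈ DiffForm.closedForms I M 3 :=
  ⟨A.isSmooth_dcFundamentalForm (s := 1) (by norm_num),
    A.extDeriv_dcFundamentalForm (s := 1) (by norm_num)⟩

lemma isSplit_generalizedKahler : A.generalizedKahler.IsSplit := by
  intro y
  have hy := A.mem_source y
  have hθ := A.isSmooth (A.index y)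
  have hJ_inclSnd (s : ℝ) (z : R4) : derivSnd I (A.chart (A.index y)) y
      (A.J s y (inclSnd I (A.chart (A.index y)) y z)) = R4.mulI s z :=
    (A.derivSnd_J hy s _).trans (congrArg (R4.mulI s) (hθ.derivSnd_inclSnd hy z))
  refine ⟨?_, fun h : A.J 1 y = A.J (-1) y => ?_, fun h : A.J 1 y = -A.J (-1) y => ?_⟩
  · ext v
    change A.J 1 y (A.J (-1) y v) = A.J (-1) y (A.J 1 y v)
    apply hθ.ext_derivFst_derivSnd hy
    · simp only [A.derivFst_J hy]
    · simp only [A.derivSnd_J hy]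
      exact R4.mulI_comm _ _ _
  · have heq : R4.mulI 1 (WithLp.toLp 2 ![0, 0, 1, 0])
        = R4.mulI (-1) (WithLp.toLp 2 ![0, 0, 1, 0]) :=
      (hJ_inclSnd 1 _).symm.trans ((congrArg (fun L : TangentSpace I y →L[ℝ] TangentSpace I y =>
        derivSnd I (A.chart (A.index y)) y (L (inclSnd I (A.chart (A.index y)) y _))) h).trans
          (hJ_inclSnd (-1) _))
    have hcoord : (1 : ℝ) * 1 = -1 * 1 := congrArg (fun z : R4 => z 3) heq
    norm_num at hcoord
  · have heq : R4.mulI 1 (WithLp.toLp 2 ![1, 0, 0, 0])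
        = -R4.mulI (-1) (WithLp.toLp 2 ![1, 0, 0, 0]) :=
      (hJ_inclSnd 1 _).symm.trans ((congrArg (fun L : TangentSpace I y →L[ℝ] TangentSpace I y =>
        derivSnd I (A.chart (A.index y)) y (L (inclSnd I (A.chart (A.index y)) y _))) h).trans
        ((map_neg (derivSnd I (A.chart (A.index y)) y) _).trans
          (congrArg Neg.neg (hJ_inclSnd (-1) _))))
    have hcoord : (1 : ℝ) = -1 := congrArg (fun z : R4 => z 1) heq
    norm_num at hcoord

end HopfAtlas

end HopfAtlas

section Orientation

section

variable {V W : Type*} [AddCommGroup V] [Module ℝ V] [AddCommGroup W] [Module ℝ W] {m n : ℕ}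

lemma exists_basis_of_complexStructure [FiniteDimensional ℝ V] (J : V →ₗ[ℝ] V)
    (hJ : ∀ v, J (J v) = -v) :
    ∃ (n : ℕ) (b : Module.Basis (Fin n × Fin 2) ℝ V), ∀ i, b (i, 1) = J (b (i, 0)) := by
  let φ : ℂ →ₐ[ℝ] Module.End ℝ V := Complex.lift ⟨J, LinearMap.ext hJ⟩
  let : Module ℂ V := Module.compHom V φ.toRingHom
  have hI (v : V) : Complex.I • v = J v := by
    change φ Complex.I v = J v
    simp [φ]
  have : IsScalarTower ℝ ℂ V := ⟨fun r c v => by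
    change φ (r • c) v = r • φ c v
    rw [map_smul]
    rfl⟩
  have : FiniteDimensional ℂ V := FiniteDimensional.right ℝ ℂ V
  refine ⟨_, (Complex.basisOneI.smulTower (Module.finBasis ℂ V)).reindex (Equiv.prodComm _ _),
    fun i => ?_⟩
  simp [Module.Basis.smulTower_apply, hI]

/-- The basis of a product formed by bases of the factors whose vectors are arranged in pairs. -/
def prodPairBasis (b : Module.Basis (Fin m × Fin 2) ℝ V) (c : Module.Basis (Fin n × Fin 2) ℝ W) :
    Module.Basis (Fin (m + n) × Fin 2) ℝ (V × W) :=
  (b.prod c).reindex ((Equiv.sumProdDistrib _ _ _).symm.trans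
    (finSumFinEquiv.prodCongr (Equiv.refl _)))

lemma prodPairBasis_castAdd (b : Module.Basis (Fin m × Fin 2) ℝ V)
    (c : Module.Basis (Fin n × Fin 2) ℝ W) (i : Fin m) (j : Fin 2) :
    prodPairBasis b c (Fin.castAdd n i, j) = (b (i, j), 0) := by
  simp [prodPairBasis]

lemma prodPairBasis_natAdd (b : Module.Basis (Fin m × Fin 2) ℝ V)
    (c : Module.Basis (Fin n × Fin 2) ℝ W) (i : Fin n) (j : Fin 2) :
    prodPairBasis b c (Fin.natAdd m i, j) = (0, c (i, j)) := by
  simp [prodPairBasis]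

lemma isInducedOrientation_neg_of_single (b : Module.Basis (Fin n × Fin 2) ℝ V) {J : V → V}
    (i₀ : Fin n) (h₀ : J (b (i₀, 0)) = -b (i₀, 1)) (h : ∀ i ≠ i₀, J (b (i, 0)) = b (i, 1)) :
    IsInducedOrientation J (-b.orientation) := by
  refine ⟨b.unitsSMul (Function.update 1 (i₀, 1) (-1)), fun i => ?_, b.orientation_neg_single _⟩
  rw [Module.Basis.unitsSMul_apply, Module.Basis.unitsSMul_apply]
  rcases eq_or_ne i i₀ with rfl | hi
  · simp [h₀]
  · simp [h i hi, hi]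

end

namespace R4

/-- The standard basis of `ℝ⁴`, arranged in two pairs. -/
def pairBasis : Module.Basis (Fin 2 × Fin 2) ℝ R4 :=
  (EuclideanSpace.basisFun (Fin 4) ℝ).toBasis.reindex (finProdFinEquiv (m := 2) (n := 2)).symm

lemma mulI_pairBasis_zero (s : ℝ) : mulI s (pairBasis (0, 0)) = pairBasis (0, 1) := by
  apply ext_coord <;> simp [pairBasis, finProdFinEquiv]

lemma mulI_pairBasis_one (s : ℝ) : mulI s (pairBasis (1, 0)) = s • pairBasis (1, 1) := by
  apply ext_coord <;> simp [pairBasis, finProdFinEquiv]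

end R4

variable {EK : Type*} [NormedAddCommGroup EK] [NormedSpace ℝ EK] {HK : Type*} [TopologicalSpace HK]
  {IK : ModelWithCorners ℝ EK HK} {K : Type*} [TopologicalSpace K] [ChartedSpace HK K]
  {E : Type*} [NormedAddCommGroup E] [NormedSpace ℝ E] {H : Type*} [TopologicalSpace H]
  {I : ModelWithCorners ℝ E H} {M : Type*} [TopologicalSpace M] [ChartedSpace H M]

namespace IsSmoothChart

variable {F : Type*} [NormedAddCommGroup F] [NormedSpace ℝ F]
  {θ : OpenPartialHomeomorph M (K × F)} {y : M}

/-- The splitting of the tangent space induced by a chart with values in `K × F`. -/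
def tangentSplitting (hθ : IsSmoothChart IK I θ) (hy : y ∈ θ.source) :
    TangentSpace I y ≃ₗ[ℝ] EK × F where
  toFun v := (derivFst IK I θ y v, derivSnd I θ y v)
  invFun w := inclFst IK I θ y w.1 + inclSnd I θ y w.2
  map_add' v w := Prod.ext (map_add (derivFst IK I θ y) v w) (map_add (derivSnd I θ y) v w)
  map_smul' c v := Prod.ext (map_smul (derivFst IK I θ y) c v) (map_smul (derivSnd I θ y) c v)
  left_inv v := hθ.inclFst_derivFst_add_inclSnd_derivSnd hy v
  right_inv w := Prod.ext
    ((map_add (derivFst IK I θ y) _ _).trans ((congrArg₂ (· + ·) (hθ.derivFst_inclFst hy w.1)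
      (hθ.derivFst_inclSnd hy w.2)).trans (add_zero _)))
    ((map_add (derivSnd I θ y) _ _).trans ((congrArg₂ (· + ·) (hθ.derivSnd_inclFst hy w.1)
      (hθ.derivSnd_inclSnd hy w.2)).trans (zero_add _)))

end IsSmoothChart

namespace HopfAtlas

variable [IsManifold IK ∞ K] {S : KahlerStructure IK K} {ι : Type*} (A : HopfAtlas I M S ι)

lemma J_tangentSplitting_symm {i : ι} {y : M} (hy : y ∈ (A.chart i).source) (s : ℝ)
    (a : EK) (z : R4) : A.J s y (((A.isSmooth i).tangentSplitting hy).symm (a, z))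
      = ((A.isSmooth i).tangentSplitting hy).symm
        ((S.cplx.J (A.chart i y).1 : EK →L[ℝ] EK) a, R4.mulI s z) := by
  set T := (A.isSmooth i).tangentSplitting hy
  have hT := T.apply_symm_apply (a, z)
  refine T.eq_symm_apply.2 (Prod.ext ?_ ?_)
  · exact (A.derivFst_J hy s _).trans
      (congrArg (S.cplx.J (A.chart i y).1 : EK →L[ℝ] EK) (congrArg Prod.fst hT))
  · exact (A.derivSnd_J hy s _).trans (congrArg (R4.mulI s) (congrArg Prod.snd hT))

variable [FiniteDimensional ℝ EK]

lemma exists_pairBasis (y : M) :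
    ∃ (n : ℕ) (b : Module.Basis (Fin n × Fin 2) ℝ (TangentSpace I y)) (i₀ : Fin n),
      (∀ s : ℝ, A.J s y (b (i₀, 0)) = s • b (i₀, 1)) ∧
      ∀ s : ℝ, ∀ i ≠ i₀, A.J s y (b (i, 0)) = b (i, 1) := by
  have hy := A.mem_source y
  set T := (A.isSmooth _).tangentSplitting hy
  set JK : EK →ₗ[ℝ] EK := (S.cplx.J (A.chart (A.index y) y).1 : EK →L[ℝ] EK).toLinearMap
  have hfst (s : ℝ) (a : EK) : A.J s y (T.symm (a, 0)) = T.symm (JK a, 0) :=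
    (A.J_tangentSplitting_symm hy s a 0).trans
      (congrArg (fun z : R4 => T.symm (JK a, z)) (map_zero (R4.mulI s)))
  have hsnd (s : ℝ) (z : R4) : A.J s y (T.symm (0, z)) = T.symm (0, R4.mulI s z) :=
    (A.J_tangentSplitting_symm hy s 0 z).trans
      (congrArg (fun a : EK => T.symm (a, R4.mulI s z)) (map_zero JK))
  obtain ⟨n, bK, hbK⟩ := exists_basis_of_complexStructure JK (S.cplx.J_J _)
  refine ⟨n + 2, (prodPairBasis bK R4.pairBasis).map T.symm, Fin.natAdd n 1, fun s => ?_,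
    fun s i => Fin.addCases (fun i _ => ?_) (fun i hi => ?_) i⟩
  · simp only [Module.Basis.map_apply, prodPairBasis_natAdd, hsnd, R4.mulI_pairBasis_one,
      ← map_smul, Prod.smul_mk, smul_zero]
  · simp only [Module.Basis.map_apply, prodPairBasis_castAdd, hfst, hbK]
  · obtain rfl : i = 0 := by
      fin_cases i
      · rfl
      · exact absurd rfl hi
    simp only [Module.Basis.map_apply, prodPairBasis_natAdd, hsnd, R4.mulI_pairBasis_zero]

variable [IsManifold I ∞ M] [IK.Boundaryless] [I.Boundaryless] [FiniteDimensional ℝ E]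

lemma inducesOppositeOrientations_generalizedKahler :
    A.generalizedKahler.InducesOppositeOrientations := by
  intro y
  obtain ⟨n, b, i₀, h₀, h⟩ := A.exists_pairBasis y
  refine ⟨n, b.orientation, ⟨b, fun i => ?_, rfl⟩, isInducedOrientation_neg_of_single b i₀ ?_ ?_⟩
  · rcases eq_or_ne i i₀ with rfl | hi
    · exact ((h₀ 1).trans (one_smul _ _)).symm
    · exact (h 1 i hi).symm
  · exact (h₀ (-1)).trans (neg_one_smul _ _)
  · exact h (-1)

end HopfAtlas

end Orientation

section MappingTorusSmooth

variable {E : Type*} [NormedAddCommGroup E] [NormedSpace ℝ E] {H : Type*} [TopologicalSpace H]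
  {I : ModelWithCorners ℝ E H} {M : Type*} [TopologicalSpace M] [ChartedSpace H M]

namespace MappingTorus

variable (f : M ≃ₘ⟮I, I⟯ M) [T2Space M] [LocallyCompactSpace M]

/-- The local inverse of the quotient map `M × ℝ → M_f` at a point. -/
abbrev localInverse (x : M × ℝ) : OpenPartialHomeomorph (MappingTorus f) (M × ℝ) :=
  (isLocalHomeomorph_mk f).localInverseAt x

lemma localInverse_symm (x : M × ℝ) : ⇑(localInverse f x).symm = mk f :=
  (isLocalHomeomorph_mk f).localInverseAt_symm x

lemma mk_localInverse {x : M × ℝ} {y : MappingTorus f} (hy : y ∈ (localInverse f x).source) :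
    mk f (localInverse f x y) = y :=
  (isLocalHomeomorph_mk f).apply_localInverseAt_of_mem hy

lemma localInverse_mk_of_mem_target {x z : M × ℝ} (hz : z ∈ (localInverse f x).target) :
    localInverse f x (mk f z) = z := by
  rw [← localInverse_symm f x]
  exact (localInverse f x).right_inv hz

lemma contMDiffAt_localInverse_comp_mk {x y : M × ℝ} (hy : mk f y ∈ (localInverse f x).source) :
    ContMDiffAt (I.prod 𝓘(ℝ, ℝ)) (I.prod 𝓘(ℝ, ℝ)) ∞ (fun z => localInverse f x (mk f z)) y :=
  (contMDiffOn_localInverse_comp_mk f x).contMDiffAt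
    (((localInverse f x).open_source.preimage (isLocalHomeomorph_mk f).continuous).mem_nhds hy)

lemma extChartAt_eq (q y : MappingTorus f) : extChartAt (I.prod 𝓘(ℝ, ℝ)) q y
    = extChartAt (I.prod 𝓘(ℝ, ℝ)) (surjInv (surjective_mk f) q)
      (localInverse f (surjInv (surjective_mk f) q) y) := rfl

lemma mem_localInverse_surjInv_source (q : MappingTorus f) :
    q ∈ (localInverse f (surjInv (surjective_mk f) q)).source := by
  have hmem := (isLocalHomeomorph_mk f).apply_self_mem_localInverseAt_source
    (x := surjInv (surjective_mk f) q)
  rwa [surjInv_eq (surjective_mk f)] at hmem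

lemma localInverse_surjInv_self (q : MappingTorus f) :
    localInverse f (surjInv (surjective_mk f) q) q = surjInv (surjective_mk f) q := by
  have hself := (isLocalHomeomorph_mk f).localInverseAt_apply_self
    (x := surjInv (surjective_mk f) q)
  rwa [surjInv_eq (surjective_mk f)] at hself

lemma exists_localInverse_eventuallyEq {x x' : M × ℝ} {y : MappingTorus f}
    (hy : y ∈ (localInverse f x).source) (hy' : y ∈ (localInverse f x').source) :
    ∃ n : ℤ, ∀ᶠ z in 𝓝 y, localInverse f x' z
      = (((f.toEquiv ^ n : Equiv.Perm M) (localInverse f x z).1, (localInverse f x z).2 + n)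
        : M × ℝ) := by
  let := suspensionAction f
  have hfiber : mk f (localInverse f x' y) = mk f (localInverse f x y) := by
    rw [mk_localInverse f hy, mk_localInverse f hy']
  obtain ⟨n, hn⟩ := (isAddQuotientCoveringMap_mk f).apply_eq_iff_mem_orbit.mp hfiber
  have hcontinuous : ContinuousAt (fun z => n +ᵥ localInverse f x z) y :=
    (contMDiff_vadd f n).continuous.continuousAt.comp ((localInverse f x).continuousAt hy)
  have htarget : ∀ᶠ z in 𝓝 y, n +ᵥ localInverse f x z ∈ (localInverse f x').target := by
    refine hcontinuous.preimage_mem_nhds ((localInverse f x').open_target.mem_nhds ?_)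
    rw [show n +ᵥ localInverse f x y = localInverse f x' y from hn]
    exact (localInverse f x').map_source hy'
  refine ⟨n, ?_⟩
  filter_upwards [htarget, (localInverse f x).open_source.mem_nhds hy] with z hz hz'
  have hmk : mk f (n +ᵥ localInverse f x z) = z :=
    ((isAddQuotientCoveringMap_mk f).map_vadd n).trans (mk_localInverse f hz')
  have hinverse := localInverse_mk_of_mem_target f hz
  rwa [hmk] at hinverse

lemma contMDiff_mk : ContMDiff (I.prod 𝓘(ℝ, ℝ)) (I.prod 𝓘(ℝ, ℝ)) ∞ (mk f) := by
  intro x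
  rw [contMDiffAt_iff_target]
  refine ⟨(isLocalHomeomorph_mk f).continuous.continuousAt, ?_⟩
  have hlift := contMDiffAt_localInverse_comp_mk f (mem_localInverse_surjInv_source f (mk f x))
  have hchart : ContMDiffAt (I.prod 𝓘(ℝ, ℝ)) 𝓘(ℝ, E × ℝ) ∞
      (extChartAt (I.prod 𝓘(ℝ, ℝ)) (surjInv (surjective_mk f) (mk f x)))
      (localInverse f (surjInv (surjective_mk f) (mk f x)) (mk f x)) := by
    rw [localInverse_surjInv_self]
    exact contMDiffAt_extChartAt
  exact ContMDiffAt.comp (f := fun z => localInverse f _ (mk f z)) x hchart hlift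

section

variable [IsManifold I ∞ M] [I.Boundaryless]

lemma contMDiffAt_localInverse_surjInv (q : MappingTorus f) :
    ContMDiffAt (I.prod 𝓘(ℝ, ℝ)) (I.prod 𝓘(ℝ, ℝ)) ∞
      (localInverse f (surjInv (surjective_mk f) q)) q := by
  set x := surjInv (surjective_mk f) q
  have hchart : ContMDiffAt (I.prod 𝓘(ℝ, ℝ)) 𝓘(ℝ, E × ℝ) ∞ (extChartAt (I.prod 𝓘(ℝ, ℝ)) q) q :=
    contMDiffAt_extChartAt
  have hchart_symm : ContMDiffAt 𝓘(ℝ, E × ℝ) (I.prod 𝓘(ℝ, ℝ)) ∞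
      (extChartAt (I.prod 𝓘(ℝ, ℝ)) x).symm (extChartAt (I.prod 𝓘(ℝ, ℝ)) q q) := by
    rw [extChartAt_eq, localInverse_surjInv_self]
    exact (contMDiffOn_extChartAt_symm x).contMDiffAt (extChartAt_target_mem_nhds x)
  have hsource : ∀ᶠ y in 𝓝 q, localInverse f x y ∈ (extChartAt (I.prod 𝓘(ℝ, ℝ)) x).source := by
    refine ((localInverse f x).continuousAt
      (mem_localInverse_surjInv_source f q)).preimage_mem_nhds ?_
    rw [localInverse_surjInv_self]
    exact extChartAt_source_mem_nhds x
  refine (hchart_symm.comp q hchart).congr_of_eventuallyEq ?_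
  filter_upwards [hsource] with y hy
  rw [comp_apply, extChartAt_eq, (extChartAt (I.prod 𝓘(ℝ, ℝ)) x).left_inv hy]

lemma contMDiffOn_localInverse (x : M × ℝ) :
    ContMDiffOn (I.prod 𝓘(ℝ, ℝ)) (I.prod 𝓘(ℝ, ℝ)) ∞ (localInverse f x)
      (localInverse f x).source := by
  intro q hq
  refine ContMDiffAt.contMDiffWithinAt ?_
  set r := surjInv (surjective_mk f) q
  have htransition : ContMDiffAt (I.prod 𝓘(ℝ, ℝ)) (I.prod 𝓘(ℝ, ℝ)) ∞
      (fun z => localInverse f x (mk f z)) (localInverse f r q) := by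
    apply contMDiffAt_localInverse_comp_mk
    rwa [mk_localInverse f (mem_localInverse_surjInv_source f q)]
  refine (htransition.comp q (contMDiffAt_localInverse_surjInv f q)).congr_of_eventuallyEq ?_
  filter_upwards [(localInverse f r).open_source.mem_nhds (mem_localInverse_surjInv_source f q)]
    with y hy
  simp only [comp_apply, mk_localInverse f hy]

end

end MappingTorus

end MappingTorusSmooth

section PolarCoordinates

/-- The radial projection of `ℝ⁴ \ {0}` on the sphere, with a junk value at the origin. -/
def radialProjection (z : R4) : Sphere3 :=
  if h : z = 0 then ⟨EuclideanSpace.single 0 1, by simp⟩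
  else ⟨‖z‖⁻¹ • z, by simp [norm_smul, h]⟩

lemma coe_radialProjection {z : R4} (hz : z ≠ 0) : (radialProjection z : R4) = ‖z‖⁻¹ • z := by
  rw [radialProjection, dif_neg hz]

lemma contMDiffAt_radialProjection {z : R4} (hz : z ≠ 0) :
    ContMDiffAt 𝓘(ℝ, R4) (𝓡 3) ∞ radialProjection z := by
  let U : TopologicalSpace.Opens R4 := ⟨{0}ᶜ, isOpen_compl_singleton⟩
  have hU : ∀ x : U, (x : R4) ≠ 0 := fun x => x.2
  have hnormalize : ContMDiff 𝓘(ℝ, R4) 𝓘(ℝ, R4) ∞ (fun x : U => ‖(x : R4)‖⁻¹ • (x : R4)) := by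
    intro x
    have : ContDiffAt ℝ ∞ (fun x : R4 => ‖x‖⁻¹ • x) x :=
      ((contDiffAt_norm ℝ (hU x)).inv (norm_ne_zero_iff.2 (hU x))).smul contDiffAt_id
    exact contMDiffAt_subtype_iff.2 this.contMDiffAt
  have : Fact (Module.finrank ℝ R4 = 3 + 1) := ⟨finrank_euclideanSpace_fin⟩
  have hrestrict := hnormalize.codRestrict_sphere (n := 3) fun x => by simp [norm_smul, hU x]
  rw [← contMDiffAt_subtype_iff (U := U) (x := ⟨z, hz⟩)]
  exact (hrestrict ⟨z, hz⟩).congr_of_eventuallyEq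
    (Filter.Eventually.of_forall fun x => Subtype.ext (coe_radialProjection (hU x)))

lemma contMDiff_coe_sphere3 : ContMDiff (𝓡 3) 𝓘(ℝ, R4) ∞ (Subtype.val : Sphere3 → R4) := by
  have : Fact (Module.finrank ℝ R4 = 3 + 1) := ⟨finrank_euclideanSpace_fin⟩
  exact contMDiff_coe_sphere

lemma norm_exp_smul_sphere (t : ℝ) (q : Sphere3) : ‖Real.exp t • (q : R4)‖ = Real.exp t := by
  simp [norm_smul]

lemma exp_smul_sphere_ne_zero (t : ℝ) (q : Sphere3) : Real.exp t • (q : R4) ≠ 0 := by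
  rw [← norm_ne_zero_iff, norm_exp_smul_sphere]
  positivity

lemma radialProjection_exp_smul (t : ℝ) (q : Sphere3) :
    radialProjection (Real.exp t • (q : R4)) = q := by
  ext1
  rw [coe_radialProjection (exp_smul_sphere_ne_zero t q), norm_exp_smul_sphere, smul_smul,
    inv_mul_cancel₀ (Real.exp_ne_zero t), one_smul]

lemma exp_log_norm_smul_radialProjection {z : R4} (hz : z ≠ 0) :
    Real.exp (Real.log ‖z‖) • (radialProjection z : R4) = z := by
  rw [coe_radialProjection hz, Real.exp_log (norm_pos_iff.2 hz), smul_smul,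
    mul_inv_cancel₀ (norm_ne_zero_iff.2 hz), one_smul]

variable {EK : Type*} [NormedAddCommGroup EK] [NormedSpace ℝ EK] {HK : Type*} [TopologicalSpace HK]
  {IK : ModelWithCorners ℝ EK HK} {K : Type*} [TopologicalSpace K]

variable (K) in
/-- The identification of `K × S³ × ℝ` with `K × (ℝ⁴ \ {0})` by `(p, q, t) ↦ (p, eᵗ q)`. -/
def polarCoordinates : OpenPartialHomeomorph ((K × Sphere3) × ℝ) (K × R4) where
  toFun x := (x.1.1, Real.exp x.2 • (x.1.2 : R4))
  invFun y := ((y.1, radialProjection y.2), Real.log ‖y.2‖)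
  source := univ
  target := {y | y.2 ≠ 0}
  map_source' x _ := exp_smul_sphere_ne_zero _ _
  map_target' _ _ := mem_univ _
  left_inv' x _ := by simp only [radialProjection_exp_smul, norm_exp_smul_sphere, Real.log_exp]
  right_inv' _ hz := Prod.ext rfl (exp_log_norm_smul_radialProjection hz)
  open_source := isOpen_univ
  open_target := isOpen_compl_singleton.preimage continuous_snd
  continuousOn_toFun := by fun_prop
  continuousOn_invFun := by
    rintro ⟨p, z⟩ (hz : z ≠ 0)
    have hsphere : ContinuousAt (fun y : K × R4 => radialProjection y.2) (p, z) :=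
      ContinuousAt.comp (g := radialProjection) (f := Prod.snd)
        (contMDiffAt_radialProjection hz).continuousAt continuousAt_snd
    have hlog : ContinuousAt (fun y : K × R4 => Real.log ‖y.2‖) (p, z) :=
      continuousAt_snd.norm.log (norm_ne_zero_iff.2 hz)
    exact ((continuousAt_fst.prodMk hsphere).prodMk hlog).continuousWithinAt

lemma polarCoordinates_apply (x : (K × Sphere3) × ℝ) :
    polarCoordinates K x = (x.1.1, Real.exp x.2 • (x.1.2 : R4)) := rfl

variable [ChartedSpace HK K]

lemma contMDiff_polarCoordinates :
    ContMDiff ((IK.prod (𝓡 3)).prod 𝓘(ℝ, ℝ)) (IK.prod 𝓘(ℝ, R4)) ∞ (polarCoordinates K) := by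
  have hexp : ContMDiff ((IK.prod (𝓡 3)).prod 𝓘(ℝ, ℝ)) 𝓘(ℝ, ℝ) ∞
      (fun x : (K × Sphere3) × ℝ => Real.exp x.2) :=
    Real.contDiff_exp.contMDiff.comp contMDiff_snd
  exact (contMDiff_fst.comp contMDiff_fst).prodMk
    (hexp.smul (contMDiff_coe_sphere3.comp (contMDiff_snd.comp contMDiff_fst)))

lemma contMDiffOn_polarCoordinates_symm :
    ContMDiffOn (IK.prod 𝓘(ℝ, R4)) ((IK.prod (𝓡 3)).prod 𝓘(ℝ, ℝ)) ∞ (polarCoordinates K).symm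
      (polarCoordinates K).target := by
  rintro ⟨p, z⟩ (hz : z ≠ 0)
  have hsphere : ContMDiffAt (IK.prod 𝓘(ℝ, R4)) (𝓡 3) ∞
      (fun y : K × R4 => radialProjection y.2) (p, z) :=
    (contMDiffAt_radialProjection hz).comp (p, z) contMDiffAt_snd
  have hlog : ContMDiffAt (IK.prod 𝓘(ℝ, R4)) 𝓘(ℝ, ℝ) ∞
      (fun y : K × R4 => Real.log ‖y.2‖) (p, z) :=
    ((contDiffAt_norm ℝ hz).log (norm_ne_zero_iff.2 hz)).contMDiffAt.comp (p, z) contMDiffAt_snd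
  exact ((contMDiffAt_fst.prodMk hsphere).prodMk hlog).contMDiffWithinAt

end PolarCoordinates

section MappingTorusAtlas

variable {EK : Type*} [NormedAddCommGroup EK] [NormedSpace ℝ EK] {HK : Type*} [TopologicalSpace HK]
  {IK : ModelWithCorners ℝ EK HK} {K : Type*} [TopologicalSpace K] [ChartedSpace HK K]

namespace KahlerStructure.IsHolomorphicIsometry

variable [IsManifold IK ∞ K] {S : KahlerStructure IK K} {φ ψ : K ≃ₘ⟮IK, IK⟯ K}

lemma refl (S : KahlerStructure IK K) :
    S.IsHolomorphicIsometry (Diffeomorph.refl IK K ∞) where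
  holomorphic x v := by
    simp only [Diffeomorph.coe_refl, mfderiv_id]
    rfl
  isometry x v w := by
    simp only [Diffeomorph.coe_refl, mfderiv_id]
    rfl

lemma trans (hφ : S.IsHolomorphicIsometry φ) (hψ : S.IsHolomorphicIsometry ψ) :
    S.IsHolomorphicIsometry (φ.trans ψ) := by
  have hderiv (x : K) : mfderiv IK IK (φ.trans ψ) x
      = (mfderiv IK IK ψ (φ x)).comp (mfderiv IK IK φ x) :=
    mfderiv_comp x (ψ.mdifferentiable (by simp) _) (φ.mdifferentiable (by simp) _)
  refine ⟨fun x v => ?_, fun x v w => ?_⟩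
  · rw [hderiv]
    exact (congrArg (mfderiv IK IK ψ (φ x)) (hφ.holomorphic x v)).trans (hψ.holomorphic _ _)
  · rw [hderiv]
    exact (hψ.isometry _ _ _).trans (hφ.isometry x v w)

lemma symm (hψ : S.IsHolomorphicIsometry ψ) : S.IsHolomorphicIsometry ψ.symm := by
  have hright (x : K) (v : EK) :
      (mfderiv IK IK ψ (ψ.symm x) : EK →L[ℝ] EK) (mfderiv IK IK ψ.symm x v) = v :=
    (mfderiv_apply_mfderiv_of_eventuallyEq (ψ.mdifferentiable (by simp) _)
      (ψ.symm.mdifferentiable (by simp) x) rfl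
      (Filter.Eventually.of_forall ψ.apply_symm_apply) v).trans
        (congrArg (fun L : EK →L[ℝ] EK => L v) (mfderiv_id (I := IK) (x := x)))
  have hleft (x : K) (v : EK) :
      (mfderiv IK IK ψ.symm x : EK →L[ℝ] EK) (mfderiv IK IK ψ (ψ.symm x) v) = v :=
    (mfderiv_apply_mfderiv_of_eventuallyEq (ψ.symm.mdifferentiable (by simp) x)
      (ψ.mdifferentiable (by simp) (ψ.symm x)) (ψ.apply_symm_apply x)
      (Filter.Eventually.of_forall ψ.symm_apply_apply) v).trans
        (congrArg (fun L : EK →L[ℝ] EK => L v) (mfderiv_id (I := IK) (x := ψ.symm x)))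
  refine ⟨fun x v => ?_, fun x v w => ?_⟩
  · have hJ : mfderiv IK IK ψ (ψ.symm x) (S.cplx.J (ψ.symm x) (mfderiv IK IK ψ.symm x v))
        = (S.cplx.J x : EK →L[ℝ] EK) v :=
      (hψ.holomorphic _ _).trans ((S.J_congr (ψ.apply_symm_apply x) _).trans
        (congrArg (S.cplx.J x : EK →L[ℝ] EK) (hright x v)))
    exact (congrArg (mfderiv IK IK ψ.symm x : EK →L[ℝ] EK) hJ).symm.trans (hleft x _)
  · exact (hψ.isometry _ _ _).symm.trans ((S.inner_congr (ψ.apply_symm_apply x) _ _).trans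
      (congrArg₂ (fun a b => (S.metric.inner x : EK →L[ℝ] EK →L[ℝ] ℝ) a b)
        (hright x v) (hright x w)))

lemma exists_zpow (hψ : S.IsHolomorphicIsometry ψ) (n : ℤ) :
    ∃ g : K ≃ₘ⟮IK, IK⟯ K, S.IsHolomorphicIsometry g ∧ g.toEquiv = ψ.toEquiv ^ n := by
  induction n with
  | zero => exact ⟨_, refl S, rfl⟩
  | succ n ih =>
    obtain ⟨g, hg, hgn⟩ := ih
    exact ⟨_, hψ.trans hg, by rw [zpow_add_one, ← hgn]; rfl⟩
  | pred n ih =>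
    obtain ⟨g, hg, hgn⟩ := ih
    exact ⟨_, hψ.symm.trans hg, by rw [zpow_sub_one, ← hgn]; rfl⟩

end KahlerStructure.IsHolomorphicIsometry

lemma zpow_prodCongr_refl_apply (ψ : K ≃ₘ⟮IK, IK⟯ K) (n : ℤ) (x : K × Sphere3) :
    ((ψ.prodCongr (Diffeomorph.refl (𝓡 3) Sphere3 ∞)).toEquiv ^ n : Equiv.Perm (K × Sphere3)) x
      = ((ψ.toEquiv ^ n : Equiv.Perm K) x.1, x.2) := by
  induction n generalizing x with
  | zero => rfl
  | succ n ih =>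
    rw [zpow_add_one, zpow_add_one, Equiv.Perm.mul_apply, ih]
    rfl
  | pred n ih =>
    rw [zpow_sub_one, zpow_sub_one, Equiv.Perm.mul_apply, ih]
    rfl

namespace MappingTorus

variable [IsManifold IK ∞ K] [T2Space K] [LocallyCompactSpace K] [IK.Boundaryless]
  (S : KahlerStructure IK K) {ψ : K ≃ₘ⟮IK, IK⟯ K} (hψ : S.IsHolomorphicIsometry ψ)

/-- The coordinates of the mapping torus of `(ψ, id)` with values in `K × (ℝ⁴ \ {0})`; the deck
transformation `n` becomes the product of `ψⁿ` and of the dilation by `eⁿ`. -/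
def hopfAtlas :
    HopfAtlas ((IK.prod (𝓡 3)).prod 𝓘(ℝ, ℝ))
      (MappingTorus (ψ.prodCongr (Diffeomorph.refl (𝓡 3) Sphere3 ∞))) S ((K × Sphere3) × ℝ) where
  chart x := (localInverse _ x).trans (polarCoordinates K)
  isSmooth x :=
    { contMDiffOn := contMDiff_polarCoordinates.comp_contMDiffOn
        ((contMDiffOn_localInverse _ x).mono inter_subset_left)
      contMDiffOn_symm := by
        refine (((contMDiff_mk (ψ.prodCongr (Diffeomorph.refl (𝓡 3) Sphere3 ∞))).comp_contMDiffOn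
          (contMDiffOn_polarCoordinates_symm (IK := IK) (K := K))).mono
            inter_subset_left).congr fun y _ => ?_
        rw [OpenPartialHomeomorph.trans_symm_eq_symm_trans_symm, OpenPartialHomeomorph.coe_trans,
          localInverse_symm] }
  ne_zero _ _ _ := exp_smul_sphere_ne_zero _ _
  index := surjInv (surjective_mk _)
  mem_source y := ⟨mem_localInverse_surjInv_source _ y, mem_univ _⟩
  compat x x' y hy hy' := by
    obtain ⟨n, hn⟩ := exists_localInverse_eventuallyEq _ hy.1 hy'.1
    obtain ⟨g, hg, hgn⟩ := hψ.exists_zpow n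
    refine ⟨g, Real.exp n, Real.exp_ne_zero _, hg, ?_⟩
    filter_upwards [hn] with z hz
    simp only [OpenPartialHomeomorph.coe_trans, comp_apply, polarCoordinates_apply]
    rw [hz, zpow_prodCongr_refl_apply, smul_smul, ← Real.exp_add, add_comm (n : ℝ), ← hgn]
    rfl

lemma hopfAtlas_chart_mk_eventuallyEq (x : (K × Sphere3) × ℝ) :
    ∀ᶠ y in 𝓝 x, (hopfAtlas S hψ).chart x (mk _ y)
      = (y.1.1, Real.exp y.2 • (y.1.2 : R4)) := by
  filter_upwards [(localInverse (ψ.prodCongr (Diffeomorph.refl (𝓡 3) Sphere3 ∞))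
    x).open_target.mem_nhds ((isLocalHomeomorph_mk _).self_mem_localInverseAt_target)] with y hy
  exact congrArg (polarCoordinates K) (localInverse_mk_of_mem_target _ hy)

end MappingTorus

end MappingTorusAtlas

section BoxStokes

open MeasureTheory

lemma extDeriv_apply_eq_sum_comp_fderiv {E : Type*} [NormedAddCommGroup E] [NormedSpace ℝ E]
    {n : ℕ} {η : E → E [⋀^Fin n]→L[ℝ] ℝ} {x : E} (hη : DifferentiableAt ℝ η x)
    (v : Fin (n + 1) → E) :
    extDeriv η x v = ∑ i : Fin (n + 1), (((-1 : ℝ) ^ (i : ℕ) • ContinuousAlternatingMap.apply ℝ E ℝ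
      (i.removeNth v)).comp (fderiv ℝ η x)) (v i) := by
  rw [extDeriv_apply hη]
  refine Finset.sum_congr rfl fun i _ => ?_
  have heval := ((ContinuousAlternatingMap.apply ℝ E ℝ (i.removeNth v)).hasFDerivAt
    (x := η x)).comp x hη.hasFDerivAt
  rw [zsmul_eq_mul, Int.cast_pow, Int.cast_neg, Int.cast_one]
  exact congrArg (fun L : E →L[ℝ] ℝ => (-1 : ℝ) ^ (i : ℕ) * L (v i)) heval.fderiv

lemma integral_extDeriv_eq_zero {n : ℕ} {a b : Fin (n + 1) → ℝ} (hle : a ≤ b)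
    {η : (Fin (n + 1) → ℝ) → (Fin (n + 1) → ℝ) [⋀^Fin n]→L[ℝ] ℝ} (hη : ContDiff ℝ 1 η)
    (hface : ∀ (i : Fin (n + 1)) (y : Fin n → ℝ),
      η (i.insertNth (b i) y) (fun j => Pi.single (i.succAbove j) 1)
        = η (i.insertNth (a i) y) (fun j => Pi.single (i.succAbove j) 1)) :
    ∫ x in Icc a b, extDeriv η x (fun i => Pi.single i 1) = 0 := by
  let eval (i : Fin (n + 1)) : ((Fin (n + 1) → ℝ) [⋀^Fin n]→L[ℝ] ℝ) →L[ℝ] ℝ :=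
    (-1 : ℝ) ^ (i : ℕ) • ContinuousAlternatingMap.apply ℝ _ _ (fun j => Pi.single (i.succAbove j) 1)
  have heval (i) (ζ) : eval i ζ = (-1 : ℝ) ^ (i : ℕ) * ζ (fun j => Pi.single (i.succAbove j) 1) :=
    rfl
  have hdiff : Differentiable ℝ η := hη.differentiable (by simp)
  have hdiv (x) : extDeriv η x (fun i => Pi.single i 1)
      = ∑ i, ((eval i).comp (fderiv ℝ η x)) (Pi.single i 1) :=
    extDeriv_apply_eq_sum_comp_fderiv (hdiff x) _
  have hcont : Continuous (fun x => ∑ i, ((eval i).comp (fderiv ℝ η x)) (Pi.single i 1)) :=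
    continuous_finsetSum _ fun i _ =>
      (eval i).continuous.comp ((hη.continuous_fderiv (by simp)).clm_apply continuous_const)
  simp_rw [hdiv]
  rw [integral_divergence_of_hasFDerivAt_off_countable' a b hle (fun i x => eval i (η x))
    (fun i x => (eval i).comp (fderiv ℝ η x)) ∅ countable_empty
    (fun i => ((eval i).continuous.comp hη.continuous).continuousOn)
    (fun x _ i => (eval i).hasFDerivAt.comp x (hdiff x).hasFDerivAt)
    (hcont.continuousOn.integrableOn_compact isCompact_Icc)]
  refine Finset.sum_eq_zero fun i _ => ?_
  simp_rw [heval, hface, sub_self]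

end BoxStokes

section PullbackToVectorSpace

variable {E : Type*} [NormedAddCommGroup E] [NormedSpace ℝ E] {H : Type*} [TopologicalSpace H]
  {I : ModelWithCorners ℝ E H} {M : Type*} [TopologicalSpace M] [ChartedSpace H M]
  {F : Type*} [NormedAddCommGroup F] [NormedSpace ℝ F] {n : ℕ} {Φ : F → M}

namespace DiffForm

lemma pullback_add_of_invariant (hΦ : MDifferentiable 𝓘(ℝ, F) I Φ) {c : F}
    (hc : ∀ x, Φ (x + c) = Φ x) (α : DiffForm I M n) (x : F) (v : Fin n → F) :
    (pullback 𝓘(ℝ, F) Φ α (x + c) : F [⋀^Fin n]→L[ℝ] ℝ) v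
      = (pullback 𝓘(ℝ, F) Φ α x : F [⋀^Fin n]→L[ℝ] ℝ) v := by
  have htranslation : HasFDerivAt (fun x : F => x + c) (ContinuousLinearMap.id ℝ F) x :=
    (hasFDerivAt_id x).add_const c
  have hcomp : pullback 𝓘(ℝ, F) (fun x => Φ (x + c)) α x
      = pullback 𝓘(ℝ, F) (fun x : F => x + c) (pullback 𝓘(ℝ, F) Φ α) x :=
    pullback_comp (hΦ _) htranslation.differentiableAt.mdifferentiableAt
  have hderiv : mfderiv 𝓘(ℝ, F) 𝓘(ℝ, F) (fun x : F => x + c) x = ContinuousLinearMap.id ℝ F := by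
    rw [mfderiv_eq_fderiv]
    exact htranslation.fderiv
  rw [funext hc] at hcomp
  refine Eq.trans ?_ (congrArg (fun L : F [⋀^Fin n]→L[ℝ] ℝ => L v) hcomp).symm
  exact congrArg (fun L : F →L[ℝ] F => (pullback 𝓘(ℝ, F) Φ α (x + c) : F [⋀^Fin n]→L[ℝ] ℝ)
    (fun i => L (v i))) hderiv.symm

lemma pullback_apply_eq_zero_of_const (hΦ : MDifferentiable 𝓘(ℝ, F) I Φ) {x : F}
    {v : Fin n → F} {j : Fin n} (hj : ∀ t : ℝ, Φ (x + t • v j) = Φ x) (α : DiffForm I M n) :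
    (pullback 𝓘(ℝ, F) Φ α x : F [⋀^Fin n]→L[ℝ] ℝ) v = 0 := by
  have hline : HasFDerivAt (fun t : ℝ => x + t • v j)
      ((ContinuousLinearMap.id ℝ ℝ).smulRight (v j)) (0 : ℝ) :=
    ((hasFDerivAt_id (0 : ℝ)).smul_const (v j)).const_add x
  have hconst := mfderiv_apply_mfderiv_of_eventuallyEq (k := fun _ : ℝ => Φ x) (hΦ x)
    hline.differentiableAt.mdifferentiableAt (by simp) (Filter.Eventually.of_forall hj) (1 : ℝ)
  have hvelocity : mfderiv 𝓘(ℝ, ℝ) 𝓘(ℝ, F) (fun t : ℝ => x + t • v j) (0 : ℝ) (1 : ℝ) = v j := by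
    rw [mfderiv_eq_fderiv, hline.fderiv]
    exact one_smul ℝ (v j)
  have hzero : (mfderiv 𝓘(ℝ, F) I Φ x : F →L[ℝ] E) (v j) = 0 :=
    (congrArg (mfderiv 𝓘(ℝ, F) I Φ x : F →L[ℝ] E) hvelocity).symm.trans (hconst.trans
      (congrArg (fun L : ℝ →L[ℝ] E => L 1) (mfderiv_const (I := 𝓘(ℝ, ℝ)) (I' := I))))
  exact ContinuousAlternatingMap.map_coord_zero (α (Φ x) : E [⋀^Fin n]→L[ℝ] ℝ) j hzero

variable [IsManifold I ∞ M] [I.Boundaryless]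

lemma contDiff_pullback [FiniteDimensional ℝ F] (hΦ : ContMDiff 𝓘(ℝ, F) I ∞ Φ)
    {α : DiffForm I M n} (hα : α.IsSmooth) :
    ContDiff ℝ ∞ (E := F) (F := F [⋀^Fin n]→L[ℝ] ℝ) (fun x => pullback 𝓘(ℝ, F) Φ α x) :=
  contDiff_iff_contDiffAt.2 fun x => smoothAt_ofFun.1 ((hα.smoothAt (Φ x)).pullback (hΦ x))

lemma extDeriv_pullback_eq (hΦ : ContMDiff 𝓘(ℝ, F) I ∞ Φ) {α : DiffForm I M n}
    (hα : α.IsSmooth) (x : F) :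
    _root_.extDeriv (fun x => (pullback 𝓘(ℝ, F) Φ α x : F [⋀^Fin n]→L[ℝ] ℝ)) x
      = pullback 𝓘(ℝ, F) Φ α.extDeriv x :=
  (congrFun (extDeriv_ofFun fun x => (pullback 𝓘(ℝ, F) Φ α x : F [⋀^Fin n]→L[ℝ] ℝ)) x).symm.trans
    ((hα.smoothAt (Φ x)).extDeriv_pullback (hΦ x))

end DiffForm

end PullbackToVectorSpace

section SphereIntegral

open Real MeasureTheory DiffForm

/-- The parametrization `(cos a e^{ib}, sin a e^{ic})` of `S³`, with values in `ℝ⁴ = ℂ²`. -/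
def sphereParam (u : Fin 3 → ℝ) : R4 :=
  WithLp.toLp 2 ![cos (u 0) * cos (u 1), cos (u 0) * sin (u 1), sin (u 0) * cos (u 2),
    sin (u 0) * sin (u 2)]

lemma norm_sq_sphereParam (u : Fin 3 → ℝ) : ‖sphereParam u‖ ^ 2 = 1 := by
  rw [R4.norm_sq_eq]
  change (cos (u 0) * cos (u 1)) ^ 2 + (cos (u 0) * sin (u 1)) ^ 2
    + (sin (u 0) * cos (u 2)) ^ 2 + (sin (u 0) * sin (u 2)) ^ 2 = 1
  linear_combination sin_sq_add_cos_sq (u 0) + cos (u 0) ^ 2 * sin_sq_add_cos_sq (u 1)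
    + sin (u 0) ^ 2 * sin_sq_add_cos_sq (u 2)

lemma norm_sphereParam (u : Fin 3 → ℝ) : ‖sphereParam u‖ = 1 :=
  (pow_eq_one_iff_of_nonneg (norm_nonneg _) two_ne_zero).1 (norm_sq_sphereParam u)

lemma contDiff_sphereParam : ContDiff ℝ ∞ sphereParam := by
  rw [contDiff_euclidean]
  intro i
  have hcoord (j : Fin 3) : ContDiff ℝ ∞ (fun u : Fin 3 → ℝ => u j) := contDiff_apply ℝ ℝ j
  fin_cases i
  · exact (hcoord 0).cos.mul (hcoord 1).cos
  · exact (hcoord 0).cos.mul (hcoord 1).sin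
  · exact (hcoord 0).sin.mul (hcoord 2).cos
  · exact (hcoord 0).sin.mul (hcoord 2).sin

lemma fderiv_sphereParam (u v : Fin 3 → ℝ) : fderiv ℝ sphereParam u v = WithLp.toLp 2
    ![-sin (u 0) * v 0 * cos (u 1) - cos (u 0) * (sin (u 1) * v 1),
      -sin (u 0) * v 0 * sin (u 1) + cos (u 0) * (cos (u 1) * v 1),
      cos (u 0) * v 0 * cos (u 2) - sin (u 0) * (sin (u 2) * v 2),
      cos (u 0) * v 0 * sin (u 2) + sin (u 0) * (cos (u 2) * v 2)] := by
  have hcoord (j : Fin 3) : HasFDerivAt (fun u : Fin 3 → ℝ => u j)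
    (ContinuousLinearMap.proj (R := ℝ) (φ := fun _ : Fin 3 => ℝ) j) u := hasFDerivAt_apply j u
  have hproj (i : Fin 4) {L : (Fin 3 → ℝ) →L[ℝ] ℝ}
      (hL : HasFDerivAt (fun u => sphereParam u i) L u) : fderiv ℝ sphereParam u v i = L v :=
    congrArg (fun L : (Fin 3 → ℝ) →L[ℝ] ℝ => L v)
      ((((EuclideanSpace.proj (𝕜 := ℝ) i).hasFDerivAt (x := sphereParam u)).comp u
        (contDiff_sphereParam.differentiable (by simp) u).hasFDerivAt).unique hL)
  apply R4.ext_coord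
  · refine (hproj 0 ((hcoord 0).cos.mul (hcoord 1).cos)).trans ?_
    simp only [neg_smul, smul_neg, add_apply, neg_apply, smul_apply,
      ContinuousLinearMap.proj_apply, smul_eq_mul, Matrix.cons_val]
    ring
  · refine (hproj 1 ((hcoord 0).cos.mul (hcoord 1).sin)).trans ?_
    simp only [neg_smul, smul_neg, add_apply, neg_apply, smul_apply,
      ContinuousLinearMap.proj_apply, smul_eq_mul, Matrix.cons_val]
    ring
  · refine (hproj 2 ((hcoord 0).sin.mul (hcoord 2).cos)).trans ?_
    simp only [neg_smul, smul_neg, add_apply, neg_apply, smul_apply,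
      ContinuousLinearMap.proj_apply, smul_eq_mul, Matrix.cons_val]
    ring
  · refine (hproj 3 ((hcoord 0).sin.mul (hcoord 2).sin)).trans ?_
    simp only [add_apply, smul_apply, ContinuousLinearMap.proj_apply, smul_eq_mul, Matrix.cons_val]
    ring

lemma sphereForm_sphereParam (u : Fin 3 → ℝ) :
    R4.sphereForm (sphereParam u) (fun i => fderiv ℝ sphereParam u (Pi.single i 1))
      = 2 * (sin (u 0) * cos (u 0)) := by
  rw [R4.sphereForm_apply, R4.detForm_eq, norm_sq_sphereParam]
  simp only [fderiv_sphereParam, sphereParam]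
  simp only [inv_one, one_pow, mul_one, Matrix.cons_val, Pi.single_eq_same, ne_eq,
    Fin.reduceEq, not_false_eq_true, Pi.single_eq_of_ne, mul_zero, sub_zero, add_zero]
  linear_combination 2 * sin (u 0) * cos (u 0) * ((sin (u 1) ^ 2 + cos (u 1) ^ 2)
    * (sin (u 2) ^ 2 + cos (u 2) ^ 2) * sin_sq_add_cos_sq (u 0)
    + (sin (u 2) ^ 2 + cos (u 2) ^ 2) * sin_sq_add_cos_sq (u 1) + sin_sq_add_cos_sq (u 2))

/-- The parametrization `sphereParam`, as a map to the sphere. -/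
def sphereMap : (Fin 3 → ℝ) → Sphere3 :=
  codRestrict sphereParam _ fun u => mem_sphere_zero_iff_norm.2 (norm_sphereParam u)

lemma contMDiff_sphereMap : ContMDiff 𝓘(ℝ, Fin 3 → ℝ) (𝓡 3) ∞ sphereMap := by
  have : Fact (Module.finrank ℝ R4 = 3 + 1) := ⟨finrank_euclideanSpace_fin⟩
  exact contDiff_sphereParam.contMDiff.codRestrict_sphere _

lemma sphereMap_add_two_pi (u : Fin 3 → ℝ) {i : Fin 3} (hi : i ≠ 0) :
    sphereMap (u + Pi.single i (2 * π)) = sphereMap u := by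
  have hcases : i = 1 ∨ i = 2 := by fin_cases i <;> simp_all
  ext1
  rcases hcases with rfl | rfl <;> simp [sphereMap, sphereParam]

lemma sphereMap_add_of_sin_eq_zero {u : Fin 3 → ℝ} (hu : sin (u 0) = 0) (t : ℝ) :
    sphereMap (u + t • Pi.single 2 1) = sphereMap u := by
  ext1
  simp [sphereMap, sphereParam, hu]

lemma sphereMap_add_of_cos_eq_zero {u : Fin 3 → ℝ} (hu : cos (u 0) = 0) (t : ℝ) :
    sphereMap (u + t • Pi.single 1 1) = sphereMap u := by
  ext1
  simp [sphereMap, sphereParam, hu]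

/-- The upper bounds of the angles in the parametrization `sphereMap`; the lower bounds are `0`. -/
def angleBound : Fin 3 → ℝ := ![π / 2, 2 * π, 2 * π]

lemma angleBound_pos (i : Fin 3) : 0 < angleBound i := by
  fin_cases i <;> simp [angleBound, pi_pos]

lemma pullback_sphereMap_face_eq (β : DiffForm (𝓡 3) Sphere3 2) (i : Fin 3) (y : Fin 2 → ℝ) :
    (pullback 𝓘(ℝ, Fin 3 → ℝ) sphereMap β (i.insertNth (angleBound i) y) :
        (Fin 3 → ℝ) [⋀^Fin 2]→L[ℝ] ℝ) (fun j => Pi.single (i.succAbove j) 1)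
      = (pullback 𝓘(ℝ, Fin 3 → ℝ) sphereMap β (i.insertNth 0 y) :
        (Fin 3 → ℝ) [⋀^Fin 2]→L[ℝ] ℝ) (fun j => Pi.single (i.succAbove j) 1) := by
  have hsphereMap : MDifferentiable 𝓘(ℝ, Fin 3 → ℝ) (𝓡 3) sphereMap :=
    contMDiff_sphereMap.mdifferentiable (by simp)
  by_cases hi : i = 0
  · -- The faces `a = 0` and `a = π / 2` are collapsed to circles.
    subst hi
    refine Eq.trans (b := (0 : ℝ)) ?_ (Eq.symm ?_)
    · refine pullback_apply_eq_zero_of_const hsphereMap (j := 0) (fun t => ?_) β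
      exact sphereMap_add_of_cos_eq_zero (by simp [angleBound]) t
    · refine pullback_apply_eq_zero_of_const hsphereMap (j := 1) (fun t => ?_) β
      exact sphereMap_add_of_sin_eq_zero (by simp) t
  · have hperiod : (i.insertNth (angleBound i) y : Fin 3 → ℝ)
        = i.insertNth 0 y + Pi.single i (2 * π) := by
      ext j
      refine Fin.succAboveCases i ?_ (fun j => ?_) j
      · fin_cases i <;> simp_all [angleBound]
      · simp
    rw [hperiod]
    exact pullback_add_of_invariant hsphereMap (fun u => sphereMap_add_two_pi u hi) β _ _

/-- The integral over `S³` of a three-form, computed in the parametrization `sphereMap`. -/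
def sphereIntegral (β : DiffForm (𝓡 3) Sphere3 3) : ℝ :=
  ∫ u in Icc (0 : Fin 3 → ℝ) angleBound,
    (pullback 𝓘(ℝ, Fin 3 → ℝ) sphereMap β u : (Fin 3 → ℝ) [⋀^Fin 3]→L[ℝ] ℝ)
      (fun i => Pi.single i 1)

lemma sphereIntegral_extDeriv {β : DiffForm (𝓡 3) Sphere3 2} (hβ : β.IsSmooth) :
    sphereIntegral β.extDeriv = 0 := by
  have hstokes := integral_extDeriv_eq_zero (fun i => (angleBound_pos i).le)
    ((contDiff_pullback contMDiff_sphereMap hβ).of_le (by simp)) (pullback_sphereMap_face_eq β)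
  simp_rw [extDeriv_pullback_eq contMDiff_sphereMap hβ] at hstokes
  exact hstokes

lemma pullback_sphereMap_sphereForm_apply (u : Fin 3 → ℝ) :
    (pullback 𝓘(ℝ, Fin 3 → ℝ) sphereMap
      (pullback (𝓡 3) (Subtype.val : Sphere3 → R4) (ofFun R4.sphereForm)) u :
        (Fin 3 → ℝ) [⋀^Fin 3]→L[ℝ] ℝ) (fun i => Pi.single i 1)
      = 2 * (sin (u 0) * cos (u 0)) := by
  have hcomp : pullback 𝓘(ℝ, Fin 3 → ℝ) sphereParam (ofFun R4.sphereForm) u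
      = pullback 𝓘(ℝ, Fin 3 → ℝ) sphereMap
        (pullback (𝓡 3) (Subtype.val : Sphere3 → R4) (ofFun R4.sphereForm)) u :=
    pullback_comp (g := (Subtype.val : Sphere3 → R4))
      (contMDiff_coe_sphere3.mdifferentiable (by simp) _)
      (contMDiff_sphereMap.mdifferentiable (by simp) u)
  rw [← hcomp, ← sphereForm_sphereParam]
  exact congrArg (fun L : (Fin 3 → ℝ) →L[ℝ] R4 =>
    R4.sphereForm (sphereParam u) (fun i => L (Pi.single i 1))) mfderiv_eq_fderiv

lemma sphereIntegral_sphereForm_pos :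
    0 < sphereIntegral (pullback (𝓡 3) (Subtype.val : Sphere3 → R4) (ofFun R4.sphereForm)) := by
  simp_rw [sphereIntegral, pullback_sphereMap_sphereForm_apply]
  have hcont : Continuous fun u : Fin 3 → ℝ => 2 * (sin (u 0) * cos (u 0)) := by fun_prop
  rw [setIntegral_pos_iff_support_of_nonneg_ae]
  · have hvolume : 0 < volume (pi univ fun i => Ioo ((0 : Fin 3 → ℝ) i) (angleBound i)) := by
      rw [Real.volume_pi_Ioo]
      simp [Fin.prod_univ_three, angleBound_pos]
    refine hvolume.trans_le (measure_mono fun u hu => ⟨?_, ?_⟩)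
    · have hpos : 0 < u 0 := (hu 0 (mem_univ _)).1
      have hlt : u 0 < π / 2 := (hu 0 (mem_univ _)).2
      have hsin := sin_pos_of_pos_of_lt_pi hpos (by linarith)
      have hcos := cos_pos_of_mem_Ioo ⟨by linarith, hlt⟩
      exact (by positivity : 2 * (sin (u 0) * cos (u 0)) ≠ 0)
    · exact ⟨fun i => (hu i (mem_univ _)).1.le, fun i => (hu i (mem_univ _)).2.le⟩
  · refine (ae_restrict_iff' measurableSet_Icc).2 (Filter.Eventually.of_forall fun u hu => ?_)
    have hnonneg : 0 ≤ u 0 := hu.1 0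
    have hle : u 0 ≤ π / 2 := hu.2 0
    have hsin := sin_nonneg_of_nonneg_of_le_pi hnonneg (by linarith)
    have hcos := cos_nonneg_of_mem_Icc ⟨by linarith, hle⟩
    exact (by positivity : 0 ≤ 2 * (sin (u 0) * cos (u 0)))
  · exact hcont.continuousOn.integrableOn_compact isCompact_Icc

end SphereIntegral

section Twisted

variable {E : Type*} [NormedAddCommGroup E] [NormedSpace ℝ E] {H : Type*} [TopologicalSpace H]
  {I : ModelWithCorners ℝ E H} {M : Type*} [TopologicalSpace M] [ChartedSpace H M]
  [IsManifold I ∞ M] [I.Boundaryless] [FiniteDimensional ℝ E]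
  {EK : Type*} [NormedAddCommGroup EK] [NormedSpace ℝ EK] {HK : Type*} [TopologicalSpace HK]
  {IK : ModelWithCorners ℝ EK HK} {K : Type*} [TopologicalSpace K] [ChartedSpace HK K]
  [IsManifold IK ∞ K] [IK.Boundaryless] [FiniteDimensional ℝ EK]
  {S : KahlerStructure IK K} {ι : Type*} (A : HopfAtlas I M S ι)

open DiffForm

namespace HopfAtlas

lemma pullback_torsion_eq {E' : Type*} [NormedAddCommGroup E'] [NormedSpace ℝ E'] {H' : Type*}
    [TopologicalSpace H'] {I' : ModelWithCorners ℝ E' H'} {N : Type*} [TopologicalSpace N]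
    [ChartedSpace H' N] {σ : N → M} {τ : N → R4} {i : ι} {x : N}
    (hσ : MDifferentiableAt I' I σ x) (hx : σ x ∈ (A.chart i).source)
    (hτ : ∀ᶠ y in 𝓝 x, (A.chart i (σ y)).2 = τ y) :
    pullback I' σ A.generalizedKahler.torsion x = pullback I' τ (ofFun R4.sphereForm) x :=
  calc pullback I' σ A.generalizedKahler.torsion x
    _ = pullback I' σ (pullback I (fun y => (A.chart i y).2) (ofFun R4.sphereForm)) x := by
      rw [pullback, pullback, A.torsion_eq hx]
    _ = pullback I' (fun y => (A.chart i (σ y)).2) (ofFun R4.sphereForm) x :=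
      (pullback_comp (((A.isSmooth i).contMDiffAt_snd hx).mdifferentiableAt (by simp)) hσ).symm
    _ = pullback I' τ (ofFun R4.sphereForm) x := pullback_congr hτ

lemma isTwisted_generalizedKahler {σ : Sphere3 → M} (hσ : ContMDiff (𝓡 3) I ∞ σ)
    (hA : ∀ q, ∃ i, σ q ∈ (A.chart i).source ∧
      ∀ᶠ q' in 𝓝 q, (A.chart i (σ q')).2 = (q' : R4)) :
    A.generalizedKahler.IsTwisted := by
  refine ⟨A.torsion_mem_closedForms, fun hexact => ?_⟩
  rw [Submodule.Quotient.mk_eq_zero, Submodule.mem_comap] at hexact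
  obtain ⟨α, hα, hαT⟩ := hexact
  replace hαT : α.extDeriv = A.generalizedKahler.torsion := hαT
  have hsmooth : (pullback (𝓡 3) σ α).IsSmooth :=
    isSmooth_of_forall_smoothAt fun q => (hα.smoothAt (σ q)).pullback (hσ q)
  have hprimitive : (pullback (𝓡 3) σ α).extDeriv
      = pullback (𝓡 3) (Subtype.val : Sphere3 → R4) (ofFun R4.sphereForm) := by
    funext q
    obtain ⟨i, hi, hi'⟩ := hA q
    rw [(hα.smoothAt (σ q)).extDeriv_pullback (hσ q), hαT]
    exact A.pullback_torsion_eq (hσ.mdifferentiable (by simp) q) hi hi'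
  have hzero := sphereIntegral_extDeriv hsmooth
  rw [hprimitive] at hzero
  exact sphereIntegral_sphereForm_pos.ne' hzero

end HopfAtlas

end Twisted

theorem mainTheorem5_general {EK : Type*} [NormedAddCommGroup EK] [NormedSpace ℝ EK]
    [FiniteDimensional ℝ EK] {HK : Type*} [TopologicalSpace HK] {IK : ModelWithCorners ℝ EK HK}
    [IK.Boundaryless] {K : Type*} [TopologicalSpace K] [ChartedSpace HK K] [IsManifold IK ∞ K]
    [T2Space K] [LocallyCompactSpace K] [Nonempty K] (S : KahlerStructure IK K)
    {ψ : K ≃ₘ⟮IK, IK⟯ K} (hψ : S.IsHolomorphicIsometry ψ) :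
    ∃ G : GeneralizedKahlerStructure ((IK.prod (𝓡 3)).prod 𝓘(ℝ, ℝ))
        (MappingTorus (ψ.prodCongr (Diffeomorph.refl (𝓡 3) Sphere3 ∞))),
      G.IsSplit ∧ G.IsTwisted ∧ G.InducesOppositeOrientations := by
  obtain ⟨p⟩ := ‹Nonempty K›
  let A := MappingTorus.hopfAtlas S hψ
  have hsection : ContMDiff (𝓡 3) ((IK.prod (𝓡 3)).prod 𝓘(ℝ, ℝ)) ∞
      (fun q : Sphere3 => (((p, q), 0) : (K × Sphere3) × ℝ)) :=
    (contMDiff_const.prodMk contMDiff_id).prodMk contMDiff_const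
  refine ⟨A.generalizedKahler, A.isSplit_generalizedKahler,
    A.isTwisted_generalizedKahler (σ := fun q => MappingTorus.mk _ ((p, q), 0))
      ((MappingTorus.contMDiff_mk _).comp hsection) fun q => ⟨((p, q), 0), ?_, ?_⟩,
    A.inducesOppositeOrientations_generalizedKahler⟩
  · exact ⟨(MappingTorus.isLocalHomeomorph_mk _).apply_self_mem_localInverseAt_source, mem_univ _⟩
  · filter_upwards [(hsection.continuous.tendsto q).eventually
      (MappingTorus.hopfAtlas_chart_mk_eventuallyEq S hψ ((p, q), 0))] with q' hq'
    refine (congrArg Prod.snd hq').trans ?_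
    simp

theorem mainTheorem5 (k : ℕ) (K : Type*) [TopologicalSpace K]
    [ChartedSpace (EuclideanSpace ℝ (Fin (2 * k))) K] [IsManifold (𝓡 (2 * k)) ∞ K]
    [T2Space K] [CompactSpace K] [Nonempty K]
    (S : KahlerStructure (𝓡 (2 * k)) K) (ψ : K ≃ₘ⟮𝓡 (2 * k), 𝓡 (2 * k)⟯ K)
    (hψ : S.IsHolomorphicIsometry ψ) :
    ∃ G : GeneralizedKahlerStructure (((𝓡 (2 * k)).prod (𝓡 3)).prod 𝓘(ℝ, ℝ))
        (MappingTorus (ψ.prodCongr (Diffeomorph.refl (𝓡 3) Sphere3 ∞))),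
      G.IsSplit ∧ G.IsTwisted ∧ G.InducesOppositeOrientations :=
  mainTheorem5_general S hψ
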